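/- Identify the unit circle $\mathbb S=\{z\in\mathbb C:|z|=1\}$ with $\mathbb R/\mathbb Z$ and let $\sigma(z)=z^3$, i.e. $\sigma(x)=3x$. For a set $Q\subset\mathbb S$, a hole of $Q$ is a positively oriented open arc $(a,b)$ which is a component of $\mathbb S\setminus Q$. A cubic lamination is an equivalence relation $\sim$ on $\mathbb S$ with closed graph and finite classes such that (i) if $t_1\sim t_2$, $t_3\sim t_4$ and $t_2\not\sim t_3$, then the open segments with endpoints $t_1,t_2$ and $t_3,t_4$ are disjoint; (ii) for every class $\mathbf g$ the set $\sigma(\mathbf g)$ is a class, and either $\sigma(\mathbf g)$ is a point or $(\sigma(a),\sigma(b))$ is a hole of $\sigma(\mathbf g)$ for every hole $(a,b)$ of $\mathbf g$. Its leaves are the edges of the convex hulls of its classes (together with the points of $\mathbb S$); its gaps are the closures of the components of the open unit disk minus the union of all leaves. The basis of a gap $G$ is $G\cap\mathbb S$, and $G$ is infinite if its basis is infinite. An invariant quadratic gap is an infinite gap $U$ such that $\sigma$ maps the basis of $U$ onto itself, takes every hole of the basis to a hole or collapses it (the endpoints of the hole have the same image), and the induced map of the boundary of $U$, with $\sigma$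 extended linearly over the edges of $U$, is a positively oriented composition of a monotone map and a covering map of degree $2$. A class is non-degenerate if it has more than one point. Let $\mathrm{FG}_a$ (respectively $\mathrm{FG}_b$) be the convex hull of all points $x\in\mathbb S$ all of whose iterates $\sigma^n(x)$, $n\ge 0$, lie on or above (respectively on or below) the chord $\overline{0\frac12}$. There is a unique cubic lamination $\sim_{ab}$ that has both $\mathrm{FG}_a$ and $\mathrm{FG}_b$ as gaps. Let $\sim_1$ and $\sim_2$ be cubic laminations, let $A$ be a non-degenerate class or an infinite gap of both $\sim_1$ and $\sim_2$, and suppose that each $\sim_i$ has an invariant quadratic gap $U_i$ $(i=1,2)$. Then $U_1=U_2$, except that, when $A$ is a non-degenerate class or an infinite gap of $\sim_{ab}$, it is also possible that $\{U_1,U_2\}=\{\mathrm{FG}_a,\mathrm{FG}_b\}$ (in either order). This exception does occur for every such $A$: $\mathrm{FG}_a\ne\mathrm{FG}_b$, and both are invariant quadratic gaps of $\sim_{ab}$ (so one may take $\sim_1=\sim_2=\sim_{ab}$). -/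

import Mathlib

noncomputable section

namespace CubicLam

/-- The unit circle, identified with `ℝ/ℤ` (angles measured in full turns). -/
abbrev Angle : Type := UnitAddCircle

/-- The point `exp (2 π i x)` of the unit circle in `ℂ` with angle `x`. -/
def pt (x : Angle) : ℂ := (AddCircle.toCircle x : ℂ)

/-- The map `z ↦ z ^ d` of the unit circle, written on angles. -/
def sig (d : ℕ) (x : Angle) : Angle := d • x

/-- The equivalence class of `x`. -/
def cls (r : Setoid Angle) (x : Angle) : Set Angle := {y | r x y}

/-- `(a, b)` is a positively oriented hole of `Q`: the open arc from `a` to `b` in the positive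
direction is a component of the complement of `Q` (for `Q` with at least two points). -/
def IsHole (Q : Set Angle) (a b : Angle) : Prop :=
  a ∈ Q ∧ b ∈ Q ∧ a ≠ b ∧ Disjoint (Set.cIoo a b) Q

/-- Laminations: closed equivalence relations on the circle with finite, pairwise unlinked
classes. -/
structure IsLamination (r : Setoid Angle) : Prop where
  closed : IsClosed {p : Angle × Angle | r p.1 p.2}
  unlinked : ∀ t₁ t₂ t₃ t₄ : Angle, r t₁ t₂ → r t₃ t₄ → ¬ r t₂ t₃ →
    Disjoint (openSegment ℝ (pt t₁) (pt t₂)) (openSegment ℝ (pt t₃) (pt t₄))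
  finite : ∀ x, (cls r x).Finite

/-- Invariance under `z ↦ z ^ d`: classes map onto classes, in a covering and orientation
preserving way (either the image of a class is a point, or holes map to holes). -/
structure IsInvariant (d : ℕ) (r : Setoid Angle) : Prop where
  forward : ∀ x, sig d '' cls r x = cls r (sig d x)
  covering : ∀ x, (∃ v, sig d '' cls r x = {v}) ∨
    ∀ a b, IsHole (cls r x) a b → IsHole (sig d '' cls r x) (sig d a) (sig d b)

/-- Cubic laminations are the laminations invariant under `z ↦ z ^ 3`. -/
structure IsCubicLamination (r : Setoid Angle) : Prop where
  lamination : IsLamination r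
  invariant : IsInvariant 3 r

/-- The chord with endpoints `a`, `b` is a leaf: an edge of the convex hull of a class
(for `a = b` this is a degenerate leaf, i.e. a point of the circle). -/
def IsLeaf (r : Setoid Angle) (a b : Angle) : Prop :=
  r a b ∧ segment ℝ (pt a) (pt b) ⊆ frontier (convexHull ℝ (pt '' cls r a))

/-- The union of all leaves. -/
def leafUnion (r : Setoid Angle) : Set ℂ :=
  {z | ∃ a b, IsLeaf r a b ∧ z ∈ segment ℝ (pt a) (pt b)}

/-- The open unit disk with all leaves removed. -/
def diskMinusLeaves (r : Setoid Angle) : Set ℂ := Metric.ball (0 : ℂ) 1 \ leafUnion r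

/-- A gap is the closure of a component of the open unit disk minus the union of all leaves. -/
def IsGap (r : Setoid Angle) (G : Set ℂ) : Prop :=
  ∃ z ∈ diskMinusLeaves r, G = closure (connectedComponentIn (diskMinusLeaves r) z)

/-- The basis of `G`: the intersection of `G` with the unit circle. -/
def basis (G : Set ℂ) : Set Angle := {x | pt x ∈ G}

/-- The map `z ↦ z ^ d`, extended over the edges of `G`, maps the boundary of `G` to the boundary
of the image of `G` as a positively oriented composition of a monotone map and a covering map of
degree `m`. The boundaries are parametrized by the circle (an edge by the hole behind it), and the
map is described by a lift `φ : ℝ → ℝ`: it is monotone of degree `m`, agrees with `z ↦ z ^ d` on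
the basis, and takes each hole once over its image hole, or collapses it (no hole is wrapped around
the circle). -/
def HasDegree (d : ℕ) (G : Set ℂ) (m : ℕ) : Prop :=
  (∀ a b, IsHole (basis G) a b →
    sig d a = sig d b ∨ IsHole (sig d '' basis G) (sig d a) (sig d b)) ∧
  ∃ φ : ℝ → ℝ, Continuous φ ∧ Monotone φ ∧ (∀ x, φ (x + 1) = φ x + m) ∧
    (∀ x : ℝ, (x : Angle) ∈ basis G → (φ x : Angle) = sig d (x : Angle)) ∧
    ∀ x y : ℝ, x < y → y < x + 1 → IsHole (basis G) (x : Angle) (y : Angle) → φ y < φ x + 1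

/-- An infinite gap (Fatou gap) is a gap with infinite basis. -/
def IsInfiniteGap (r : Setoid Angle) (G : Set ℂ) : Prop :=
  IsGap r G ∧ (basis G).Infinite

/-- `U` is an invariant quadratic gap of the cubic lamination `r`: an infinite gap which maps to
itself with degree two. -/
structure IsInvariantQuadraticGap (r : Setoid Angle) (U : Set ℂ) : Prop where
  infiniteGap : IsInfiniteGap r U
  invariant : sig 3 '' basis U = basis U
  degree : HasDegree 3 U 2

/-- `A` is a non-degenerate class (as a set of points of the unit circle in `ℂ`). -/
def IsNondegenerateClass (r : Setoid Angle) (A : Set ℂ) : Prop :=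
  ∃ x, (cls r x).Nontrivial ∧ A = pt '' cls r x

/-- `A` is a non-degenerate class or an infinite gap. -/
def IsClassOrInfiniteGap (r : Setoid Angle) (A : Set ℂ) : Prop :=
  IsNondegenerateClass r A ∨ IsInfiniteGap r A

/-- The convex hull of all points of the circle whose orbits under `z ↦ z ^ 3` lie above (or on)
the horizontal diameter. -/
def FGa : Set ℂ := convexHull ℝ (pt '' {x | ∀ n : ℕ, 0 ≤ (pt ((sig 3)^[n] x)).im})

/-- The convex hull of all points of the circle whose orbits under `z ↦ z ^ 3` lie below (or on)
the horizontal diameter. -/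
def FGb : Set ℂ := convexHull ℝ (pt '' {x | ∀ n : ℕ, (pt ((sig 3)^[n] x)).im ≤ 0})

end CubicLam

end

/-!
Write `σ` for the tripling map `sig 3` of the circle. The relation `sbtw a x b` says that `x` lies in
the open arc `(a, b)`.

**Gaps on the circle.** An infinite gap is the convex hull of its basis, and the bases are exactly
the infinite closed sets that no class separates and whose holes have equivalent endpoints
(`IsGapBasis`, `IsInfiniteGap.isGapBasis`, `IsGapBasis.isInfiniteGap`). Hence everything happens on
the circle. Images of gap bases under `σ` are gap bases (`IsGapBasis.image`), and a class, or a gap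
basis different from a given one `X`, lies behind a hole of `X`.

**The major hole.** Let `φ` be the lift of degree two of an invariant quadratic gap with basis `X`.
Since `3 x - φ x` is an integer on `X` and increases by one around the circle, exactly one hole
`(m, m')` has length `ℓ ≥ 1/3`; all other holes have length at most `1/6`, and they are eventually
mapped onto `(m, m')`. So `X` is the set of points whose orbits avoid `(m, m')`. Moreover `ℓ ≤ 1/2`,
and `ℓ = 1/2` only if `m` is fixed, that is, for the two special gaps (`IsMajor`, `exists_isMajor`,
`IsMajor.eq_gapSet`).

**Comparison.** Let `S` be a common class or a common gap basis of two laminations with major holes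
`(m, m') ≠ (p, p')` that are not both of length `1/2`. If all images of `S` lie behind holes of both
bases, then points of `S` and of its images are at most `1/6` apart: this is clear unless the holes
are the two major ones, and then their intersection is too short, for otherwise one of the major
holes would contain the other or the image of `S` could not lie behind a hole. So all distances in
`S` triple at each step, which is absurd (`false_of_behind_holes`, `IsMajor.eq_or_half`). It follows
that the gaps are equal, or both of them are special.

**The exception.** The lamination `abSetoid` has the class `{0, 1/2}`, and its other non-degenerate
classes consist of the endpoints of the middle thirds of the intervals between consecutive points
`j / (2 · 3 ^ n)`. Two points that are equivalent in a lamination with the first special gap and in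
a lamination with the second one are equivalent in `abSetoid`, again because otherwise their distance
would triple forever (`abRel_of_rel`). This gives the uniqueness of `abSetoid` as well as the fact
that a class or infinite gap common to two such laminations belongs to `abSetoid`
(`eq_abSetoid`, `IsClassOrInfiniteGap.ab`).
-/


noncomputable section

namespace CubicLam

open Set

/-! ### Arc lengths and the tripling map -/

/-- Length in `[0, 1)` of the arc running in the positive direction from `a` to `b`. -/
def arc (a b : Angle) : ℝ := (AddCircle.equivIco (1 : ℝ) 0 (b - a) : ℝ)

theorem arc_nonneg (a b : Angle) : 0 ≤ arc a b :=
  (AddCircle.equivIco (1 : ℝ) 0 (b - a)).2.1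

theorem arc_lt_one (a b : Angle) : arc a b < 1 :=
  (AddCircle.equivIco (1 : ℝ) 0 (b - a)).2.2.trans_eq (zero_add 1)

theorem coe_arc (a b : Angle) : ((arc a b : ℝ) : Angle) = b - a :=
  AddCircle.coe_equivIco

theorem coe_int (n : ℤ) : ((n : ℝ) : Angle) = 0 :=
  (AddCircle.coe_eq_zero_iff (1 : ℝ)).2 ⟨n, by simp⟩

theorem coe_eq_coe_iff {s t : ℝ} : (s : Angle) = t ↔ ∃ n : ℤ, t = s + n := by
  constructor
  · intro h
    have : ((t - s : ℝ) : Angle) = 0 := by rw [AddCircle.coe_sub, h, sub_self]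
    obtain ⟨n, hn⟩ := (AddCircle.coe_eq_zero_iff (1 : ℝ)).1 this
    exact ⟨n, by simp at hn; linarith⟩
  · rintro ⟨n, rfl⟩
    rw [AddCircle.coe_add, coe_int, add_zero]

theorem arc_unique {a b : Angle} {t : ℝ} (h0 : 0 ≤ t) (h1 : t < 1) (h : (t : Angle) = b - a) :
    arc a b = t := by
  rw [← coe_arc, coe_eq_coe_iff] at h
  obtain ⟨n, hn⟩ := h
  have h2 := arc_nonneg a b
  have h3 := arc_lt_one a b
  have : n = 0 := by
    have h4 : (n : ℝ) < 1 := by linarith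
    have h5 : (-1 : ℝ) < n := by linarith
    have h4' : n < 1 := by exact_mod_cast h4
    have h5' : -1 < n := by exact_mod_cast h5
    omega
  simp [this] at hn
  exact hn

theorem arc_add_coe (a : Angle) {t : ℝ} (h0 : 0 ≤ t) (h1 : t < 1) : arc a (a + t) = t :=
  arc_unique h0 h1 (by simp)

theorem add_arc (a b : Angle) : a + (arc a b : ℝ) = b := by
  rw [coe_arc]; abel

theorem arc_self (a : Angle) : arc a a = 0 := arc_unique le_rfl one_pos (by simp)

theorem arc_eq_zero {a b : Angle} : arc a b = 0 ↔ a = b := by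
  constructor
  · intro h
    have := add_arc a b
    rw [h] at this
    simpa using this
  · rintro rfl
    exact arc_self a

theorem arc_pos {a b : Angle} : 0 < arc a b ↔ a ≠ b := by
  rw [lt_iff_le_and_ne, ne_comm, Ne, arc_eq_zero]
  simp [arc_nonneg]

/-- Arc lengths are determined by the positions of the points relative to a base point `a`. -/
theorem arc_eq_ite (a x y : Angle) :
    arc x y = if arc a x ≤ arc a y then arc a y - arc a x else arc a y - arc a x + 1 := by
  have h1 := arc_nonneg a x
  have h2 := arc_nonneg a y
  have h3 := arc_lt_one a x
  have h4 := arc_lt_one a y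
  split_ifs with h
  · apply arc_unique (by linarith) (by linarith)
    rw [AddCircle.coe_sub, coe_arc, coe_arc]; abel
  · push Not at h
    apply arc_unique (by linarith) (by linarith)
    rw [AddCircle.coe_add, AddCircle.coe_sub, coe_arc, coe_arc, AddCircle.coe_period]; abel

theorem arc_of_le {a x y : Angle} (h : arc a x ≤ arc a y) : arc x y = arc a y - arc a x := by
  rw [arc_eq_ite a, if_pos h]

theorem arc_of_lt {a x y : Angle} (h : arc a y < arc a x) : arc x y = arc a y - arc a x + 1 := by
  rw [arc_eq_ite a, if_neg h.not_ge]

theorem arc_left_cancel {a x y : Angle} (h : arc a x = arc a y) : x = y := by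
  rw [← add_arc a x, ← add_arc a y, h]

theorem arc_right_cancel {a x y : Angle} (h : arc x a = arc y a) : x = y := by
  have h1 := (add_arc x a).trans (add_arc y a).symm
  rw [h] at h1
  exact add_right_cancel h1

theorem arc_swap {a b : Angle} (h : a ≠ b) : arc b a = 1 - arc a b := by
  rw [arc_of_lt (a := a) (by rw [arc_self]; exact arc_pos.2 h), arc_self]; ring

theorem sbtw_iff {a x b : Angle} : sbtw a x b ↔ 0 < arc a x ∧ arc a x < arc a b := by
  have key : btw a b x ↔ arc a b ≤ (AddCircle.equivIoc (1 : ℝ) 0 (x - a) : ℝ) := Iff.rfl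
  rw [sbtw_iff_not_btw, btw_cyclic, key, not_le]
  set u : ℝ := (AddCircle.equivIoc (1 : ℝ) 0 (x - a) : ℝ) with hu
  have hu0 : 0 < u := (AddCircle.equivIoc (1 : ℝ) 0 (x - a)).2.1
  have hu1 : u ≤ 1 := (AddCircle.equivIoc (1 : ℝ) 0 (x - a)).2.2.trans_eq (zero_add 1)
  have huc : (u : Angle) = x - a := AddCircle.coe_equivIoc
  constructor
  · intro h
    have : arc a x = u := arc_unique hu0.le (h.trans (arc_lt_one a b)) huc
    rw [this]; exact ⟨hu0, h⟩
  · rintro ⟨h1, h2⟩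
    rw [← coe_arc, coe_eq_coe_iff] at huc
    obtain ⟨n, hn⟩ := huc
    have h3 := arc_lt_one a x
    have : n = 0 := by
      have h4 : (n : ℝ) < 1 := by linarith
      have h5 : (-1 : ℝ) < n := by linarith
      have h4' : n < 1 := by exact_mod_cast h4
      have h5' : -1 < n := by exact_mod_cast h5
      omega
    simp [this] at hn
    rw [← hn]; exact h2

/-- The cyclic order in terms of the positions relative to a base point `u`. -/
theorem sbtw_base (u : Angle) {a x b : Angle} : sbtw a x b ↔
    (arc u a < arc u x ∧ arc u x < arc u b) ∨ (arc u b < arc u a ∧ arc u a < arc u x) ∨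
      (arc u x < arc u b ∧ arc u b < arc u a) := by
  have hx0 := arc_nonneg u x
  have hx1 := arc_lt_one u x
  have ha0 := arc_nonneg u a
  have ha1 := arc_lt_one u a
  have hb0 := arc_nonneg u b
  have hb1 := arc_lt_one u b
  rw [sbtw_iff, arc_eq_ite u a x, arc_eq_ite u a b]
  grind

theorem sbtw_trichotomy {a b : Angle} (h : a ≠ b) (x : Angle) :
    x = a ∨ x = b ∨ sbtw a x b ∨ sbtw b x a := by
  have h0 : 0 < arc a b := arc_pos.2 h
  rcases eq_or_ne x a with hxa | hxa
  · exact Or.inl hxa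
  have h1 : 0 < arc a x := arc_pos.2 hxa.symm
  rw [sbtw_base a, sbtw_base a, arc_self]
  rcases lt_trichotomy (arc a x) (arc a b) with h2 | h2 | h2
  · exact Or.inr (Or.inr (Or.inl (Or.inl ⟨h1, h2⟩)))
  · exact Or.inr (Or.inl (arc_left_cancel h2))
  · exact Or.inr (Or.inr (Or.inr (Or.inr (Or.inl ⟨h0, h2⟩))))

theorem arc_nsmul {a b : Angle} (n k : ℕ) (h1 : (k : ℝ) ≤ n * arc a b)
    (h2 : n * arc a b < k + 1) : arc (n • a) (n • b) = n * arc a b - k := by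
  apply arc_unique (by linarith) (by linarith)
  have : (k : ℝ) = ((k : ℤ) : ℝ) := by simp
  rw [AddCircle.coe_sub, this, coe_int, sub_zero, ← nsmul_eq_mul, AddCircle.coe_nsmul, coe_arc,
    smul_sub]

theorem sig_apply (x : Angle) : sig 3 x = 3 • x := rfl

theorem sig_iterate (n : ℕ) (x : Angle) : (sig 3)^[n] x = 3 ^ n • x := by
  induction n with
  | zero => simp
  | succ k ih => rw [Function.iterate_succ_apply', ih, sig, smul_smul, pow_succ, mul_comm]

theorem arc_sig {a b : Angle} (k : ℕ) (h1 : (k : ℝ) ≤ 3 * arc a b) (h2 : 3 * arc a b < k + 1) :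
    arc (sig 3 a) (sig 3 b) = 3 * arc a b - k := by
  have := arc_nsmul (a := a) (b := b) 3 k (by exact_mod_cast h1) (by exact_mod_cast h2)
  exact_mod_cast this

theorem continuous_sig : Continuous (sig 3) := continuous_nsmul 3

theorem continuousAt_arc {x y : Angle} (h : x ≠ y) : ContinuousAt (fun z => arc x z) y := by
  have h0 : y - x ≠ ((0 : ℝ) : Angle) := by
    rw [AddCircle.coe_zero]; exact sub_ne_zero.2 h.symm
  have h1 := AddCircle.continuousAt_equivIco (p := (1 : ℝ)) (a := 0) (x := y - x) h0
  have h2 : ContinuousAt (fun z : Angle => z - x) y := (continuous_sub_right x).continuousAt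
  exact continuous_subtype_val.continuousAt.comp
    (ContinuousAt.comp (f := fun z : Angle => z - x) h1 h2)

/-! ### Holes -/

theorem IsHole.not_sbtw {Q : Set Angle} {a b x : Angle} (h : IsHole Q a b) (hx : x ∈ Q) :
    ¬ sbtw a x b := fun hs => Set.disjoint_left.1 h.2.2.2 hs hx

theorem isHole_of {Q : Set Angle} {a b : Angle} (ha : a ∈ Q) (hb : b ∈ Q) (hab : a ≠ b)
    (h : ∀ x ∈ Q, ¬ sbtw a x b) : IsHole Q a b :=
  ⟨ha, hb, hab, Set.disjoint_left.2 fun x hs hx => h x hx hs⟩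

theorem IsHole.le_arc {Q : Set Angle} {a b x : Angle} (h : IsHole Q a b) (hx : x ∈ Q)
    (hxa : x ≠ a) : arc a b ≤ arc a x := by
  by_contra hlt
  exact h.not_sbtw hx (sbtw_iff.2 ⟨arc_pos.2 hxa.symm, not_le.1 hlt⟩)

theorem IsHole.right_unique {Q : Set Angle} {a b c : Angle} (h : IsHole Q a b)
    (h' : IsHole Q a c) : b = c :=
  arc_left_cancel (a := a)
    (le_antisymm (h.le_arc h'.2.1 h'.2.2.1.symm) (h'.le_arc h.2.1 h.2.2.1.symm))

theorem IsHole.le_arc' {Q : Set Angle} {a b x : Angle} (h : IsHole Q a b) (hx : x ∈ Q)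
    (hxb : x ≠ b) : arc a b ≤ arc x b := by
  rcases eq_or_ne x a with rfl | hxa
  · exact le_rfl
  have h1 := h.le_arc hx hxa
  rcases h1.eq_or_lt with h1 | h1
  · exact absurd (arc_left_cancel h1).symm hxb
  rw [arc_of_lt (a := a) h1]
  linarith [arc_lt_one a x]

theorem IsHole.left_unique {Q : Set Angle} {a b c : Angle} (h : IsHole Q a c)
    (h' : IsHole Q b c) : a = b :=
  arc_right_cancel (a := c)
    (le_antisymm (h.le_arc' h'.1 h'.2.2.1) (h'.le_arc' h.1 h.2.2.1))

/-- Two holes with a common point coincide. -/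
theorem IsHole.eq_of_sbtw {Q : Set Angle} {a b c d x : Angle} (h : IsHole Q a b)
    (h' : IsHole Q c d) (hx : sbtw a x b) (hx' : sbtw c x d) : a = c ∧ b = d := by
  have key : a = c := by
    by_contra hac
    have h1 := h.le_arc h'.1 (Ne.symm hac)
    have h2 := h'.le_arc h.1 hac
    rw [sbtw_iff] at hx hx'
    rw [arc_swap hac] at h2
    have h3 : arc a x < arc a c := by linarith
    rw [arc_of_lt (a := a) (x := c) (y := x) h3] at hx'
    linarith
  subst key
  exact ⟨rfl, h.right_unique h'⟩

/-- Every point outside a closed set with at least two points lies in a hole. -/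
theorem exists_hole {Q : Set Angle} (hQ : IsClosed Q) (hn : Q.Nontrivial) {x : Angle}
    (hx : x ∉ Q) : ∃ a b, IsHole Q a b ∧ sbtw a x b := by
  have hne : ∀ y ∈ Q, x ≠ y := fun y hy h => hx (h ▸ hy)
  have hc : ContinuousOn (fun z => arc x z) Q := fun y hy =>
    (continuousAt_arc (hne y hy)).continuousWithinAt
  obtain ⟨b, hb, hbmin⟩ := hQ.isCompact.exists_isMinOn hn.nonempty hc
  obtain ⟨a, ha, hamax⟩ := hQ.isCompact.exists_isMaxOn hn.nonempty hc
  have hmin : ∀ y ∈ Q, arc x b ≤ arc x y := fun y hy => hbmin hy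
  have hmax : ∀ y ∈ Q, arc x y ≤ arc x a := fun y hy => hamax hy
  have hab : arc x b < arc x a := by
    refine lt_of_le_of_ne (hmin a ha) fun h => ?_
    obtain ⟨u, hu, v, hv, huv⟩ := hn
    exact huv (arc_left_cancel (a := x) (by
      linarith [hmin u hu, hmin v hv, hmax u hu, hmax v hv]))
  have hb0 : 0 < arc x b := arc_pos.2 (hne b hb)
  have ne : a ≠ b := by rintro rfl; exact lt_irrefl _ hab
  refine ⟨a, b, isHole_of ha hb ne fun y hy hs => ?_, (sbtw_iff.2 ⟨hb0, hab⟩).cyclic_right⟩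
  rw [sbtw_iff, arc_of_lt (a := x) hab, arc_pos] at hs
  have h1 := hmax y hy
  have h2 := hmin y hy
  rcases h1.eq_or_lt with h1 | h1
  · exact hs.1 (arc_left_cancel h1).symm
  · rw [arc_of_lt (a := x) h1] at hs
    linarith

/-! ### Chords and sides -/

theorem norm_pt (x : Angle) : ‖pt x‖ = 1 := Circle.norm_coe _

theorem continuous_pt : Continuous pt := continuous_subtype_val.comp AddCircle.continuous_toCircle

theorem pt_injective : Function.Injective pt :=
  Subtype.val_injective.comp (AddCircle.injective_toCircle one_ne_zero)

theorem pt_coe (t : ℝ) :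
    pt (t : Angle) = Real.cos (2 * Real.pi * t) + Real.sin (2 * Real.pi * t) * Complex.I := by
  rw [pt, AddCircle.toCircle_apply_mk, Circle.coe_exp, div_one, Complex.exp_mul_I,
    Complex.ofReal_cos, Complex.ofReal_sin]

theorem pt_coe_re (t : ℝ) : (pt (t : Angle)).re = Real.cos (2 * Real.pi * t) := by
  rw [pt_coe]
  simp only [Complex.add_re, Complex.mul_re, Complex.ofReal_re, Complex.ofReal_im, Complex.I_re,
    Complex.I_im]
  ring

theorem pt_coe_im (t : ℝ) : (pt (t : Angle)).im = Real.sin (2 * Real.pi * t) := by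
  rw [pt_coe]
  simp only [Complex.add_im, Complex.mul_im, Complex.ofReal_re, Complex.ofReal_im, Complex.I_re,
    Complex.I_im]
  ring

theorem pt_add (x y : Angle) : pt (x + y) = pt x * pt y := by
  simp [pt, AddCircle.toCircle_add]

theorem exists_pt {z : ℂ} (h : ‖z‖ = 1) : ∃ x, pt x = z := by
  refine ⟨((z.arg / (2 * Real.pi) : ℝ) : Angle), ?_⟩
  rw [pt_coe, mul_div_cancel₀ _ (by positivity)]
  have := Complex.norm_mul_cos_add_sin_mul_I z
  rw [h] at this
  simpa using this

/-- The affine function that vanishes on the line through `pt a` and `pt b`; it is negative on the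
side of the open arc `(a, b)`. -/
def side (a b : Angle) (z : ℂ) : ℝ := (starRingEnd ℂ (pt b - pt a) * (z - pt a)).im

theorem continuous_side (a b : Angle) : Continuous (side a b) := by
  unfold side; fun_prop

theorem side_combo (a b : Angle) (z w : ℂ) {s t : ℝ} (h : s + t = 1) :
    side a b (s • z + t • w) = s * side a b z + t * side a b w := by
  obtain rfl : s = 1 - t := by linarith
  simp [side]
  ring

theorem side_swap (a b : Angle) (z : ℂ) : side b a z = - side a b z := by
  simp [side]; ring

theorem side_self (a : Angle) (z : ℂ) : side a a z = 0 := by simp [side]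

theorem side_left (a b : Angle) : side a b (pt a) = 0 := by simp [side]

theorem side_right (a b : Angle) : side a b (pt b) = 0 := by simp [side]; ring

theorem side_pt (a b x : Angle) : side a b (pt x) = 4 * Real.sin (Real.pi * (arc a x - arc a b)) *
    Real.sin (Real.pi * arc a b) * Real.sin (Real.pi * arc a x) := by
  have h1 : (pt a).re ^ 2 + (pt a).im ^ 2 = 1 := by
    have := Complex.sq_norm (pt a)
    rw [norm_pt, Complex.normSq_apply] at this
    linarith
  have hb : pt b = pt a * pt (arc a b : ℝ) := by rw [← pt_add, add_arc]
  have hx : pt x = pt a * pt (arc a x : ℝ) := by rw [← pt_add, add_arc]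
  rw [side, hb, hx]
  simp only [Complex.mul_im, Complex.mul_re, Complex.sub_re, Complex.sub_im, Complex.conj_re,
    Complex.conj_im, pt_coe_re, pt_coe_im]
  set s := Real.pi * arc a x with hs
  set t := Real.pi * arc a b with ht
  have e1 : 2 * Real.pi * arc a x = 2 * s := by rw [hs]; ring
  have e2 : 2 * Real.pi * arc a b = 2 * t := by rw [ht]; ring
  have e3 : Real.pi * (arc a x - arc a b) = s - t := by rw [hs, ht]; ring
  rw [e1, e2, e3, Real.sin_sub]
  simp only [Real.sin_two_mul, Real.cos_two_mul]
  have h2 := Real.sin_sq_add_cos_sq s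
  have h3 := Real.sin_sq_add_cos_sq t
  generalize Real.sin s = S at *
  generalize Real.cos s = C at *
  generalize Real.sin t = T at *
  generalize Real.cos t = K at *
  generalize (pt a).re = p at *
  generalize (pt a).im = q at *
  have hC : C ^ 2 = 1 - S ^ 2 := by linarith
  have hK : K ^ 2 = 1 - T ^ 2 := by linarith
  have hp : p ^ 2 = 1 - q ^ 2 := by linarith
  ring_nf
  simp only [hC, hK, hp]
  ring

theorem sin_pi_mul_pos {t : ℝ} (h0 : 0 < t) (h1 : t < 1) : 0 < Real.sin (Real.pi * t) :=
  Real.sin_pos_of_pos_of_lt_pi (by positivity) (by nlinarith [Real.pi_pos])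

theorem side_neg {a b x : Angle} (h : sbtw a x b) : side a b (pt x) < 0 := by
  rw [sbtw_iff] at h
  have h1 := arc_lt_one a b
  have e : Real.sin (Real.pi * (arc a x - arc a b)) =
      - Real.sin (Real.pi * (arc a b - arc a x)) := by
    rw [← Real.sin_neg]; congr 1; ring
  rw [side_pt, e]
  have i1 := sin_pi_mul_pos (t := arc a b - arc a x) (by linarith) (by linarith)
  have i2 := sin_pi_mul_pos (t := arc a b) (by linarith) (by linarith)
  have i3 := sin_pi_mul_pos (t := arc a x) (by linarith) (by linarith)
  have := mul_pos (mul_pos i1 i2) i3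
  linarith

theorem side_pos {a b x : Angle} (h : sbtw b x a) : 0 < side a b (pt x) := by
  rw [side_swap]
  linarith [side_neg h]

theorem side_nonneg {a b x : Angle} (h : ¬ sbtw a x b) : 0 ≤ side a b (pt x) := by
  rcases eq_or_ne a b with rfl | hab
  · rw [side_self]
  rcases sbtw_trichotomy hab x with rfl | rfl | h1 | h1
  · rw [side_left]
  · rw [side_right]
  · exact absurd h1 h
  · exact (side_pos h1).le

theorem sbtw_of_side_neg {a b x : Angle} (h : side a b (pt x) < 0) : sbtw a x b := by
  by_contra h1
  linarith [side_nonneg h1]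

theorem side_eq_zero_of_mem {a b : Angle} {z : ℂ} (h : z ∈ segment ℝ (pt a) (pt b)) :
    side a b z = 0 := by
  obtain ⟨s, t, _, _, hst, rfl⟩ := h
  rw [side_combo a b _ _ hst, side_left, side_right]; ring

/-- A point of the line through `pt a` and `pt b`, with the formula that decides whether it is
inside the disk or between the two points. -/
theorem exists_combo_of_side_eq_zero {a b : Angle} (hab : a ≠ b) {z : ℂ} (h : side a b z = 0) :
    ∃ t : ℝ, z = (1 - t) • pt a + t • pt b ∧
      1 - ‖z‖ ^ 2 = t * (1 - t) * ‖pt b - pt a‖ ^ 2 := by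
  have hne : pt b - pt a ≠ 0 := sub_ne_zero.2 fun h => hab (pt_injective h).symm
  set v := pt b - pt a with hv
  have hvz : v.re * (z - pt a).im - v.im * (z - pt a).re = 0 := by
    have := h
    simp only [side, ← hv, Complex.mul_im, Complex.conj_re, Complex.conj_im] at this
    linarith
  have hn : v.re ^ 2 + v.im ^ 2 ≠ 0 := by
    intro h0
    apply hne
    apply Complex.ext <;> simp <;> nlinarith [sq_nonneg v.re, sq_nonneg v.im]
  obtain ⟨t, ht⟩ : ∃ t : ℝ, t * (v.re ^ 2 + v.im ^ 2) =
      v.re * (z - pt a).re + v.im * (z - pt a).im := ⟨_, div_mul_cancel₀ _ hn⟩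
  have hz : z = (1 - t) • pt a + t • pt b := by
    have hb : pt b = pt a + v := by rw [hv]; ring
    rw [hb]
    rw [Complex.sub_re z, Complex.sub_im z] at hvz ht
    apply Complex.ext
    · simp only [Complex.add_re, Complex.real_smul, Complex.mul_re, Complex.ofReal_re,
        Complex.ofReal_im]
      apply mul_left_cancel₀ hn
      linear_combination (-v.im) * hvz - v.re * ht
    · simp only [Complex.add_im, Complex.real_smul, Complex.mul_im, Complex.ofReal_re,
        Complex.ofReal_im]
      apply mul_left_cancel₀ hn
      linear_combination v.re * hvz - v.im * ht
  refine ⟨t, hz, ?_⟩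
  have n1 := Complex.sq_norm (pt a)
  have n2 := Complex.sq_norm (pt b)
  rw [norm_pt, Complex.normSq_apply] at n1 n2
  rw [hz, Complex.sq_norm, Complex.sq_norm, Complex.normSq_apply, Complex.normSq_apply, hv]
  simp
  linear_combination (1 - t) * n1 + t * n2

theorem mem_segment_of_side_eq_zero {a b : Angle} (hab : a ≠ b) {z : ℂ} (hz : ‖z‖ ≤ 1)
    (h : side a b z = 0) : z ∈ segment ℝ (pt a) (pt b) := by
  obtain ⟨t, ht, hn⟩ := exists_combo_of_side_eq_zero hab h
  have hne : 0 < ‖pt b - pt a‖ ^ 2 := by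
    have : pt b - pt a ≠ 0 := sub_ne_zero.2 fun h => hab (pt_injective h).symm
    positivity
  have h0 : 0 ≤ t * (1 - t) := by
    by_contra hlt
    push Not at hlt
    nlinarith [norm_nonneg z]
  exact ⟨1 - t, t, by nlinarith, by nlinarith, by ring, ht.symm⟩

theorem mem_openSegment_of_side_eq_zero {a b : Angle} (hab : a ≠ b) {z : ℂ} (hz : ‖z‖ < 1)
    (h : side a b z = 0) : z ∈ openSegment ℝ (pt a) (pt b) := by
  obtain ⟨t, ht, hn⟩ := exists_combo_of_side_eq_zero hab h
  have hne : 0 < ‖pt b - pt a‖ ^ 2 := by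
    have : pt b - pt a ≠ 0 := sub_ne_zero.2 fun h => hab (pt_injective h).symm
    positivity
  have h0 : 0 < t * (1 - t) := by
    by_contra hlt
    push Not at hlt
    nlinarith [norm_nonneg z]
  exact ⟨1 - t, t, by nlinarith, by nlinarith, by ring, ht.symm⟩

theorem norm_lt_one_of_mem_openSegment {a b : Angle} (hab : a ≠ b) {z : ℂ}
    (hz : z ∈ openSegment ℝ (pt a) (pt b)) : ‖z‖ < 1 := by
  have h1 : pt a ∈ Metric.closedBall (0 : ℂ) 1 := by simp [norm_pt]
  have h2 : pt b ∈ Metric.closedBall (0 : ℂ) 1 := by simp [norm_pt]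
  have h := (strictConvex_closedBall ℝ (0 : ℂ) 1).openSegment_subset h1 h2
    (fun h => hab (pt_injective h)) hz
  rw [interior_closedBall _ one_ne_zero] at h
  simpa using h

/-- Chords whose endpoints separate each other intersect inside the disk. -/
theorem not_disjoint_of_cross {a b c d : Angle} (h1 : sbtw c a d) (h2 : sbtw d b c) :
    ¬ Disjoint (openSegment ℝ (pt a) (pt b)) (openSegment ℝ (pt c) (pt d)) := by
  have s1 := side_neg h1
  have s2 := side_pos h2
  have hab : a ≠ b := by rintro rfl; linarith
  have hcd : c ≠ d := by rintro rfl; rw [side_self] at s1; exact lt_irrefl _ s1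
  set p := side c d (pt a)
  set q := side c d (pt b)
  have hmem : (q / (q - p)) • pt a + (-p / (q - p)) • pt b ∈ openSegment ℝ (pt a) (pt b) :=
    ⟨q / (q - p), -p / (q - p), div_pos s2 (by linarith), div_pos (by linarith) (by linarith), by
      rw [← add_div, ← sub_eq_add_neg, div_self (by linarith)], rfl⟩
  refine Set.not_disjoint_iff.2 ⟨_, hmem, mem_openSegment_of_side_eq_zero hcd
    (norm_lt_one_of_mem_openSegment hab hmem) ?_⟩
  rw [side_combo]
  · change q / (q - p) * p + -p / (q - p) * q = 0
    ring
  · rw [← add_div, ← sub_eq_add_neg, div_self (by linarith)]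

theorem IsLamination.rel_of_cross {r : Setoid Angle} (hr : IsLamination r) {a b c d : Angle}
    (hab : r a b) (hcd : r c d) (h1 : sbtw c a d) (h2 : sbtw d b c) : r b c := by
  by_contra h
  exact not_disjoint_of_cross h1 h2 (hr.unlinked a b c d hab hcd h)

/-- Chords whose endpoints do not separate each other are disjoint inside the disk, unless they
have the same endpoints. -/
theorem disjoint_of_not_cross {a b c d : Angle} (hcd : c ≠ d) (h1 : ¬ sbtw c a d)
    (h2 : ¬ sbtw c b d) (h3 : (a ≠ c ∧ a ≠ d) ∨ (b ≠ c ∧ b ≠ d)) :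
    Disjoint (openSegment ℝ (pt a) (pt b)) (openSegment ℝ (pt c) (pt d)) := by
  rw [Set.disjoint_left]
  rintro _ ⟨s, t, hs, ht, hst, rfl⟩ hz
  have h0 := side_eq_zero_of_mem (openSegment_subset_segment _ _ _ hz)
  rw [side_combo c d _ _ hst] at h0
  have i1 := side_nonneg h1
  have i2 := side_nonneg h2
  rcases h3 with h3 | h3
  · have : 0 < side c d (pt a) := by
      rcases sbtw_trichotomy hcd a with h | h | h | h
      · exact absurd h h3.1
      · exact absurd h h3.2
      · exact absurd h h1
      · exact side_pos h
    nlinarith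
  · have : 0 < side c d (pt b) := by
      rcases sbtw_trichotomy hcd b with h | h | h | h
      · exact absurd h h3.1
      · exact absurd h h3.2
      · exact absurd h h2
      · exact side_pos h
    nlinarith

/-! ### Convex hulls of closed subsets of the circle -/

theorem convex_side_nonneg (a b : Angle) : Convex ℝ {z | 0 ≤ side a b z} := by
  intro z hz w hw s t hs ht hst
  simp only [mem_ofPred_eq] at *
  rw [side_combo a b _ _ hst]
  positivity

theorem side_nonneg_of_mem_hull {Q : Set Angle} {a b : Angle} (h : ∀ x ∈ Q, ¬ sbtw a x b) {z : ℂ}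
    (hz : z ∈ convexHull ℝ (pt '' Q)) : 0 ≤ side a b z :=
  convexHull_min (t := {z | 0 ≤ side a b z})
    (by rintro _ ⟨x, hx, rfl⟩; exact side_nonneg (h x hx)) (convex_side_nonneg a b) hz

theorem norm_le_one_of_mem_hull {Q : Set Angle} {z : ℂ}
    (hz : z ∈ convexHull ℝ (pt '' Q)) : ‖z‖ ≤ 1 := by
  have := convexHull_min (t := Metric.closedBall (0 : ℂ) 1)
    (by rintro _ ⟨x, hx, rfl⟩; simp [norm_pt]) (convex_closedBall _ _) hz
  simpa using this

theorem basis_hull {Q : Set Angle} (hQ : IsClosed Q) (hn : Q.Nontrivial) :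
    basis (convexHull ℝ (pt '' Q)) = Q := by
  ext x
  constructor
  · intro hx
    by_contra hxQ
    obtain ⟨a, b, h, hs⟩ := exists_hole hQ hn hxQ
    have := side_nonneg_of_mem_hull (fun x hx => h.not_sbtw hx) hx
    linarith [side_neg hs]
  · exact fun hx => subset_convexHull ℝ _ ⟨x, hx, rfl⟩

/-- A point of the disk which is on the inner side of every hole of `Q` belongs to the convex hull
of `Q`. The line from a point of `Q` through it leaves the disk in a point of `Q` or crosses the
chord of the hole in which it leaves. -/
theorem mem_hull_of_side_nonneg {Q : Set Angle} (hQ : IsClosed Q) (hn : Q.Nontrivial) {w : ℂ}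
    (hw : ‖w‖ ≤ 1) (h : ∀ a b, IsHole Q a b → 0 ≤ side a b w) : w ∈ convexHull ℝ (pt '' Q) := by
  obtain ⟨q, hq⟩ := hn.nonempty
  have hqh : pt q ∈ convexHull ℝ (pt '' Q) := subset_convexHull ℝ _ ⟨q, hq, rfl⟩
  rcases eq_or_ne w (pt q) with rfl | hwq
  · exact hqh
  have hpos : 0 < ‖w - pt q‖ := norm_pos_iff.2 (sub_ne_zero.2 hwq)
  have hle : ‖w - pt q‖ ≤ 2 := by
    have := norm_sub_le w (pt q); rw [norm_pt] at this; linarith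
  have hT : 1 ≤ 2 / ‖w - pt q‖ := by rw [le_div_iff₀ hpos]; linarith
  obtain ⟨t, ht, hnt⟩ : ∃ t ∈ Icc 1 (2 / ‖w - pt q‖), ‖pt q + t • (w - pt q)‖ = 1 := by
    have hc : ContinuousOn (fun t : ℝ => ‖pt q + t • (w - pt q)‖) (Icc 1 (2 / ‖w - pt q‖)) := by
      fun_prop
    refine intermediate_value_Icc hT hc ⟨by simpa using hw, ?_⟩
    have h1 : ‖(2 / ‖w - pt q‖) • (w - pt q)‖ = 2 := by
      rw [norm_smul, Real.norm_of_nonneg (by positivity), div_mul_cancel₀ _ hpos.ne']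
    have h2 := norm_sub_le (pt q + (2 / ‖w - pt q‖) • (w - pt q)) (pt q)
    rw [add_sub_cancel_left, h1, norm_pt] at h2
    linarith
  obtain ⟨y, hy⟩ := exists_pt hnt
  have ht0 : 0 < t := by linarith [ht.1]
  have hwy : w = (1 - 1 / t) • pt q + (1 / t) • pt y := by
    rw [hy, smul_add, smul_smul, one_div_mul_cancel ht0.ne', one_smul, sub_smul, one_smul]; abel
  have hs0 : 0 < 1 / t := by positivity
  have hs1 : 1 / t ≤ 1 := by rw [div_le_one ht0]; exact ht.1
  have hconv := convex_convexHull ℝ (pt '' Q)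
  by_cases hyQ : y ∈ Q
  · rw [hwy]
    exact hconv hqh (subset_convexHull ℝ _ ⟨y, hyQ, rfl⟩) (by linarith) hs0.le (by ring)
  obtain ⟨a, b, hab, hsb⟩ := exists_hole hQ hn hyQ
  have hsy := side_neg hsb
  have hsq := side_nonneg (hab.not_sbtw hq)
  have hsw := h a b hab
  rw [hwy, side_combo _ _ _ _ (by ring)] at hsw
  set s := 1 / t
  set p := side a b (pt q)
  set k := side a b (pt y)
  have hp : 0 < p := by
    rcases hsq.eq_or_lt with h0 | h0
    · rw [← h0] at hsw; nlinarith
    · exact h0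
  have hpk : 0 < p - k := by linarith
  have hv : (-k / (p - k)) • pt q + (p / (p - k)) • pt y ∈ convexHull ℝ (pt '' Q) := by
    have e : -k / (p - k) + p / (p - k) = 1 := by rw [← add_div, div_eq_one_iff_eq hpk.ne']; ring
    have h0 : side a b ((-k / (p - k)) • pt q + (p / (p - k)) • pt y) = 0 := by
      rw [side_combo _ _ _ _ e]
      change -k / (p - k) * p + p / (p - k) * k = 0
      ring
    have hnv : ‖(-k / (p - k)) • pt q + (p / (p - k)) • pt y‖ ≤ 1 := by
      have := convex_closedBall (0 : ℂ) 1 (x := pt q) (by simp [norm_pt]) (y := pt y)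
        (by simp [norm_pt]) (div_nonneg (by linarith) hpk.le) (div_nonneg hp.le hpk.le) e
      simpa using this
    exact hconv.segment_subset (subset_convexHull ℝ _ ⟨a, hab.1, rfl⟩)
      (subset_convexHull ℝ _ ⟨b, hab.2.1, rfl⟩) (mem_segment_of_side_eq_zero hab.2.2.1 hnv h0)
  have hle : s * (p - k) / p ≤ 1 := by rw [div_le_one hp]; nlinarith
  have := hconv hqh hv (a := 1 - s * (p - k) / p) (b := s * (p - k) / p) (by linarith)
    (by positivity) (by ring)
  convert this using 1
  rw [hwy, smul_add, smul_smul, smul_smul, ← add_assoc, ← add_smul]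
  congr 2 <;> field_simp
  ring

/-! ### Gaps of laminations -/

/-- No class of `r` has two points that separate two points of `S`. -/
def Unseparated (r : Setoid Angle) (S : Set Angle) : Prop :=
  ∀ a b, r a b → ∀ x ∈ S, ∀ y ∈ S, sbtw a x b → ¬ sbtw b y a

/-- The bases of the infinite gaps of `r`, described without reference to the disk: infinite closed
sets which are not separated by classes and whose holes have equivalent endpoints. -/
structure IsGapBasis (r : Setoid Angle) (Q : Set Angle) : Prop where
  closed : IsClosed Q
  infinite : Q.Infinite
  rel_of_isHole : ∀ a b, IsHole Q a b → r a b
  unseparated : Unseparated r Q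

theorem IsGapBasis.nontrivial {r : Setoid Angle} {Q : Set Angle} (h : IsGapBasis r Q) :
    Q.Nontrivial := h.infinite.nontrivial

theorem mem_cls_self (r : Setoid Angle) (x : Angle) : x ∈ cls r x := r.refl x

theorem cls_eq_of_rel {r : Setoid Angle} {x y : Angle} (h : r x y) : cls r x = cls r y := by
  ext z
  exact ⟨fun hz => r.trans (r.symm h) hz, fun hz => r.trans h hz⟩

theorem IsLamination.isClosed_cls {r : Setoid Angle} (hr : IsLamination r) (x : Angle) :
    IsClosed (cls r x) := (hr.finite x).isClosed

theorem segment_subset_frontier_hull {g : Set Angle} {u v : Angle} (h : IsHole g u v) :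
    segment ℝ (pt u) (pt v) ⊆ frontier (convexHull ℝ (pt '' g)) := by
  intro z hz
  have hzm : z ∈ convexHull ℝ (pt '' g) := (convex_convexHull ℝ _).segment_subset
    (subset_convexHull ℝ _ (mem_image_of_mem pt h.1))
    (subset_convexHull ℝ _ (mem_image_of_mem pt h.2.1)) hz
  refine ⟨subset_closure hzm, fun hint => ?_⟩
  have h0 := side_eq_zero_of_mem hz
  -- move from `z` slightly towards the point in the middle of the hole
  set p := u + ((arc u v / 2 : ℝ) : Angle) with hp
  have hpos := arc_pos.2 h.2.2.1
  have harc : arc u p = arc u v / 2 := arc_add_coe u (by linarith) (by linarith [arc_lt_one u v])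
  have hside := side_neg (sbtw_iff.2 ⟨by rw [harc]; linarith, by rw [harc]; linarith⟩ : sbtw u p v)
  have hc : Filter.Tendsto (fun t : ℝ => (1 - t) • z + t • pt p) (nhdsWithin 0 (Ioi 0)) (nhds z) := by
    have : Continuous (fun t : ℝ => (1 - t) • z + t • pt p) := by fun_prop
    have h1 := (this.tendsto 0).mono_left (nhdsWithin_le_nhds (s := Ioi 0))
    simpa using h1
  have hev := (hc.eventually (mem_interior_iff_mem_nhds.1 hint)).and self_mem_nhdsWithin
  obtain ⟨t, ht, ht0⟩ := hev.exists
  have h1 := side_nonneg_of_mem_hull (fun x hx => h.not_sbtw hx) ht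
  rw [side_combo _ _ _ _ (by ring), h0] at h1
  have ht0' : 0 < t := ht0
  nlinarith

theorem isLeaf_of_isHole {r : Setoid Angle} {x u v : Angle} (h : IsHole (cls r x) u v) :
    IsLeaf r u v := by
  refine ⟨r.trans (r.symm h.1) h.2.1, ?_⟩
  rw [← cls_eq_of_rel h.1]
  exact segment_subset_frontier_hull h

/-- The points of the open disk on the same side of every leaf as `z`. -/
def cell (r : Setoid Angle) (z : ℂ) : Set ℂ :=
  {w | ‖w‖ < 1 ∧ ∀ a b, IsLeaf r a b → a ≠ b → 0 < side a b z * side a b w}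

/-- The points of the closed disk that are not strictly separated from `z` by a leaf. -/
def closedCell (r : Setoid Angle) (z : ℂ) : Set ℂ :=
  {w | ‖w‖ ≤ 1 ∧ ∀ a b, IsLeaf r a b → 0 ≤ side a b z * side a b w}

theorem side_ne_zero_of_mem {r : Setoid Angle} {z : ℂ} (hz : z ∈ diskMinusLeaves r) {a b : Angle}
    (h : IsLeaf r a b) (hab : a ≠ b) : side a b z ≠ 0 := fun h0 =>
  hz.2 ⟨a, b, h, mem_segment_of_side_eq_zero hab (mem_ball_zero_iff.1 hz.1).le h0⟩

/-- The component of `z` is the convex set cut out by the sides of the leaves, as no leaf meets it.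
-/
theorem component_eq_cell {r : Setoid Angle} {z : ℂ} (hz : z ∈ diskMinusLeaves r) :
    connectedComponentIn (diskMinusLeaves r) z = cell r z := by
  apply Subset.antisymm
  · intro w hw
    have hw' := connectedComponentIn_subset _ _ hw
    refine ⟨mem_ball_zero_iff.1 hw'.1, fun a b hab hne => ?_⟩
    have hpre : IsPreconnected (side a b '' connectedComponentIn (diskMinusLeaves r) z) :=
      isPreconnected_connectedComponentIn.image _ (continuous_side a b).continuousOn
    have hoc := hpre.ordConnected
    have h0 : (0 : ℝ) ∉ side a b '' connectedComponentIn (diskMinusLeaves r) z := by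
      rintro ⟨u, hu, h0⟩
      exact side_ne_zero_of_mem (connectedComponentIn_subset _ _ hu) hab hne h0
    have hzm : side a b z ∈ side a b '' connectedComponentIn (diskMinusLeaves r) z :=
      ⟨z, mem_connectedComponentIn hz, rfl⟩
    have hwm : side a b w ∈ side a b '' connectedComponentIn (diskMinusLeaves r) z := ⟨w, hw, rfl⟩
    have i1 := side_ne_zero_of_mem hz hab hne
    have i2 := side_ne_zero_of_mem hw' hab hne
    rcases lt_or_gt_of_ne i1 with i1 | i1 <;> rcases lt_or_gt_of_ne i2 with i2 | i2
    · exact mul_pos_of_neg_of_neg i1 i2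
    · exact absurd (hoc.out hzm hwm ⟨i1.le, i2.le⟩) h0
    · exact absurd (hoc.out hwm hzm ⟨i2.le, i1.le⟩) h0
    · exact mul_pos i1 i2
  · have hconv : Convex ℝ (cell r z) := by
      intro u hu v hv s t hs ht hst
      refine ⟨?_, fun a b hab hne => ?_⟩
      · have := convex_ball (0 : ℂ) 1 (mem_ball_zero_iff.2 hu.1) (mem_ball_zero_iff.2 hv.1) hs ht hst
        exact mem_ball_zero_iff.1 this
      · rw [side_combo _ _ _ _ hst]
        have i1 := hu.2 a b hab hne
        have i2 := hv.2 a b hab hne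
        rcases hs.eq_or_lt with h0 | h0
        · have : t = 1 := by linarith
          subst this; rw [← h0]; linarith
        · nlinarith [mul_pos h0 i1, mul_nonneg ht i2.le]
    refine hconv.isPreconnected.subset_connectedComponentIn ⟨mem_ball_zero_iff.1 hz.1, ?_⟩ ?_
    · exact fun a b hab hne => mul_self_pos.2 (side_ne_zero_of_mem hz hab hne)
    · refine fun w hw => ⟨mem_ball_zero_iff.2 hw.1, ?_⟩
      rintro ⟨a, b, hab, hseg⟩
      rcases eq_or_ne a b with rfl | hne
      · rw [segment_same] at hseg
        have := hw.1
        rw [mem_singleton_iff.1 hseg, norm_pt] at this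
        exact lt_irrefl _ this
      · have := hw.2 a b hab hne
        rw [side_eq_zero_of_mem hseg, mul_zero] at this
        exact lt_irrefl _ this

theorem closure_cell {r : Setoid Angle} {z : ℂ} (hz : z ∈ diskMinusLeaves r) :
    closure (cell r z) = closedCell r z := by
  apply Subset.antisymm
  · apply closure_minimal
    · refine fun w hw => ⟨hw.1.le, fun a b hab => ?_⟩
      rcases eq_or_ne a b with rfl | hne
      · simp [side_self]
      · exact (hw.2 a b hab hne).le
    · have : closedCell r z = {w | ‖w‖ ≤ 1} ∩
          ⋂ (a) (b) (_ : IsLeaf r a b), {w | 0 ≤ side a b z * side a b w} := by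
        ext w; simp [closedCell]
      rw [this]
      refine (isClosed_le continuous_norm continuous_const).inter ?_
      refine isClosed_iInter fun a => isClosed_iInter fun b => isClosed_iInter fun _ => ?_
      exact isClosed_le continuous_const (continuous_const.mul (continuous_side a b))
  · intro w hw
    have hsub : openSegment ℝ z w ⊆ cell r z := by
      rintro _ ⟨s, t, hs, ht, hst, rfl⟩
      have hzn := mem_ball_zero_iff.1 hz.1
      refine ⟨?_, fun a b hab hne => ?_⟩
      · calc ‖s • z + t • w‖ ≤ ‖s • z‖ + ‖t • w‖ := norm_add_le _ _
          _ = s * ‖z‖ + t * ‖w‖ := by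
            rw [norm_smul, norm_smul, Real.norm_of_nonneg hs.le, Real.norm_of_nonneg ht.le]
          _ < 1 := by nlinarith [hw.1]
      · rw [side_combo _ _ _ _ hst]
        have i1 := mul_self_pos.2 (side_ne_zero_of_mem hz hab hne)
        have i2 := hw.2 a b hab
        nlinarith [mul_pos hs i1, mul_nonneg ht.le i2]
    exact closure_mono hsub (segment_subset_closure_openSegment (right_mem_segment ℝ z w))

theorem isGap_iff {r : Setoid Angle} {G : Set ℂ} :
    IsGap r G ↔ ∃ z ∈ diskMinusLeaves r, G = closedCell r z := by
  unfold IsGap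
  refine exists_congr fun z => and_congr_right fun hz => ?_
  rw [component_eq_cell hz, closure_cell hz]

theorem mem_basis_closedCell {r : Setoid Angle} {z : ℂ} {x : Angle} :
    x ∈ basis (closedCell r z) ↔ ∀ a b, IsLeaf r a b → 0 ≤ side a b z * side a b (pt x) := by
  simp [basis, closedCell, norm_pt]

theorem IsLeaf.symm {r : Setoid Angle} {a b : Angle} (h : IsLeaf r a b) : IsLeaf r b a := by
  refine ⟨r.symm h.1, ?_⟩
  rw [segment_symm, ← cls_eq_of_rel h.1]
  exact h.2

/-- The basis of an infinite gap is not separated by a class: the gap lies behind an edge of the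
convex hull of the class, because otherwise its basis would consist of points of the class. -/
theorem unseparated_basis {r : Setoid Angle} (hr : IsLamination r) {z : ℂ}
    (hz : z ∈ diskMinusLeaves r) (hinf : (basis (closedCell r z)).Infinite) :
    Unseparated r (basis (closedCell r z)) := by
  intro a b hab x hx y hy hxs hys
  have hne : a ≠ b := by rintro rfl; exact sbtw_irrefl_left_right hxs
  have hn : (cls r a).Nontrivial := ⟨a, mem_cls_self r a, b, hab, hne⟩
  obtain ⟨u, v, huv, hneg⟩ : ∃ u v, IsHole (cls r a) u v ∧ side u v z < 0 := by
    by_contra hcon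
    push Not at hcon
    refine hinf ((hr.finite a).subset fun p hp => ?_)
    by_contra hpg
    obtain ⟨u, v, huv, hpuv⟩ := exists_hole (hr.isClosed_cls a) hn hpg
    have i1 := mem_basis_closedCell.1 hp u v (isLeaf_of_isHole huv)
    have i2 := side_neg hpuv
    have i3 := (hcon u v huv).lt_of_ne'
      (side_ne_zero_of_mem hz (isLeaf_of_isHole huv) huv.2.2.1)
    nlinarith
  have key : ∀ p ∈ basis (closedCell r z), ¬ sbtw v p u := by
    intro p hp hs
    have i1 := mem_basis_closedCell.1 hp u v (isLeaf_of_isHole huv)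
    have i2 := side_pos hs
    nlinarith
  have kx := key x hx
  have ky := key y hy
  have ka := huv.not_sbtw (mem_cls_self r a)
  have kb := huv.not_sbtw hab
  have huv0 := arc_pos.2 huv.2.2.1
  have a0 := arc_nonneg u a
  have b0 := arc_nonneg u b
  have x0 := arc_nonneg u x
  have y0 := arc_nonneg u y
  rw [sbtw_base u, arc_self] at kx ky ka kb
  rw [sbtw_base u] at hxs hys
  grind

/-- The endpoints of a hole of the basis of a gap are equivalent: among the pairs of equivalent
points of the closed hole that cut off its midpoint there is one with maximal distance, and this
pair consists of the endpoints. -/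
theorem rel_of_isHole_basis {r : Setoid Angle} (hr : IsLamination r) {z : ℂ} {a b : Angle}
    (h : IsHole (basis (closedCell r z)) a b) : r a b := by
  set B := arc a b with hB
  have hB0 : 0 < B := arc_pos.2 h.2.2.1
  have hB1 : B < 1 := arc_lt_one a b
  have key : ∀ w, 0 < w → w < B → ∃ s t : ℝ, 0 ≤ s ∧ s < w ∧ w < t ∧ t ≤ B ∧
      r (a + (s : ℝ)) (a + (t : ℝ)) := by
    intro w hw0 hwB
    have haw : arc a (a + (w : ℝ)) = w := arc_add_coe a hw0.le (by linarith)
    have hwQ : a + ((w : ℝ) : Angle) ∉ basis (closedCell r z) := fun hm =>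
      h.not_sbtw hm (sbtw_iff.2 ⟨by rw [haw]; exact hw0, by rw [haw]; exact hwB⟩)
    obtain ⟨c, d, hcd, hside⟩ : ∃ c d, r c d ∧ sbtw c (a + (w : ℝ)) d ∧
        ¬ sbtw c a d ∧ ¬ sbtw c b d := by
      rw [mem_basis_closedCell] at hwQ
      push Not at hwQ
      obtain ⟨c, d, hl, hneg⟩ := hwQ
      have main : ∀ c d, IsLeaf r c d → side c d (pt (a + (w : ℝ))) < 0 → 0 < side c d z →
          r c d ∧ sbtw c (a + (w : ℝ)) d ∧ ¬ sbtw c a d ∧ ¬ sbtw c b d := by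
        intro c d hl i1 i2
        refine ⟨hl.1, sbtw_of_side_neg i1, fun hs => ?_, fun hs => ?_⟩
        · have := mem_basis_closedCell.1 h.1 c d hl
          nlinarith [side_neg hs]
        · have := mem_basis_closedCell.1 h.2.1 c d hl
          nlinarith [side_neg hs]
      rcases mul_neg_iff.1 hneg with ⟨i1, i2⟩ | ⟨i1, i2⟩
      · exact ⟨c, d, main c d hl i2 i1⟩
      · refine ⟨d, c, main d c hl.symm ?_ ?_⟩ <;> rw [side_swap] <;> linarith
    obtain ⟨h1, h2, h3⟩ := hside
    rw [sbtw_base a] at h1 h2 h3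
    rw [arc_self] at h2
    rw [haw] at h1
    have c0 := arc_nonneg a c
    have d0 := arc_nonneg a d
    refine ⟨arc a c, arc a d, c0, ?_, ?_, ?_, ?_⟩
    · grind
    · grind
    · grind
    · rwa [add_arc, add_arc]
  set W := B / 2 with hW
  set K : Set (ℝ × ℝ) := (Icc 0 W ×ˢ Icc W B) ∩ {p | r (a + (p.1 : ℝ)) (a + (p.2 : ℝ))} with hK
  have hKc : IsCompact K := by
    refine (isCompact_Icc.prod isCompact_Icc).inter_right ?_
    have hcont : Continuous fun p : ℝ × ℝ =>
        ((a + ((p.1 : ℝ) : Angle), a + ((p.2 : ℝ) : Angle)) : Angle × Angle) :=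
      (continuous_const.add ((AddCircle.continuous_mk' 1).comp continuous_fst)).prodMk
        (continuous_const.add ((AddCircle.continuous_mk' 1).comp continuous_snd))
    exact hr.closed.preimage hcont
  obtain ⟨s0, t0, hs0, hs0', ht0, ht0', hst0⟩ := key W (by linarith) (by linarith)
  obtain ⟨⟨s, t⟩, hst, hmax⟩ := hKc.exists_isMaxOn ⟨(s0, t0), ⟨⟨⟨hs0, hs0'.le⟩, ⟨ht0.le, ht0'⟩⟩, hst0⟩⟩
    (f := fun p => p.2 - p.1) (by fun_prop)
  have hmax' : ∀ s' t', 0 ≤ s' → s' ≤ W → W ≤ t' → t' ≤ B → r (a + (s' : ℝ)) (a + (t' : ℝ)) →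
      t' - s' ≤ t - s := fun s' t' h1 h2 h3 h4 h5 => hmax (a := (s', t')) ⟨⟨⟨h1, h2⟩, ⟨h3, h4⟩⟩, h5⟩
  obtain ⟨⟨⟨h1, h2⟩, ⟨h3, h4⟩⟩, h5⟩ := hst
  simp only [mem_ofPred_eq] at h1 h2 h3 h4 h5
  have hpos : ∀ u, 0 ≤ u → u ≤ B → arc a (a + (u : ℝ)) = u := fun u hu0 hu1 =>
    arc_add_coe a hu0 (by linarith)
  have hs : s = 0 := by
    by_contra hs
    obtain ⟨s', t', i1, i2, i3, i4, i5⟩ := key s (lt_of_le_of_ne h1 (Ne.symm hs)) (by linarith)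
    rcases le_or_gt t t' with i | i
    · have := hmax' s' t' i1 (by linarith) (by linarith) i4 i5
      linarith
    · have hr2 : r (a + (t : ℝ)) (a + (s' : ℝ)) := by
        apply hr.rel_of_cross h5 i5
        · rw [sbtw_base a, hpos s' i1 (by linarith), hpos s h1 (by linarith),
            hpos t' (by linarith) i4]
          exact Or.inl ⟨i2, i3⟩
        · rw [sbtw_base a, hpos s' i1 (by linarith), hpos t (by linarith) h4,
            hpos t' (by linarith) i4]
          exact Or.inr (Or.inl ⟨by linarith, by linarith⟩)
      have := hmax' s' t i1 (by linarith) h3 h4 (r.symm hr2)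
      linarith
  have ht : t = B := by
    by_contra ht
    obtain ⟨s', t', i1, i2, i3, i4, i5⟩ := key t (by linarith) (lt_of_le_of_ne h4 ht)
    subst hs
    rcases eq_or_lt_of_le i1 with i | i
    · subst i
      have := hmax' 0 t' le_rfl (by linarith) (by linarith) i4 i5
      linarith
    · have hr2 : r (a + (t' : ℝ)) (a + (0 : ℝ)) := by
        apply hr.rel_of_cross i5 h5
        · rw [sbtw_base a, hpos s' i1 (by linarith), hpos 0 le_rfl (by linarith),
            hpos t (by linarith) h4]
          exact Or.inl ⟨i, i2⟩
        · rw [sbtw_base a, hpos t' (by linarith) i4, hpos t (by linarith) h4,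
            hpos 0 le_rfl (by linarith)]
          exact Or.inr (Or.inl ⟨by linarith, by linarith⟩)
      have := hmax' 0 t' le_rfl h2 (by linarith) i4 (r.symm hr2)
      linarith
  subst hs
  subst ht
  rw [AddCircle.coe_zero, add_zero, add_arc] at h5
  exact h5

theorem isClosed_closedCell {r : Setoid Angle} {z : ℂ} (hz : z ∈ diskMinusLeaves r) :
    IsClosed (closedCell r z) := by
  rw [← closure_cell hz]; exact isClosed_closure

theorem isGapBasis_closedCell {r : Setoid Angle} (hr : IsLamination r) {z : ℂ}
    (hz : z ∈ diskMinusLeaves r) (hinf : (basis (closedCell r z)).Infinite) :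
    IsGapBasis r (basis (closedCell r z)) where
  closed := (isClosed_closedCell hz).preimage continuous_pt
  infinite := hinf
  rel_of_isHole _ _ h := rel_of_isHole_basis hr h
  unseparated := unseparated_basis hr hz hinf

/-- The holes of the basis of an infinite gap are leaves: the class of the endpoints has no points
on the side of the gap. -/
theorem IsGapBasis.isHole_cls {r : Setoid Angle} {Q : Set Angle}
    (hQ : IsGapBasis r Q) {a b : Angle} (h : IsHole Q a b) : IsHole (cls r a) b a := by
  refine isHole_of (hQ.rel_of_isHole a b h) (mem_cls_self r a) h.2.2.1.symm fun e he hs => ?_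
  refine hQ.infinite (Set.Finite.subset (Set.toFinite {a, b, e}) fun q hq => ?_)
  have h1 := hQ.unseparated a e he
  have h2 := hQ.unseparated b e (r.trans (r.symm (hQ.rel_of_isHole a b h)) he)
  have hqn := h.not_sbtw hq
  by_contra hmem
  simp only [mem_insert_iff, mem_singleton_iff, not_or] at hmem
  obtain ⟨ha, hb, hne⟩ := hmem
  have pq : 0 < arc a q := arc_pos.2 (Ne.symm ha)
  have pb : 0 < arc a b := arc_pos.2 h.2.2.1
  have nq : arc a q ≠ arc a e := fun h => hne (arc_left_cancel h)
  have nb : arc a q ≠ arc a b := fun h => hb (arc_left_cancel h)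
  have e0 := arc_nonneg a e
  have h1' := h1 b h.2.1 q hq
  have h2' := h2 q hq a h.1
  rw [sbtw_base a] at h1' h2' hqn hs
  rw [sbtw_base a] at h1' h2'
  rw [arc_self] at *
  grind

/-- Infinite gaps are the convex hulls of the gap bases. -/
theorem IsInfiniteGap.isGapBasis {r : Setoid Angle} (hr : IsLamination r) {G : Set ℂ}
    (hG : IsInfiniteGap r G) : IsGapBasis r (basis G) ∧ G = convexHull ℝ (pt '' basis G) := by
  obtain ⟨hgap, hinf⟩ := hG
  obtain ⟨z, hz, rfl⟩ := isGap_iff.1 hgap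
  have hQ := isGapBasis_closedCell hr hz hinf
  refine ⟨hQ, Subset.antisymm (fun w hw => ?_) ?_⟩
  · refine mem_hull_of_side_nonneg hQ.closed hQ.nontrivial hw.1 fun a b hab => ?_
    have hl : IsLeaf r a b := (isLeaf_of_isHole (hQ.isHole_cls hab)).symm
    have hzs : 0 < side a b z := by
      obtain ⟨q, hq, hqa, hqb⟩ : ∃ q ∈ basis (closedCell r z), q ≠ a ∧ q ≠ b := by
        by_contra hcon
        push Not at hcon
        exact hinf (Set.Finite.subset (Set.toFinite {a, b}) fun q hq => by
          by_cases h : q = a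
          · exact Or.inl h
          · exact Or.inr (hcon q hq h))
      have i1 := mem_basis_closedCell.1 hq a b hl
      have i2 : 0 < side a b (pt q) := by
        rcases sbtw_trichotomy hab.2.2.1 q with h | h | h | h
        · exact absurd h hqa
        · exact absurd h hqb
        · exact absurd h (hab.not_sbtw hq)
        · exact side_pos h
      have i3 := side_ne_zero_of_mem hz hl hab.2.2.1
      rcases lt_or_gt_of_ne i3 with i3 | i3
      · nlinarith
      · exact i3
    have := hw.2 a b hl
    by_contra hlt
    nlinarith
  · apply convexHull_min
    · rintro _ ⟨x, hx, rfl⟩; exact hx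
    · intro u hu v hv s t hs ht hst
      refine ⟨?_, fun a b hab => ?_⟩
      · have := convex_closedBall (0 : ℂ) 1 (mem_closedBall_zero_iff.2 hu.1)
          (mem_closedBall_zero_iff.2 hv.1) hs ht hst
        exact mem_closedBall_zero_iff.1 this
      · rw [side_combo _ _ _ _ hst]
        nlinarith [mul_nonneg hs (hu.2 a b hab), mul_nonneg ht (hv.2 a b hab)]

/-- The convex hull of a gap basis is an infinite gap. It is the closed cell of the centre of a
triangle with vertices in the basis: leaves do not separate the basis, and the holes of the basis
are leaves. -/
theorem IsGapBasis.isInfiniteGap {r : Setoid Angle} {Q : Set Angle}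
    (hQ : IsGapBasis r Q) : IsInfiniteGap r (convexHull ℝ (pt '' Q)) := by
  refine ⟨?_, by rw [basis_hull hQ.closed hQ.nontrivial]; exact hQ.infinite⟩
  obtain ⟨p, hp⟩ := hQ.nontrivial.nonempty
  obtain ⟨q, hq, hqp⟩ := hQ.nontrivial.exists_ne p
  obtain ⟨s, hs, hsp, hsq⟩ : ∃ s ∈ Q, s ≠ p ∧ s ≠ q := by
    by_contra hcon
    push Not at hcon
    exact hQ.infinite (Set.Finite.subset (Set.toFinite {p, q}) fun s hs => by
      by_cases h : s = p
      · exact Or.inl h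
      · exact Or.inr (hcon s hs h))
  -- the centre of a triangle with vertices in `Q` is not on a leaf
  obtain ⟨z, hz⟩ : ∃ z : ℂ, z =
      (1 / 3 : ℝ) • pt s + (2 / 3 : ℝ) • ((1 / 2 : ℝ) • pt p + (1 / 2 : ℝ) • pt q) :=
    ⟨_, rfl⟩
  have hside : ∀ a b, side a b z = (side a b (pt s) + side a b (pt p) + side a b (pt q)) / 3 := by
    intro a b
    rw [hz, side_combo _ _ _ _ (by norm_num), side_combo _ _ _ _ (by norm_num)]; ring
  have hpos : ∀ a b, a ≠ b → (∀ x ∈ Q, ¬ sbtw a x b) → 0 < side a b z := by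
    intro a b hab h
    rw [hside]
    have i1 := side_nonneg (h s hs)
    have i2 := side_nonneg (h p hp)
    have i3 := side_nonneg (h q hq)
    have main : ∀ x ∈ Q, x ≠ a → x ≠ b → 0 < side a b (pt x) := by
      intro x hx h1 h2
      rcases sbtw_trichotomy hab x with h' | h' | h' | h'
      · exact absurd h' h1
      · exact absurd h' h2
      · exact absurd h' (h x hx)
      · exact side_pos h'
    have : 0 < side a b (pt s) ∨ 0 < side a b (pt p) ∨ 0 < side a b (pt q) := by
      by_contra hcon
      push Not at hcon
      have f : ∀ x ∈ Q, side a b (pt x) ≤ 0 → x = a ∨ x = b := by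
        intro x hx hle
        by_contra hne
        push Not at hne
        linarith [main x hx hne.1 hne.2]
      have f1 := f s hs hcon.1
      have f2 := f p hp hcon.2.1
      have f3 := f q hq hcon.2.2
      grind
    rcases this with h' | h' | h' <;> linarith
  have hunsep : ∀ a b, r a b → (∀ x ∈ Q, ¬ sbtw a x b) ∨ (∀ x ∈ Q, ¬ sbtw b x a) := by
    intro a b hab
    by_contra hcon
    push Not at hcon
    obtain ⟨⟨x, hx, hxs⟩, ⟨y, hy, hys⟩⟩ := hcon
    exact hQ.unseparated a b hab x hx y hy hxs hys
  have hzn : ‖z‖ < 1 := by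
    have h1 : (1 / 2 : ℝ) • pt p + (1 / 2 : ℝ) • pt q ∈ openSegment ℝ (pt p) (pt q) :=
      ⟨1 / 2, 1 / 2, by norm_num, by norm_num, by norm_num, rfl⟩
    have h2 := norm_lt_one_of_mem_openSegment hqp.symm h1
    rw [hz]
    refine (norm_add_le _ _).trans_lt ?_
    rw [norm_smul, norm_smul, norm_pt, Real.norm_of_nonneg (by norm_num),
      Real.norm_of_nonneg (by norm_num)]
    linarith
  have hzm : z ∈ diskMinusLeaves r := by
    refine ⟨mem_ball_zero_iff.2 hzn, ?_⟩
    rintro ⟨a, b, hab, hseg⟩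
    rcases eq_or_ne a b with rfl | hne
    · rw [segment_same] at hseg
      rw [mem_singleton_iff.1 hseg, norm_pt] at hzn
      exact lt_irrefl _ hzn
    · have h0 := side_eq_zero_of_mem hseg
      rcases hunsep a b hab.1 with h | h
      · linarith [hpos a b hne h]
      · have := hpos b a hne.symm h
        rw [side_swap] at this
        linarith
  refine isGap_iff.2 ⟨z, hzm, Subset.antisymm (fun w hw => ⟨norm_le_one_of_mem_hull hw, ?_⟩) ?_⟩
  · intro a b hab
    rcases eq_or_ne a b with rfl | hne
    · simp [side_self]
    rcases hunsep a b hab.1 with h | h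
    · exact mul_nonneg (hpos a b hne h).le (side_nonneg_of_mem_hull h hw)
    · rw [side_swap b a z, side_swap b a w, neg_mul_neg]
      exact mul_nonneg (hpos b a hne.symm h).le (side_nonneg_of_mem_hull h hw)
  · intro w hw
    refine mem_hull_of_side_nonneg hQ.closed hQ.nontrivial hw.1 fun a b hab => ?_
    have hl : IsLeaf r a b := (isLeaf_of_isHole (hQ.isHole_cls hab)).symm
    have i1 := hpos a b hab.2.2.1 fun x hx => hab.not_sbtw hx
    have i2 := hw.2 a b hl
    by_contra hlt
    nlinarith

/-! ### Images of classes and gap bases -/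

theorem exists_isHole_left {g : Set Angle} (hg : g.Finite) (hn : g.Nontrivial) {q : Angle}
    (hq : q ∈ g) : ∃ p, IsHole g p q := by
  obtain ⟨y, hy, hyq⟩ := hn.exists_ne q
  obtain ⟨p, ⟨hp, hpq⟩, hmin⟩ := Set.exists_min_image (g \ {q}) (fun p => arc p q)
    (hg.subset sdiff_subset) ⟨y, hy, hyq⟩
  have hpq' : p ≠ q := hpq
  refine ⟨p, isHole_of hp hq hpq' fun x hx hs => ?_⟩
  rw [sbtw_iff] at hs
  have hxq : x ≠ q := by rintro rfl; exact lt_irrefl _ hs.2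
  have := hmin x ⟨hx, hxq⟩
  rw [arc_of_le (a := p) hs.2.le] at this
  linarith

theorem finite_fiber (b : Angle) : {q | sig 3 q = b}.Finite := by
  rcases Set.eq_empty_or_nonempty {q | sig 3 q = b} with h | ⟨q0, h0⟩
  · rw [h]; exact Set.finite_empty
  have ht : {u : Angle | 3 • u = 0}.Finite := AddCircle.finite_torsion (1 : ℝ) (by norm_num)
  refine (ht.image (fun u => u + q0)).subset fun q hq => ⟨q - q0, ?_, by simp⟩
  have h1 : 3 • q = b := hq
  have h2 : 3 • q0 = b := h0
  simp [smul_sub, h1, h2]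

/-- Lengths are tripled up to the number of full turns. -/
theorem exists_nat_of_arc (x q : Angle) : ∃ k : ℕ, 3 * arc x q = arc (sig 3 x) (sig 3 q) + k := by
  have h0 := arc_nonneg x q
  refine ⟨⌊3 * arc x q⌋₊, ?_⟩
  rw [arc_sig ⌊3 * arc x q⌋₊ (Nat.floor_le (by linarith)) (Nat.lt_floor_add_one _)]
  ring

theorem sig_add_coe (x : Angle) (s : ℝ) : sig 3 (x + (s : ℝ)) = sig 3 x + ((3 * s : ℝ) : Angle) := by
  rw [sig_apply, sig_apply, smul_add, ← AddCircle.coe_nsmul]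
  simp

/-- If `σ x` and `σ y` lie on different sides of an edge `(a, b)` of a class, then `x` and `y` are
separated by a class over it. Otherwise every class has as many preimages of `a` in the arc from
`x` to `y` as of `b`, while going around that arc one passes over `b` once more than over `a`. -/
theorem exists_separating {r : Setoid Angle} (hr : IsCubicLamination r) {a b x y : Angle}
    (hab : IsHole (cls r a) a b) (hx : sbtw a (sig 3 x) b) (hy : sbtw b (sig 3 y) a) :
    ∃ q q', sig 3 q = b ∧ sig 3 q' = a ∧ r q q' ∧ sbtw x q y ∧ sbtw y q' x := by
  by_contra hcon
  push Not at hcon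
  have hne := hab.2.2.1
  have hxa : sig 3 x ≠ a := by rintro rfl; exact sbtw_irrefl_left hx
  have hya : sig 3 y ≠ a := by rintro rfl; exact sbtw_irrefl_right hy
  have hxy : x ≠ y := by rintro rfl; exact sbtw_asymm hx hy.cyclic_right.cyclic_right.cyclic_right
  -- the predecessor of a preimage of `b` in its class is a preimage of `a`
  have hpred : ∀ q, sig 3 q = b → sbtw x q y →
      ∃ p, IsHole (cls r q) p q ∧ sig 3 p = a ∧ sbtw x p y := by
    intro q hqb hq
    have himg : sig 3 '' cls r q = cls r a := by
      rw [hr.invariant.forward, hqb, cls_eq_of_rel hab.2.1]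
    have hcov : ¬ ∃ v, sig 3 '' cls r q = {v} := by
      rintro ⟨v, hv⟩
      rw [himg] at hv
      have h1 := hv ▸ hab.1
      have h2 := hv ▸ hab.2.1
      rw [mem_singleton_iff] at h1 h2
      exact hne (h1.trans h2.symm)
    have hn : (cls r q).Nontrivial := by
      by_contra hns
      rw [Set.not_nontrivial_iff] at hns
      have := (hns.image (sig 3)) (himg ▸ hab.1) (himg ▸ hab.2.1)
      exact hne this
    obtain ⟨p, hp⟩ := exists_isHole_left (hr.lamination.finite q) hn (mem_cls_self r q)
    have hp' := (hr.invariant.covering q).resolve_left hcov p q hp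
    rw [himg, hqb] at hp'
    have hpa := hp'.left_unique hab
    refine ⟨p, hp, hpa, ?_⟩
    have h1 := hcon q p hqb hpa hp.1 hq
    have hpx : p ≠ x := by rintro rfl; exact hxa hpa
    have hpy : p ≠ y := by rintro rfl; exact hya hpa
    exact ((sbtw_trichotomy hxy p).resolve_left hpx).resolve_left hpy |>.resolve_right h1
  choose! pred hpred using hpred
  set u := sig 3 x with hu
  have hα0 := arc_nonneg u a
  have hβ0 := arc_nonneg u b
  have hα1 := arc_lt_one u a
  obtain ⟨hb0, hba⟩ : 0 < arc u b ∧ arc u b < arc u a := by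
    rw [sbtw_base u, arc_self] at hx
    grind
  obtain ⟨hγ1, hγ2⟩ : arc u b < arc u (sig 3 y) ∧ arc u (sig 3 y) < arc u a := by
    rw [sbtw_base u] at hy
    grind
  obtain ⟨k, hk⟩ := exists_nat_of_arc x y
  rw [← hu] at hk
  have ht1 := arc_lt_one x y
  set δ := (arc u a - arc u b) / 3 with hδ
  set F := {q | sig 3 q = b ∧ sbtw x q y} with hF
  have hFfin : F.Finite := (finite_fiber b).subset fun q hq => hq.1
  -- translation by `-δ` maps preimages of `a` to preimages of `b`
  have htr : ∀ p, sig 3 p = a → sbtw x p y → arc x (p - (δ : ℝ)) = arc x p - δ ∧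
      p - (δ : ℝ) ∈ F := by
    intro p hpa hp
    rw [sbtw_iff] at hp
    obtain ⟨i, hi⟩ := exists_nat_of_arc x p
    rw [hpa, ← hu] at hi
    have hi0 : (0 : ℝ) ≤ i := by positivity
    have e : arc x (p - (δ : ℝ)) = arc x p - δ := by
      apply arc_unique
      · linarith
      · linarith
      · rw [AddCircle.coe_sub, coe_arc]; abel
    refine ⟨e, ?_, ?_⟩
    · have h3 : sig 3 (p - (δ : ℝ)) = a - ((3 * δ : ℝ) : Angle) := by
        have := sig_add_coe p (-δ)
        rw [hpa, AddCircle.coe_neg, ← sub_eq_add_neg] at this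
        rw [this]; simp [sub_eq_add_neg]
      rw [h3, hδ, mul_div_cancel₀ _ (by norm_num : (3 : ℝ) ≠ 0), AddCircle.coe_sub, coe_arc, coe_arc]
      abel
    · rw [sbtw_iff, e]
      exact ⟨by linarith, by linarith⟩
  set f : Angle → Angle := fun q => pred q - (δ : ℝ) with hf
  have hinj : InjOn f F := by
    intro q1 h1 q2 h2 h12
    have hpp : pred q1 = pred q2 := sub_left_injective h12
    obtain ⟨i1, -, -⟩ := hpred q1 h1.1 h1.2
    obtain ⟨i2, -, -⟩ := hpred q2 h2.1 h2.2
    rw [← hpp] at i2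
    have : cls r q1 = cls r q2 := by rw [cls_eq_of_rel i1.1, cls_eq_of_rel i2.1]
    rw [this] at i1
    exact i1.right_unique i2
  -- the last preimage of `b` before `y` is missed by the translation
  set q0 : Angle := x + (((arc u b + k) / 3 : ℝ) : Angle) with hq0
  have hk0 : (0 : ℝ) ≤ k := by positivity
  have harc0 : arc x q0 = (arc u b + k) / 3 := arc_add_coe x (by positivity) (by linarith)
  have hq0F : q0 ∈ F := by
    refine ⟨?_, ?_⟩
    · rw [hq0, sig_add_coe, mul_div_cancel₀ _ (by norm_num : (3 : ℝ) ≠ 0), AddCircle.coe_add,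
        ← hu, ← add_assoc, add_arc]
      have : (k : ℝ) = ((k : ℤ) : ℝ) := by simp
      rw [this, coe_int, add_zero]
    · rw [sbtw_iff, harc0]
      exact ⟨by positivity, by linarith⟩
  have hsub : f '' F ⊆ F \ {q0} := by
    rintro _ ⟨q, hq, rfl⟩
    obtain ⟨-, i2, i3⟩ := hpred q hq.1 hq.2
    obtain ⟨j1, j2⟩ := htr _ i2 i3
    refine ⟨j2, fun h => ?_⟩
    rw [mem_singleton_iff] at h
    change pred q - (δ : ℝ) = q0 at h
    rw [h, harc0] at j1
    rw [sbtw_iff] at i3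
    linarith [i3.2]
  have h1 := Set.ncard_le_ncard hsub (hFfin.subset sdiff_subset)
  rw [hinj.ncard_image] at h1
  have h2 := Set.ncard_sdiff_singleton_lt_of_mem hq0F hFfin
  omega

theorem IsCubicLamination.image_cls {r : Setoid Angle} (hr : IsCubicLamination r) (x : Angle) :
    sig 3 '' cls r x = cls r (sig 3 x) := hr.invariant.forward x

theorem IsCubicLamination.rel_sig {r : Setoid Angle} (hr : IsCubicLamination r) {x y : Angle}
    (h : r x y) : r (sig 3 x) (sig 3 y) := by
  have : sig 3 y ∈ cls r (sig 3 x) := by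
    rw [← hr.image_cls]; exact mem_image_of_mem _ h
  exact this

/-- Holes of classes with distinct images of the endpoints are mapped to holes. -/
theorem IsCubicLamination.isHole_sig {r : Setoid Angle} (hr : IsCubicLamination r) {x p q : Angle}
    (h : IsHole (cls r x) p q) (hne : sig 3 p ≠ sig 3 q) :
    IsHole (cls r (sig 3 x)) (sig 3 p) (sig 3 q) := by
  rw [← hr.image_cls]
  refine (hr.invariant.covering x).resolve_left ?_ p q h
  rintro ⟨v, hv⟩
  have h1 : sig 3 p ∈ sig 3 '' cls r x := mem_image_of_mem _ h.1
  have h2 : sig 3 q ∈ sig 3 '' cls r x := mem_image_of_mem _ h.2.1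
  rw [hv] at h1 h2
  exact hne (h1.trans h2.symm)

/-- An unseparated set behind an edge of a class, with a point on that edge, is mapped behind the
image of the edge. -/
theorem sbtw_sig_of_sbtw {r : Setoid Angle} (hr : IsCubicLamination r) {Q : Set Angle}
    (hQ : Unseparated r Q) {p q w : Angle} (h : IsHole (cls r p) p q) (hw : w ∈ Q)
    (hs : sbtw p w q) (hpq : p ∈ Q ∨ q ∈ Q) (hwc : sig 3 w ∉ cls r (sig 3 p))
    (hne : sig 3 p ≠ sig 3 q) : sbtw (sig 3 p) (sig 3 w) (sig 3 q) := by
  by_contra hcon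
  have himg := hr.isHole_sig h hne
  have hwp : sig 3 w ≠ sig 3 p := fun h => hwc (h ▸ mem_cls_self r _)
  have hwq : sig 3 w ≠ sig 3 q := fun h => hwc (h ▸ himg.2.1)
  have hsw : sbtw (sig 3 q) (sig 3 w) (sig 3 p) :=
    (((sbtw_trichotomy hne (sig 3 w)).resolve_left hwp).resolve_left hwq).resolve_left hcon
  have hl := arc_pos.2 hne
  have hl1 := arc_lt_one (sig 3 p) (sig 3 q)
  rw [sbtw_iff] at hs
  have hpq1 := arc_lt_one p q
  rcases hpq with hp | hq
  · obtain ⟨ε, hε0, hε1, hε2⟩ : ∃ ε, 0 < ε ∧ ε < arc p w ∧ 3 * ε < arc (sig 3 p) (sig 3 q) :=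
      ⟨min (arc p w) (arc (sig 3 p) (sig 3 q) / 3) / 2, by
        have := lt_min hs.1 (by linarith : 0 < arc (sig 3 p) (sig 3 q) / 3); linarith, by
        have := min_le_left (arc p w) (arc (sig 3 p) (sig 3 q) / 3); linarith [hs.1], by
        have := min_le_right (arc p w) (arc (sig 3 p) (sig 3 q) / 3); linarith⟩
    have hx : arc p (p + (ε : ℝ)) = ε := arc_add_coe p hε0.le (by linarith)
    have hsx : sbtw (sig 3 p) (sig 3 (p + (ε : ℝ))) (sig 3 q) := by
      rw [sbtw_iff, arc_sig 0 (by rw [hx]; push_cast; linarith) (by rw [hx]; push_cast; linarith), hx]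
      push_cast
      exact ⟨by linarith, by linarith⟩
    obtain ⟨c, c', hc, hc', hcc, h1, h2⟩ := exists_separating hr himg hsx hsw
    rw [sbtw_base p, hx] at h1 h2
    have hc'0 := arc_nonneg p c'
    -- `c'` is not in the short arc
    have hc'1 : arc p c' = 0 ∨ ε ≤ arc p c' := by
      by_contra hlt
      push Not at hlt
      have := arc_sig (a := p) (b := c') 0 (by push_cast; linarith) (by push_cast; linarith)
      rw [hc', arc_self] at this
      push_cast at this
      exact hlt.1 (by linarith)
    rcases hc'1 with h0 | h0
    · have := arc_eq_zero.1 h0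
      subst this
      refine h.not_sbtw (r.symm hcc) (sbtw_iff.2 ?_)
      rw [arc_self] at *
      grind
    · have := hQ c' c (r.symm hcc) p hp w hw
      rw [sbtw_base p, sbtw_base p] at this
      rw [arc_self] at *
      grind
  · have hs' : 0 < arc w q := arc_pos.2 (by rintro rfl; exact lt_irrefl _ hs.2)
    have hwq' : arc w q = arc p q - arc p w := arc_of_le hs.2.le
    obtain ⟨ε, hε0, hε1, hε2⟩ : ∃ ε, 0 < ε ∧ ε < arc w q ∧ 3 * ε < arc (sig 3 p) (sig 3 q) :=
      ⟨min (arc w q) (arc (sig 3 p) (sig 3 q) / 3) / 2, by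
        have := lt_min hs' (by linarith : 0 < arc (sig 3 p) (sig 3 q) / 3); linarith, by
        have := min_le_left (arc w q) (arc (sig 3 p) (sig 3 q) / 3); linarith, by
        have := min_le_right (arc w q) (arc (sig 3 p) (sig 3 q) / 3); linarith⟩
    obtain ⟨x, hx⟩ : ∃ x, x = q + ((1 - ε : ℝ) : Angle) := ⟨_, rfl⟩
    have hqx : arc q x = 1 - ε := by rw [hx]; exact arc_add_coe q (by linarith) (by linarith)
    have hxq : arc x q = ε := by
      have : q ≠ x := by rw [← arc_pos, hqx]; linarith
      rw [arc_swap this, hqx]; ring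
    have h3 := arc_sig (a := x) (b := q) 0 (by rw [hxq]; push_cast; linarith)
      (by rw [hxq]; push_cast; linarith)
    rw [hxq] at h3
    push_cast at h3
    have hsx : sbtw (sig 3 p) (sig 3 x) (sig 3 q) := by
      have hne' : sig 3 x ≠ sig 3 q := by rw [← arc_pos, h3]; linarith
      have h4 := arc_swap hne'
      rw [h3] at h4
      have h5 := arc_swap hne
      rw [sbtw_base (sig 3 q), arc_self, h4, h5]
      right; left
      exact ⟨by linarith, by linarith⟩
    obtain ⟨c, c', hc, hc', hcc, h1, h2⟩ := exists_separating hr himg hsx hsw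
    have hqp : arc q p = 1 - arc p q := arc_swap h.2.2.1
    have hqw : arc q w = 1 - arc w q := arc_swap (arc_pos.1 hs')
    rw [sbtw_base q, hqx, hqw] at h1 h2
    have hc0 := arc_nonneg q c
    have hc1' := arc_lt_one q c
    have hc1 : arc q c = 0 ∨ 0 < arc q c ∧ arc q c ≤ 1 - ε := by
      rcases hc0.eq_or_lt with h0 | h0
      · exact Or.inl h0.symm
      by_contra hlt
      have hlt : 1 - ε < arc q c := by
        by_contra hle
        exact hlt (Or.inr ⟨h0, not_lt.1 hle⟩)
      have hqc : q ≠ c := arc_pos.1 h0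
      have e1 := arc_swap hqc
      have e2 := arc_lt_one q c
      have := arc_sig (a := c) (b := q) 0 (by rw [e1]; push_cast; linarith)
        (by rw [e1]; push_cast; linarith)
      rw [hc, arc_self, e1] at this
      push_cast at this
      linarith
    rcases hc1 with h0 | h0
    · have := arc_eq_zero.1 h0
      subst this
      have hc'p : r p c' := r.trans h.2.1 hcc
      refine h.not_sbtw hc'p ?_
      rw [← sbtw_cyclic, ← sbtw_cyclic, sbtw_base q, arc_self, hqp]
      rw [arc_self] at *
      grind
    · have := hQ c c' hcc w hw q hq
      rw [sbtw_base q, sbtw_base q] at this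
      rw [arc_self, hqw] at this
      grind

theorem infinite_image_sig {Q : Set Angle} (h : Q.Infinite) : (sig 3 '' Q).Infinite := fun hf => by
  have h1 : Q ⊆ ⋃ b ∈ sig 3 '' Q, {q | sig 3 q = b} := fun q hq =>
    mem_iUnion₂.2 ⟨sig 3 q, mem_image_of_mem _ hq, rfl⟩
  exact h ((hf.biUnion fun b _ => finite_fiber b).subset h1)

/-- Let `g` be the class of `a`, and let `(u, v)` be the hole of `g` that contains the image of a
point `w` of `Q`. All of `σ(Q)` lies in the closed arc from `u` to `v`, so that `a` and `b` cannot
separate it: a point `σ z` outside `g` on the other side of `(u, v)` would yield a class that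
separates `w` and `z` (`exists_separating`), and a point `σ z` in `g` is an endpoint of `(u, v)`,
which is the image of the hole of the class of `z` that contains `w`. -/
theorem Unseparated.image {r : Setoid Angle} (hr : IsCubicLamination r) {Q : Set Angle}
    (hQ : Unseparated r Q) (hinf : Q.Infinite) : Unseparated r (sig 3 '' Q) := by
  rintro a b hab _ ⟨x, hx, rfl⟩ _ ⟨y, hy, rfl⟩ hxs hys
  have hne : a ≠ b := by rintro rfl; exact sbtw_irrefl_left_right hxs
  have hn : (cls r a).Nontrivial := ⟨a, mem_cls_self r a, b, hab, hne⟩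
  obtain ⟨_, ⟨w, hw, rfl⟩, hwc⟩ :=
    (infinite_image_sig hinf).exists_notMem_finite (hr.lamination.finite a)
  obtain ⟨u, v, huv, hwuv⟩ := exists_hole (hr.lamination.isClosed_cls a) hn hwc
  have hcu : cls r u = cls r a := (cls_eq_of_rel huv.1).symm
  have key : ∀ z ∈ Q, ¬ sbtw v (sig 3 z) u := by
    intro z hz hs
    by_cases hzc : sig 3 z ∈ cls r a
    · have hcz : cls r (sig 3 z) = cls r a := (cls_eq_of_rel hzc).symm
      have himg : sig 3 '' cls r z = cls r a := by rw [hr.image_cls, hcz]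
      have hnz : (cls r z).Nontrivial := by
        by_contra hns
        rw [Set.not_nontrivial_iff] at hns
        have hsub := hns.image (sig 3)
        rw [himg] at hsub
        exact hne (hsub (mem_cls_self r a) hab)
      have hwz : w ∉ cls r z := fun h => hwc (himg ▸ mem_image_of_mem _ h)
      obtain ⟨p, q, hpq, hwpq⟩ := exists_hole (hr.lamination.isClosed_cls z) hnz hwz
      have hzpq : z = p ∨ z = q := by
        have h1 := hpq.not_sbtw (mem_cls_self r z)
        have h2 := hQ p q (r.trans (r.symm hpq.1) hpq.2.1) w hw z hz hwpq
        have := sbtw_trichotomy hpq.2.2.1 z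
        tauto
      have hcp : cls r p = cls r z := (cls_eq_of_rel hpq.1).symm
      have hpqn : sig 3 p ≠ sig 3 q := by
        intro h
        have := (hr.invariant.covering z).resolve_left (by
          rintro ⟨t, ht⟩
          rw [himg] at ht
          have i1 : a ∈ ({t} : Set Angle) := ht ▸ mem_cls_self r a
          have i2 : b ∈ ({t} : Set Angle) := by rw [← ht]; exact hab
          exact hne (i1.trans i2.symm)) p q hpq
        exact this.2.2.1 h
      have hcsp : cls r (sig 3 p) = cls r a := by
        rw [← hr.image_cls, hcp, himg]
      have hpqQ : p ∈ Q ∨ q ∈ Q := by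
        rcases hzpq with h | h
        · exact Or.inl (h ▸ hz)
        · exact Or.inr (h ▸ hz)
      have h3 := sbtw_sig_of_sbtw hr hQ (hcp ▸ hpq) hw hwpq
        hpqQ (hcsp ▸ hwc) hpqn
      have h4 := hr.isHole_sig hpq hpqn
      rw [hcz] at h4
      obtain ⟨e1, e2⟩ := huv.eq_of_sbtw h4 hwuv h3
      rcases hzpq with h | h
      · rw [h, e1] at hs
        exact sbtw_irrefl_right hs
      · rw [h, e2] at hs
        exact sbtw_irrefl_left hs
    · obtain ⟨q, q', -, -, hqq, h1, h2⟩ := exists_separating hr (hcu.symm ▸ huv) hwuv hs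
      have h3 := hQ q' q (r.symm hqq) w hw z hz
      rw [sbtw_base w] at h1 h2 h3
      rw [sbtw_base w, arc_self] at h3
      rw [arc_self] at h1 h2
      have := arc_nonneg w q
      have := arc_nonneg w q'
      have := arc_nonneg w z
      grind
  have ka := huv.not_sbtw (mem_cls_self r a)
  have kb := huv.not_sbtw hab
  have kx := key x hx
  have ky := key y hy
  have huv0 := arc_pos.2 huv.2.2.1
  have a0 := arc_nonneg u a
  have b0 := arc_nonneg u b
  have x0 := arc_nonneg u (sig 3 x)
  have y0 := arc_nonneg u (sig 3 y)
  rw [sbtw_base u, arc_self] at kx ky ka kb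
  rw [sbtw_base u] at hxs hys
  grind

/-- The image of a gap basis is a gap basis. A hole `(u, v)` of the image starts at the image of a
point `a` of the basis that is the left endpoint of a hole `(a, d)`. Then `σ d = v`, because
otherwise the class of `u` and `σ d` would separate the image. -/
theorem IsGapBasis.image {r : Setoid Angle} (hr : IsCubicLamination r) {Q : Set Angle}
    (hQ : IsGapBasis r Q) : IsGapBasis r (sig 3 '' Q) := by
  have huns := hQ.unseparated.image hr hQ.infinite
  have hinf := infinite_image_sig hQ.infinite
  refine ⟨(hQ.closed.isCompact.image continuous_sig).isClosed, hinf, fun u v huv => ?_, huns⟩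
  set F := {a | a ∈ Q ∧ sig 3 a = u} with hF
  have hFf : F.Finite := (finite_fiber u).subset fun a ha => ha.2
  obtain ⟨x, hx, hxF⟩ := hQ.infinite.exists_notMem_finite hFf
  obtain ⟨a0, ha0, ha0u⟩ := huv.1
  obtain ⟨a, ⟨ha, hau⟩, hmin⟩ := Set.exists_min_image F (fun a => arc a x) hFf ⟨a0, ha0, ha0u⟩
  have hax : a ≠ x := by rintro rfl; exact hxF ⟨ha, hau⟩
  -- `a` is isolated from the right in `Q`
  have hl := arc_pos.2 huv.2.2.1
  have hl1 := arc_lt_one u v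
  have hright : ∀ ε, 0 < ε → 3 * ε < arc u v → a + (ε : ℝ) ∉ Q := by
    intro ε h0 h1 hmem
    have hay : arc a (a + (ε : ℝ)) = ε := arc_add_coe a h0.le (by linarith)
    refine huv.not_sbtw (mem_image_of_mem _ hmem) (sbtw_iff.2 ?_)
    rw [← hau, arc_sig 0 (by rw [hay]; push_cast; linarith) (by rw [hay]; push_cast; linarith), hay,
      hau]
    push_cast
    exact ⟨by linarith, by linarith⟩
  obtain ⟨d, had⟩ : ∃ d, IsHole Q a d := by
    set ε := arc u v / 4 with hε
    have hay : arc a (a + (ε : ℝ)) = ε := arc_add_coe a (by linarith) (by linarith)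
    obtain ⟨c, d, hcd, hs⟩ := exists_hole hQ.closed hQ.nontrivial
      (hright ε (by linarith) (by linarith))
    have hca : c = a := by
      by_contra hca
      have hc0 : 0 < arc a c := arc_pos.2 (Ne.symm hca)
      have hcε : ε < arc a c := by
        by_contra hle
        refine hright (arc a c) hc0 (by linarith) ?_
        rw [add_arc]; exact hcd.1
      have h1 := hcd.not_sbtw ha
      have hd0 := arc_nonneg a d
      rw [sbtw_base a] at h1 hs
      rw [arc_self] at h1
      rw [hay] at hs
      grind
    exact ⟨d, hca ▸ hcd⟩
  have hdu : sig 3 d ≠ u := by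
    intro h
    have hdx : d ≠ x := by rintro rfl; exact hxF ⟨had.2.1, h⟩
    have h1 := hmin d ⟨had.2.1, h⟩
    have h2 := had.le_arc hx hax.symm
    rw [arc_of_le (a := a) h2] at h1
    linarith [arc_pos.2 had.2.2.1]
  have hrad := hr.rel_sig (hQ.rel_of_isHole a d had)
  rw [hau] at hrad
  by_contra huvn
  have hdv : sig 3 d ≠ v := by rintro rfl; exact huvn hrad
  have hdm : sig 3 d ∈ sig 3 '' Q := mem_image_of_mem _ had.2.1
  have hvd : sbtw u v (sig 3 d) := by
    have := huv.not_sbtw hdm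
    have := sbtw_trichotomy huv.2.2.1 (sig 3 d)
    have h3 : sbtw v (sig 3 d) u := by tauto
    exact h3.cyclic_right
  -- all other points of the image would be behind the image of the edge from `a` to `d`
  obtain ⟨_, ⟨w, hw, rfl⟩, hwc⟩ := hinf.exists_notMem_finite (hr.lamination.finite u)
  have hhole := hQ.isHole_cls had
  have hcd : cls r d = cls r a := (cls_eq_of_rel (hQ.rel_of_isHole a d had)).symm
  have hcsd : cls r (sig 3 d) = cls r u := (cls_eq_of_rel hrad).symm
  have hwa : w ≠ a := by
    rintro rfl
    rw [hau] at hwc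
    exact hwc (mem_cls_self r _)
  have hwd : w ≠ d := by rintro rfl; exact hwc hrad
  have hws : sbtw d w a := by
    have := had.not_sbtw hw
    have := sbtw_trichotomy had.2.2.1 w
    tauto
  have h1 := sbtw_sig_of_sbtw hr hQ.unseparated (hcd ▸ hhole) hw hws (Or.inl had.2.1)
    (hcsd ▸ hwc) (by rw [hau]; exact hdu)
  rw [hau] at h1
  exact huns u (sig 3 d) hrad v huv.2.1 (sig 3 w) (mem_image_of_mem _ hw) hvd h1

/-- Nested gap bases coincide. -/
theorem IsGapBasis.eq_of_subset {r : Setoid Angle} {Q Q' : Set Angle} (hQ : IsGapBasis r Q)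
    (hQ' : IsGapBasis r Q') (h : Q ⊆ Q') : Q = Q' := by
  refine h.antisymm fun w hw => ?_
  by_contra hwQ
  obtain ⟨a, b, hab, hs⟩ := exists_hole hQ.closed hQ.nontrivial hwQ
  obtain ⟨y, hy, hyn⟩ := hQ.infinite.exists_notMem_finite (Set.toFinite {a, b})
  simp only [mem_insert_iff, mem_singleton_iff, not_or] at hyn
  have hys : sbtw b y a := by
    have := hab.not_sbtw hy
    have := sbtw_trichotomy hab.2.2.1 y
    tauto
  exact hQ'.unseparated a b (hQ.rel_of_isHole a b hab) w hw y (h hy) hs hys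

/-- The closed arc from `a` to `b`. -/
def closedArc (a b : Angle) : Set Angle := {x | arc a x ≤ arc a b}

theorem mem_closedArc {a b x : Angle} (hab : a ≠ b) : x ∈ closedArc a b ↔ ¬ sbtw b x a := by
  have h0 := arc_pos.2 hab
  rw [sbtw_base a, arc_self, closedArc, mem_ofPred_eq]
  have := arc_nonneg a x
  grind

/-- A non-degenerate class lies behind a hole of every gap basis. -/
theorem IsGapBasis.exists_hole_of_cls {r : Setoid Angle} (hr : IsLamination r) {Q : Set Angle}
    (hQ : IsGapBasis r Q) {x : Angle} (hx : (cls r x).Nontrivial) :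
    ∃ a b, IsHole Q a b ∧ cls r x ⊆ closedArc a b := by
  by_cases hsub : cls r x ⊆ Q
  · obtain ⟨w, hw, hwc⟩ := hQ.infinite.exists_notMem_finite (hr.finite x)
    obtain ⟨p, q, hpq, hwpq⟩ := exists_hole (hr.isClosed_cls x) hx hwc
    have hrel : r p q := r.trans (r.symm hpq.1) hpq.2.1
    refine ⟨q, p, isHole_of (hsub hpq.2.1) (hsub hpq.1) hpq.2.2.1.symm fun y hy hs =>
      hQ.unseparated p q hrel w hw y hy hwpq hs, fun y hy => ?_⟩
    rw [mem_closedArc hpq.2.2.1.symm]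
    exact hpq.not_sbtw hy
  · obtain ⟨e, he, heQ⟩ := Set.not_subset.1 hsub
    obtain ⟨a, b, hab, hs⟩ := exists_hole hQ.closed hQ.nontrivial heQ
    refine ⟨a, b, hab, fun y hy => ?_⟩
    rw [mem_closedArc hab.2.2.1]
    intro hys
    have hey : r e y := r.trans (r.symm he) hy
    rw [sbtw_cyclic] at hys
    have h1 : sbtw e b y := by
      rw [sbtw_base a] at hs hys ⊢
      rw [arc_self] at *
      have := arc_nonneg a y
      have := arc_nonneg a e
      have := arc_nonneg a b
      grind
    have h2 : sbtw y a e := by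
      rw [sbtw_base a] at hs hys ⊢
      rw [arc_self] at *
      have := arc_nonneg a y
      have := arc_nonneg a e
      have := arc_nonneg a b
      grind
    exact hQ.unseparated e y hey b hab.2.1 a hab.1 h1 h2

/-- An unseparated set is contained in a gap basis or lies behind one of its holes. -/
theorem IsGapBasis.subset_or_exists_hole {r : Setoid Angle} {Q : Set Angle}
    (hQ : IsGapBasis r Q) {S : Set Angle} (hS : Unseparated r S) :
    S ⊆ Q ∨ ∃ a b, IsHole Q a b ∧ S ⊆ closedArc a b := by
  by_cases hsub : S ⊆ Q
  · exact Or.inl hsub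
  · obtain ⟨e, he, heQ⟩ := Set.not_subset.1 hsub
    obtain ⟨a, b, hab, hs⟩ := exists_hole hQ.closed hQ.nontrivial heQ
    refine Or.inr ⟨a, b, hab, fun y hy => ?_⟩
    rw [mem_closedArc hab.2.2.1]
    exact hS a b (hQ.rel_of_isHole a b hab) e he y hy hs

/-! ### The major hole of an invariant quadratic gap -/

/-- A continuous function that is integer-valued on a closed set `P` changes along `P` only by
its jumps over the bounded complementary intervals of `P`. -/
theorem rel_of_jumps {P : Set ℝ} (hP : IsClosed P) {ψ : ℝ → ℝ} (hψ : Continuous ψ)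
    (hint : ∀ x ∈ P, ∃ n : ℤ, ψ x = n) {R : ℝ → ℝ → Prop} (hrefl : ∀ u, R u u)
    (htrans : ∀ u v w, R u v → R v w → R u w) {x₀ y₀ : ℝ} (hx₀ : x₀ ∈ P) (hy₀ : y₀ ∈ P)
    (hle : x₀ ≤ y₀)
    (hjump : ∀ x ∈ P, ∀ y ∈ P, x < y → (∀ z ∈ P, ¬ (x < z ∧ z < y)) → R (ψ x) (ψ y)) :
    R (ψ x₀) (ψ y₀) := by
  have hloc : ∀ s ∈ P, ∃ ε > 0, ∀ x ∈ P, |x - s| < ε → ψ x = ψ s := by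
    intro s hs
    obtain ⟨ε, hε, h⟩ := Metric.continuous_iff.1 hψ s 1 one_pos
    refine ⟨ε, hε, fun x hx hxs => ?_⟩
    have h1 := h x hxs
    obtain ⟨n, hn⟩ := hint x hx
    obtain ⟨k, hk⟩ := hint s hs
    rw [Real.dist_eq, hn, hk] at h1
    rw [hn, hk]
    have h2 : |n - k| < 1 := by exact_mod_cast h1
    have h3 : n = k := by
      have := Int.abs_lt_one_iff.1 h2
      omega
    rw [h3]
  set S := {x | x ∈ P ∧ x₀ ≤ x ∧ x ≤ y₀ ∧ R (ψ x₀) (ψ x)} with hS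
  have hx₀S : x₀ ∈ S := ⟨hx₀, le_rfl, hle, hrefl _⟩
  have hbdd : BddAbove S := ⟨y₀, fun x hx => hx.2.2.1⟩
  set s := sSup S with hs
  have hscl : s ∈ closure S := csSup_mem_closure ⟨x₀, hx₀S⟩ hbdd
  have hsP : s ∈ P := hP.closure_subset_iff.2 (fun x hx => hx.1) hscl
  have hs1 : x₀ ≤ s := le_csSup hbdd hx₀S
  have hs2 : s ≤ y₀ := csSup_le ⟨x₀, hx₀S⟩ fun x hx => hx.2.2.1
  have hsS : s ∈ S := by
    obtain ⟨ε, hε, h⟩ := hloc s hsP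
    obtain ⟨x, hx, hxs⟩ := Metric.mem_closure_iff.1 hscl ε hε
    refine ⟨hsP, hs1, hs2, ?_⟩
    rw [← h x hx.1 (by rw [dist_comm, Real.dist_eq] at hxs; exact hxs)]
    exact hx.2.2.2
  rcases hs2.eq_or_lt with h | hlt
  · rw [← h]; exact hsS.2.2.2
  exfalso
  set T := {x | x ∈ P ∧ s < x ∧ x ≤ y₀} with hT
  have hy₀T : y₀ ∈ T := ⟨hy₀, hlt, le_rfl⟩
  have hTb : BddBelow T := ⟨s, fun x hx => hx.2.1.le⟩
  set s' := sInf T with hs'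
  have hs'cl : s' ∈ closure T := csInf_mem_closure ⟨y₀, hy₀T⟩ hTb
  have hs'P : s' ∈ P := hP.closure_subset_iff.2 (fun x hx => hx.1) hs'cl
  have hs'1 : s ≤ s' := le_csInf ⟨y₀, hy₀T⟩ fun x hx => hx.2.1.le
  have hs'2 : s' ≤ y₀ := csInf_le hTb hy₀T
  rcases hs'1.eq_or_lt with h | hlt'
  · obtain ⟨ε, hε, hl⟩ := hloc s hsP
    obtain ⟨x, hx, hxs⟩ := Metric.mem_closure_iff.1 hs'cl ε hε
    have hxS : x ∈ S := ⟨hx.1, hs1.trans hx.2.1.le, hx.2.2, by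
      rw [hl x hx.1 (by rw [dist_comm, Real.dist_eq, ← h] at hxs; exact hxs)]
      exact hsS.2.2.2⟩
    exact absurd (le_csSup hbdd hxS) (not_le.2 hx.2.1)
  · have hs'S : s' ∈ S := ⟨hs'P, hs1.trans hs'1, hs'2, htrans _ _ _ hsS.2.2.2
      (hjump s hsP s' hs'P hlt' fun z hz hzz =>
        absurd (csInf_le hTb ⟨hz, hzz.1, hzz.2.le.trans hs'2⟩) (not_le.2 hzz.2))⟩
    exact absurd (le_csSup hbdd hs'S) (not_le.2 hlt')

/-- Given the lift `φ` of degree two, exactly one hole of the basis has length at least `1/3`. The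
function `3 x - φ x` is integer-valued on the basis, jumps by the integer part of `3 ℓ` over a hole
of length `ℓ`, and increases by `3 - 2 = 1` along the circle. -/
theorem exists_long_hole {X : Set Angle} (hX : IsClosed X) (hinf : X.Infinite) {φ : ℝ → ℝ}
    (hφ : Continuous φ) (hmono : Monotone φ) (hdeg : ∀ x, φ (x + 1) = φ x + 2)
    (hφX : ∀ x : ℝ, (x : Angle) ∈ X → (φ x : Angle) = sig 3 (x : Angle))
    (hφh : ∀ x y : ℝ, x < y → y < x + 1 → IsHole X (x : Angle) (y : Angle) → φ y < φ x + 1) :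
    ∃ m m', IsHole X m m' ∧ 1 / 3 ≤ arc m m' ∧ arc m m' < 2 / 3 ∧
      ∀ a b, IsHole X a b → 1 / 3 ≤ arc a b → a = m := by
  set P := {t : ℝ | (t : Angle) ∈ X} with hP
  have hPc : IsClosed P := hX.preimage (AddCircle.continuous_mk' 1)
  obtain ⟨ψ, hψdef⟩ : ∃ ψ : ℝ → ℝ, ∀ t, ψ t = 3 * t - φ t := ⟨_, fun _ => rfl⟩
  have hψ : Continuous ψ := by
    have : ψ = fun t => 3 * t - φ t := funext hψdef
    rw [this]; fun_prop
  have hψ1 : ∀ t, ψ (t + 1) = ψ t + 1 := by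
    intro t
    rw [hψdef, hψdef, hdeg]; ring
  have hint : ∀ x ∈ P, ∃ n : ℤ, ψ x = n := by
    intro x hx
    have h1 := hφX x hx
    rw [sig_apply, ← AddCircle.coe_nsmul, coe_eq_coe_iff] at h1
    obtain ⟨n, hn⟩ := h1
    refine ⟨n, ?_⟩
    rw [nsmul_eq_mul] at hn
    push_cast at hn
    rw [hψdef]; linarith
  have hP1 : ∀ x ∈ P, x + 1 ∈ P := by
    intro x hx
    have : ((x + 1 : ℝ) : Angle) = x := AddCircle.coe_add_period 1 x
    change ((x + 1 : ℝ) : Angle) ∈ X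
    rw [this]; exact hx
  have hlift : ∀ x : ℝ, ∀ z ∈ X, x + arc (x : Angle) z ∈ P := by
    intro x z hz
    change ((x + arc (x : Angle) z : ℝ) : Angle) ∈ X
    rw [AddCircle.coe_add, add_arc]; exact hz
  have harc : ∀ x y : ℝ, x ≤ y → y < x + 1 → arc (x : Angle) (y : Angle) = y - x := by
    intro x y h1 h2
    exact arc_unique (by linarith) (by linarith) (by rw [AddCircle.coe_sub])
  -- the jump over a hole
  have hhole : ∀ x y : ℝ, x < y → y < x + 1 → IsHole X (x : Angle) (y : Angle) →
      ψ y - ψ x = ⌊3 * (y - x)⌋ := by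
    intro x y hxy hyx h
    have h1 := hmono hxy.le
    have h2 := hφh x y hxy hyx h
    obtain ⟨n, hn⟩ := hint x h.1
    obtain ⟨k, hk⟩ := hint y h.2.1
    have e1 := hψdef x
    have e2 := hψdef y
    have : ⌊3 * (y - x)⌋ = k - n := by
      rw [Int.floor_eq_iff]
      push_cast
      constructor <;> linarith
    rw [this, hn, hk]
    push_cast; ring
  have hgap : ∀ x ∈ P, ∀ y ∈ P, x < y → (∀ z ∈ P, ¬ (x < z ∧ z < y)) →
      y < x + 1 ∧ IsHole X (x : Angle) (y : Angle) := by
    intro x hx y hy hxy hno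
    have hlt : y < x + 1 := by
      obtain ⟨z, hz, hzx⟩ := hinf.nontrivial.exists_ne (x : Angle)
      have h1 := hno _ (hlift x z hz)
      have h2 := arc_pos.2 hzx.symm
      have h3 := arc_lt_one (x : Angle) z
      by_contra hcon
      exact h1 ⟨by linarith, by linarith⟩
    have hxyA := harc x y hxy.le hlt
    refine ⟨hlt, isHole_of hx hy (arc_pos.1 (by linarith)) fun z hz hs => ?_⟩
    rw [sbtw_iff, hxyA] at hs
    exact hno _ (hlift x z hz) ⟨by linarith, by linarith⟩
  have hmonoψ : ∀ x ∈ P, ∀ y ∈ P, x ≤ y → ψ x ≤ ψ y := by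
    intro x hx y hy hxy
    refine rel_of_jumps hPc hψ hint (R := fun u v => u ≤ v) (fun _ => le_rfl)
      (fun _ _ _ => le_trans) hx hy hxy fun u hu v hv huv hno => ?_
    obtain ⟨h1, h2⟩ := hgap u hu v hv huv hno
    have h3 := hhole u v huv h1 h2
    have h4 : (0 : ℝ) ≤ ⌊3 * (v - u)⌋ := by
      exact_mod_cast Int.floor_nonneg.2 (by linarith)
    linarith
  -- lifts of a hole
  have hholes : ∀ a b, IsHole X a b → ∀ x : ℝ, (x : Angle) = a →
      x ∈ P ∧ x + arc a b ∈ P ∧ ψ (x + arc a b) - ψ x = ⌊3 * arc a b⌋ := by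
    rintro _ b h x rfl
    have h0 := arc_pos.2 h.2.2.1
    have h1 := arc_lt_one (x : Angle) b
    refine ⟨h.1, hlift x b h.2.1, ?_⟩
    have e : ((x + arc (x : Angle) b : ℝ) : Angle) = b := by rw [AddCircle.coe_add, add_arc]
    rw [hhole x _ (by linarith) (by linarith) (by rw [e]; exact h)]
    congr 2; ring
  have hex : ∃ m m', IsHole X m m' ∧ 1 / 3 ≤ arc m m' := by
    by_contra hcon
    push Not at hcon
    obtain ⟨z, hz⟩ := hinf.nonempty
    obtain ⟨x, -, rfl⟩ := AddCircle.eq_coe_Ico (p := (1 : ℝ)) z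
    have hx : x ∈ P := hz
    have h0 : ψ x = ψ (x + 1) := by
      refine rel_of_jumps hPc hψ hint (R := fun u v => u = v) (fun _ => rfl)
        (fun _ _ _ => Eq.trans) hx (hP1 x hx) (by linarith) fun u hu v hv huv hno => ?_
      obtain ⟨h1, h2⟩ := hgap u hu v hv huv hno
      have h3 := hhole u v huv h1 h2
      have h4 := hcon _ _ h2
      rw [harc u v huv.le h1] at h4
      have h5 : ⌊3 * (v - u)⌋ = 0 := by
        rw [Int.floor_eq_iff]
        push_cast
        constructor <;> linarith
      rw [h5] at h3
      push_cast at h3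
      linarith
    rw [hψ1] at h0
    linarith
  obtain ⟨m, m', hm, hlong⟩ := hex
  obtain ⟨x, -, hx⟩ := AddCircle.eq_coe_Ico (p := (1 : ℝ)) m
  obtain ⟨hxP, hyP, hjump⟩ := hholes m m' hm x hx
  have hl1 := arc_lt_one m m'
  have hfl : ∀ t : ℝ, 1 / 3 ≤ t → (1 : ℝ) ≤ ⌊3 * t⌋ := by
    intro t ht
    have : 1 ≤ ⌊3 * t⌋ := Int.le_floor.2 (by push_cast; linarith)
    exact_mod_cast this
  refine ⟨m, m', hm, hlong, ?_, fun a b hab hab3 => ?_⟩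
  · by_contra hcon
    push Not at hcon
    have h2 : (2 : ℝ) ≤ ⌊3 * arc m m'⌋ := by
      have : 2 ≤ ⌊3 * arc m m'⌋ := Int.le_floor.2 (by push_cast; linarith)
      exact_mod_cast this
    have h3 := hmonoψ _ hyP _ (hP1 x hxP) (by linarith)
    rw [hψ1] at h3
    linarith
  · by_contra hne
    have e1 := hm.le_arc hab.1 hne
    have e2 := hab.le_arc hm.1 (Ne.symm hne)
    rw [arc_swap (Ne.symm hne)] at e2
    obtain ⟨i1, i2, i3⟩ := hholes a b hab (x + arc m a) (by
      rw [AddCircle.coe_add, hx, add_arc])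
    have j1 := hmonoψ _ hyP _ i1 (by linarith)
    have j2 := hmonoψ _ i2 _ (hP1 x hxP) (by linarith)
    rw [hψ1] at j2
    have := hfl _ hlong
    have := hfl _ hab3
    linarith

/-- `(m, m')` is the major hole of the basis `X` of an invariant quadratic gap. It determines `X`
(`eq_avoiding`). Either its length `ℓ` is `1/3` and its endpoints have the same image, or its
endpoints are periodic: `σ` takes it to a hole of length `3 ℓ - 1`, whose length is then tripled
until it is `ℓ` again (`periodic`). -/
structure IsMajor (X : Set Angle) (m m' : Angle) : Prop where
  isHole : IsHole X m m'
  third_le : 1 / 3 ≤ arc m m'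
  le_half : arc m m' ≤ 1 / 2
  other_le : ∀ a b, IsHole X a b → a ≠ m → arc a b ≤ 1 / 6
  image : sig 3 '' X = X
  eq_avoiding : X = {x | ∀ n : ℕ, ¬ sbtw m ((sig 3)^[n] x) m'}
  fixed_of_half : arc m m' = 1 / 2 → sig 3 m = m
  periodic : arc m m' = 1 / 3 ∨ ∃ k : ℕ, (sig 3)^[k] m = m ∧ (sig 3)^[k] m' = m' ∧
    3 ^ k * (arc m m' - 1 / 3) = arc m m'

theorem IsMajor.hole_le_half {X : Set Angle} {m m' : Angle} (h : IsMajor X m m') {a b : Angle}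
    (hab : IsHole X a b) : arc a b ≤ 1 / 2 := by
  by_cases ha : a = m
  · subst ha
    rw [hab.right_unique h.isHole]
    exact h.le_half
  · have := h.other_le a b hab ha
    linarith

theorem IsMajor.iterate_mem {X : Set Angle} {m m' : Angle} (h : IsMajor X m m') {x : Angle}
    (hx : x ∈ X) (n : ℕ) : (sig 3)^[n] x ∈ X := by
  induction n with
  | zero => exact hx
  | succ k ih =>
    rw [Function.iterate_succ_apply', ← h.image]
    exact mem_image_of_mem _ ih

/-- Holes shorter than `1/3` are mapped to holes of three times their length; hence all holes reach
the only hole of length at least `1/3`. -/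
theorem exists_isMajor {X : Set Angle} (hX : IsClosed X) (hn : X.Nontrivial)
    (himg : sig 3 '' X = X)
    (hh : ∀ a b, IsHole X a b → sig 3 a = sig 3 b ∨ IsHole X (sig 3 a) (sig 3 b))
    (hlong : ∃ m m', IsHole X m m' ∧ 1 / 3 ≤ arc m m' ∧ arc m m' < 2 / 3 ∧
      ∀ a b, IsHole X a b → 1 / 3 ≤ arc a b → a = m) : ∃ m m', IsMajor X m m' := by
  obtain ⟨m, m', hm, h1, h2, huniq⟩ := hlong
  have hshort : ∀ a b, IsHole X a b → arc a b < 1 / 3 →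
      IsHole X (sig 3 a) (sig 3 b) ∧ arc (sig 3 a) (sig 3 b) = 3 * arc a b := by
    intro a b hab hlt
    have hpos := arc_pos.2 hab.2.2.1
    have e := arc_sig (a := a) (b := b) 0 (by push_cast; linarith) (by push_cast; linarith)
    push_cast at e
    refine ⟨(hh a b hab).resolve_left (arc_pos.1 (by linarith)), by linarith⟩
  have hmaj : arc (sig 3 m) (sig 3 m') = 3 * arc m m' - 1 := by
    have e := arc_sig (a := m) (b := m') 1 (by push_cast; linarith) (by push_cast; linarith)
    push_cast at e
    exact e
  have hmajh : arc m m' ≠ 1 / 3 → IsHole X (sig 3 m) (sig 3 m') := by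
    intro hne
    refine (hh m m' hm).resolve_left (arc_pos.1 ?_)
    have := lt_of_le_of_ne h1 hne.symm
    linarith
  have hfix : 1 / 2 ≤ arc m m' → sig 3 m = m ∧ arc (sig 3 m) (sig 3 m') = arc m m' := by
    intro hle
    have hh' := hmajh (by linarith)
    have e := huniq _ _ hh' (by rw [hmaj]; linarith)
    refine ⟨e, ?_⟩
    rw [e] at hh' ⊢
    rw [hh'.right_unique hm]
  have hhalf : arc m m' ≤ 1 / 2 := by
    by_contra hlt
    push Not at hlt
    have := (hfix hlt.le).2
    linarith
  have hle : ∀ a b, IsHole X a b → arc a b ≤ 1 / 2 := by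
    intro a b hab
    by_cases h : 1 / 3 ≤ arc a b
    · have := huniq a b hab h
      subst this
      rw [hab.right_unique hm]; exact hhalf
    · linarith
  have hother : ∀ a b, IsHole X a b → a ≠ m → arc a b < 1 / 3 := by
    intro a b hab ha
    by_contra hcon
    exact ha (huniq a b hab (not_lt.1 hcon))
  -- the iterated images of a hole reach the major hole
  have hreach : ∀ N : ℕ, ∀ a b, IsHole X a b → 1 / 3 ≤ 3 ^ N * arc a b →
      ∃ n : ℕ, (sig 3)^[n] a = m ∧ (sig 3)^[n] b = m' ∧ 3 ^ n * arc a b = arc m m' ∧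
        ∀ x, sbtw a x b → sbtw m ((sig 3)^[n] x) m' := by
    intro N
    induction N with
    | zero =>
      intro a b hab hN
      have := huniq a b hab (by simpa using hN)
      subst this
      have := hab.right_unique hm
      subst this
      exact ⟨0, rfl, rfl, by simp, fun x hx => hx⟩
    | succ N ih =>
      intro a b hab hN
      by_cases h : 1 / 3 ≤ arc a b
      · have := huniq a b hab h
        subst this
        have := hab.right_unique hm
        subst this
        exact ⟨0, rfl, rfl, by simp, fun x hx => hx⟩
      · push Not at h
        obtain ⟨i1, i2⟩ := hshort a b hab h
        obtain ⟨n, j1, j2, j3, j4⟩ := ih _ _ i1 (by rw [i2, ← mul_assoc, ← pow_succ]; exact hN)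
        refine ⟨n + 1, j1, j2, by rw [← j3, i2, pow_succ, mul_assoc], fun x hx => ?_⟩
        refine j4 _ (sbtw_iff.2 ?_)
        rw [sbtw_iff] at hx
        rw [i2, arc_sig 0 (by push_cast; linarith) (by push_cast; linarith)]
        push_cast
        exact ⟨by linarith, by linarith⟩
  have hreach' : ∀ a b, IsHole X a b →
      ∃ n : ℕ, (sig 3)^[n] a = m ∧ (sig 3)^[n] b = m' ∧ 3 ^ n * arc a b = arc m m' ∧
        ∀ x, sbtw a x b → sbtw m ((sig 3)^[n] x) m' := by
    intro a b hab
    have hpos := arc_pos.2 hab.2.2.1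
    obtain ⟨N, hN⟩ := pow_unbounded_of_one_lt (1 / arc a b) (by norm_num : (1 : ℝ) < 3)
    refine hreach N a b hab ?_
    rw [div_lt_iff₀ hpos] at hN
    linarith
  refine ⟨m, m', hm, h1, hhalf, fun a b hab ha => ?_, himg, ?_, fun h => (hfix h.ge).1, ?_⟩
  · obtain ⟨i1, i2⟩ := hshort a b hab (hother a b hab ha)
    have := hle _ _ i1
    linarith
  · ext x
    constructor
    · intro hx n
      have : ∀ n, (sig 3)^[n] x ∈ X := by
        intro n
        induction n with
        | zero => exact hx
        | succ k ih =>
          rw [Function.iterate_succ_apply', ← himg]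
          exact mem_image_of_mem _ ih
      exact hm.not_sbtw (this n)
    · intro hx
      by_contra hxX
      obtain ⟨a, b, hab, hs⟩ := exists_hole hX hn hxX
      obtain ⟨n, -, -, -, h⟩ := hreach' a b hab
      exact hx n (h x hs)
  · by_cases h3 : arc m m' = 1 / 3
    · exact Or.inl h3
    · obtain ⟨n, i1, i2, i3, -⟩ := hreach' _ _ (hmajh h3)
      refine Or.inr ⟨n + 1, i1, i2, ?_⟩
      rw [hmaj] at i3
      rw [show (3 : ℝ) ^ (n + 1) * (arc m m' - 1 / 3) = 3 ^ n * (3 * arc m m' - 1) by ring]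
      exact i3

theorem IsInvariantQuadraticGap.exists_isMajor {r : Setoid Angle} (hr : IsLamination r) {U : Set ℂ}
    (hU : IsInvariantQuadraticGap r U) : ∃ m m', IsMajor (basis U) m m' := by
  obtain ⟨hB, -⟩ := hU.infiniteGap.isGapBasis hr
  obtain ⟨hh, φ, hφ, hmono, hdeg, hφX, hφh⟩ := hU.degree
  rw [hU.invariant] at hh
  exact CubicLam.exists_isMajor hB.closed hB.nontrivial hU.invariant hh
    (exists_long_hole hB.closed hB.infinite hφ hmono (by exact_mod_cast hdeg) hφX hφh)

/-! ### Comparison of two major holes -/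

theorem sig_iterate_add_coe (k : ℕ) (x : Angle) (t : ℝ) :
    (sig 3)^[k] (x + (t : ℝ)) = (sig 3)^[k] x + ((3 ^ k * t : ℝ) : Angle) := by
  rw [sig_iterate, sig_iterate, smul_add, ← AddCircle.coe_nsmul]
  simp

theorem IsCubicLamination.image_iterate_cls {r : Setoid Angle} (hr : IsCubicLamination r)
    (k : ℕ) (x : Angle) : (sig 3)^[k] '' cls r x = cls r ((sig 3)^[k] x) := by
  induction k with
  | zero => simp
  | succ k ih => rw [Function.iterate_succ', image_comp, ih, hr.image_cls, Function.comp_apply]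

/-- As classes are finite, `σ` is injective on periodic classes. -/
theorem IsCubicLamination.false_of_periodic {r : Setoid Angle} (hr : IsCubicLamination r)
    {p p' : Angle} (h : r p p') (hne : p ≠ p') (hcrit : sig 3 p = sig 3 p') {k : ℕ} (hk : k ≠ 0)
    (hper : (sig 3)^[k] p = p ∨ (sig 3)^[k] p' = p') : False := by
  obtain ⟨j, rfl⟩ := Nat.exists_eq_succ_of_ne_zero hk
  have heq : (sig 3)^[j.succ] p = (sig 3)^[j.succ] p' := by
    rw [Function.iterate_succ_apply, Function.iterate_succ_apply, hcrit]
  have himg : (sig 3)^[j.succ] '' cls r p = cls r p := by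
    rw [hr.image_iterate_cls]
    rcases hper with h1 | h1
    · rw [h1]
    · rw [heq, h1, cls_eq_of_rel h]
  have hinj : InjOn (sig 3)^[j.succ] (cls r p) :=
    Set.injOn_of_ncard_image_eq (by rw [himg]) (hr.lamination.finite p)
  exact hne (hinj (mem_cls_self r p) h heq)

theorem IsGapBasis.image_iterate {r : Setoid Angle} (hr : IsCubicLamination r) {Q : Set Angle}
    (hQ : IsGapBasis r Q) (n : ℕ) : IsGapBasis r ((sig 3)^[n] '' Q) := by
  induction n with
  | zero => simpa using hQ
  | succ n ih =>
    rw [Function.iterate_succ', image_comp]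
    exact ih.image hr

theorem sig_eq_of_arc {p p' : Angle} (h : arc p p' = 1 / 3) : sig 3 p = sig 3 p' := by
  rw [← arc_eq_zero, arc_sig 1 (by rw [h]; norm_num) (by rw [h]; norm_num), h]
  norm_num

theorem IsMajor.exists_period {X : Set Angle} {m m' : Angle} (h : IsMajor X m m')
    (hl : 1 / 3 < arc m m') : ∃ k : ℕ, k ≠ 0 ∧ (sig 3)^[k] m = m ∧ (sig 3)^[k] m' = m' ∧
      3 ^ k * (arc m m' - 1 / 3) = arc m m' ∧ (3 : ℝ) ≤ 3 ^ k := by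
  obtain ⟨k, h1, h2, h3⟩ := h.periodic.resolve_left hl.ne'
  have hk : k ≠ 0 := by
    rintro rfl
    rw [pow_zero, one_mul] at h3
    linarith
  exact ⟨k, hk, h1, h2, h3, le_self_pow₀ (by norm_num) hk⟩

/-- A major hole is not properly contained in another one. The outer hole `(m, m')` has period `k`,
and `σ^k` expands the two parts of `(m, m')` outside the inner hole by the factor `3 ^ k`. As the
images of `p` and `p'` do not lie in the inner hole, the two parts would be too long together, or
one of them is trivial and the class of `p` and `p'` is periodic with a critical pair. -/
theorem IsMajor.false_of_nested {X Y : Set Angle} {m m' p p' : Angle} (h₁ : IsMajor X m m')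
    (h₂ : IsMajor Y p p') {r : Setoid Angle} (hr : IsCubicLamination r) (hp : r p p')
    (hsub : arc m p + arc p p' ≤ arc m m') (hlt : arc p p' < arc m m') : False := by
  have hl2 := h₂.third_le
  have hl1 := arc_lt_one m m'
  have hα := arc_nonneg m p
  obtain ⟨k, hk0, hkm, hkm', hk, hk3⟩ := h₁.exists_period (by linarith)
  obtain ⟨β, hβ⟩ : ∃ β, β = arc m m' - arc m p - arc p p' := ⟨_, rfl⟩
  have hβ0 : 0 ≤ β := by linarith
  have hmp' : arc m p' = arc m p + arc p p' :=
    arc_unique (by linarith) (by linarith) (by rw [AddCircle.coe_add, coe_arc, coe_arc]; abel)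
  generalize hK : (3 : ℝ) ^ k = K at hk hk3
  have hKα : K * arc m p ≤ arc m m' := by
    rw [← hk]; exact mul_le_mul_of_nonneg_left (by linarith) (by linarith)
  have hKβ : K * β ≤ arc m m' := by
    rw [← hk]; exact mul_le_mul_of_nonneg_left (by linarith) (by linarith)
  have hKα0 : 0 ≤ K * arc m p := by positivity
  have hKβ0 : 0 ≤ K * β := by positivity
  have e1 : arc m ((sig 3)^[k] p) = K * arc m p := by
    apply arc_unique hKα0 (by linarith)
    have : (sig 3)^[k] p = (sig 3)^[k] (m + (arc m p : ℝ)) := by rw [add_arc]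
    rw [this, sig_iterate_add_coe, hkm, hK]; abel
  have e2 : arc m ((sig 3)^[k] p') = arc m m' - K * β := by
    apply arc_unique (by linarith) (by linarith)
    have : p' = m' + ((-β : ℝ) : Angle) := by
      rw [show -β = arc m p' - arc m m' by linarith, AddCircle.coe_sub, coe_arc, coe_arc]
      abel
    rw [this, sig_iterate_add_coe, hkm', hK, AddCircle.coe_sub, coe_arc,
      show K * -β = -(K * β) by ring, AddCircle.coe_neg]
    abel
  have n1 := h₂.isHole.not_sbtw (h₂.iterate_mem h₂.isHole.1 k)
  have n2 := h₂.isHole.not_sbtw (h₂.iterate_mem h₂.isHole.2.1 k)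
  rw [sbtw_base m, e1, hmp'] at n1
  rw [sbtw_base m, e2, hmp'] at n2
  have c1 : arc m p = 0 ∨ arc m p + arc p p' ≤ K * arc m p := by
    rcases hα.eq_or_lt with h | h
    · exact Or.inl h.symm
    · right
      by_contra hcon
      exact n1 (Or.inl ⟨by nlinarith, not_le.1 hcon⟩)
  have c2 : β = 0 ∨ arc m m' - K * β ≤ arc m p := by
    rcases hβ0.eq_or_lt with h | h
    · exact Or.inl h.symm
    · right
      by_contra hcon
      exact n2 (Or.inl ⟨not_le.1 hcon, by nlinarith⟩)
  have hcrit : arc p p' ≤ 1 / 3 → (sig 3)^[k] p = p ∨ (sig 3)^[k] p' = p' → False :=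
    fun h hper => hr.false_of_periodic hp h₂.isHole.2.2.1 (sig_eq_of_arc (le_antisymm h hl2)) hk0 hper
  have hKpos : 0 < K := by linarith
  rcases c1 with c1 | c1 <;> rcases c2 with c2 | c2
  · linarith
  · apply hcrit
    · by_contra hcon
      push Not at hcon
      have : K * β < K * (arc m m' - 1 / 3) := mul_lt_mul_of_pos_left (by linarith) hKpos
      linarith
    · left
      rw [← arc_eq_zero.1 c1, hkm]
  · apply hcrit
    · by_contra hcon
      push Not at hcon
      have : K * arc m p < K * (arc m m' - 1 / 3) := mul_lt_mul_of_pos_left (by linarith) hKpos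
      linarith
    · right
      have : p' = m' := arc_left_cancel (a := m) (by linarith)
      rw [this, hkm']
  · have : K * (arc m p + β) ≤ K * (arc m m' - 1 / 3) :=
      mul_le_mul_of_nonneg_left (by linarith) (by linarith)
    nlinarith

/-- Distinct major holes do not have an arc of length `1/3` in common. -/
theorem IsMajor.eq_of_overlap {X Y : Set Angle} {m m' p p' : Angle} (h₁ : IsMajor X m m')
    (h₂ : IsMajor Y p p') {r₁ r₂ : Setoid Angle} (hr₁ : IsCubicLamination r₁)
    (hr₂ : IsCubicLamination r₂) (hm : r₁ m m') (hp : r₂ p p')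
    (hov : arc m p + 1 / 3 ≤ arc m m') : m = p ∧ m' = p' := by
  have hl1 := arc_lt_one m m'
  have hα := arc_nonneg m p
  have hl1' := h₁.le_half
  have hl2' := h₂.le_half
  rcases hα.eq_or_lt with h | h
  · have e := arc_eq_zero.1 h.symm
    subst e
    refine ⟨rfl, arc_left_cancel (a := m) ?_⟩
    rcases lt_trichotomy (arc m m') (arc m p') with h' | h' | h'
    · exact (h₂.false_of_nested h₁ hr₁ hm (by rw [arc_self]; linarith) h').elim
    · exact h'
    · exact (h₁.false_of_nested h₂ hr₂ hp (by rw [arc_self]; linarith) h').elim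
  · rcases le_or_gt (arc m p + arc p p') (arc m m') with h' | h'
    · exact (h₁.false_of_nested h₂ hr₂ hp h' (by linarith)).elim
    · exfalso
      obtain ⟨k, hk0, hkm, hkm', hk, hk3⟩ := h₁.exists_period (by linarith)
      have hmp' : arc m p' = arc m p + arc p p' :=
        arc_unique (by linarith [arc_nonneg p p']) (by linarith)
          (by rw [AddCircle.coe_add, coe_arc, coe_arc]; abel)
      generalize hK : (3 : ℝ) ^ k = K at hk hk3
      have hKα : K * arc m p ≤ arc m m' := by
        rw [← hk]; exact mul_le_mul_of_nonneg_left (by linarith) (by linarith)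
      have e1 : arc m ((sig 3)^[k] p) = K * arc m p := by
        apply arc_unique (by positivity) (by linarith)
        have : (sig 3)^[k] p = (sig 3)^[k] (m + (arc m p : ℝ)) := by rw [add_arc]
        rw [this, sig_iterate_add_coe, hkm, hK]; abel
      have n1 := h₂.isHole.not_sbtw (h₂.iterate_mem h₂.isHole.1 k)
      rw [sbtw_base m, e1, hmp'] at n1
      exact n1 (Or.inl ⟨by nlinarith, by linarith⟩)

theorem sbtw_sig_left {a x y : Angle} (h0 : 0 < arc a x) (h1 : arc a x < arc a y)
    (h2 : arc a y < 1 / 3) : sbtw (sig 3 y) (sig 3 a) (sig 3 x) := by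
  have e1 := arc_sig (a := a) (b := x) 0 (by push_cast; linarith) (by push_cast; linarith)
  have e2 := arc_sig (a := a) (b := y) 0 (by push_cast; linarith) (by push_cast; linarith)
  push_cast at e1 e2
  rw [sbtw_base (sig 3 a), arc_self, e1, e2]
  exact Or.inr (Or.inr ⟨by linarith, by linarith⟩)

theorem sbtw_sig_right {b x y : Angle} (h0 : 0 < arc x y) (h1 : arc x y < arc x b)
    (h2 : arc x b < 1 / 3) : sbtw (sig 3 y) (sig 3 b) (sig 3 x) := by
  have e1 := arc_sig (a := x) (b := y) 0 (by push_cast; linarith) (by push_cast; linarith)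
  have e2 := arc_sig (a := x) (b := b) 0 (by push_cast; linarith) (by push_cast; linarith)
  push_cast at e1 e2
  rw [sbtw_base (sig 3 x), arc_self, e1, e2]
  exact Or.inr (Or.inl ⟨by linarith, by linarith⟩)

/-- Let `S` lie behind two different major holes `(m, m')` and `(p, p')` and let `σ(S)` lie behind
holes of both bases. If two points of `S` were more than `1/6` apart, then the short arc between
their images would have no points of the bases, and this would only be possible if the two points
were `p` and `m'`. -/
theorem arc_le_sixth_of_overlap {X Y S : Set Angle} {m m' p p' : Angle} (h₁ : IsMajor X m m')
    (h₂ : IsMajor Y p p') {r₁ r₂ : Setoid Angle} (hr₁ : IsCubicLamination r₁)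
    (hr₂ : IsCubicLamination r₂) (hm : r₁ m m') (hp : r₂ p p') (hne : ¬ (m = p ∧ m' = p'))
    (hhalf : arc m m' + arc p p' < 1) (hpm : arc m p ≤ arc m m')
    (hSm : S ⊆ closedArc m m') (hSp : S ⊆ closedArc p p')
    (hX : (sig 3 '' S).Nontrivial → ∃ c d, IsHole X c d ∧ sig 3 '' S ⊆ closedArc c d)
    (hY : (sig 3 '' S).Nontrivial → ∃ c d, IsHole Y c d ∧ sig 3 '' S ⊆ closedArc c d)
    (hS : (m' ∈ S → m ∈ S) ∨ S.Infinite) {x y : Angle} (hx : x ∈ S) (hy : y ∈ S)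
    (hxy : arc m x ≤ arc m y) : arc m y - arc m x ≤ 1 / 6 := by
  by_contra hcon
  push Not at hcon
  have hα : arc m m' - 1 / 3 < arc m p := by
    by_contra hle
    exact hne (h₁.eq_of_overlap h₂ hr₁ hr₂ hm hp (by linarith))
  have hα0 : 0 < arc m p := by linarith [h₁.third_le]
  have hpos : ∀ z ∈ S, arc m p ≤ arc m z ∧ arc m z ≤ arc m m' ∧ arc p z = arc m z - arc m p := by
    intro z hz
    have i1 : arc m z ≤ arc m m' := hSm hz
    have i2 : arc p z ≤ arc p p' := hSp hz
    rcases le_or_gt (arc m p) (arc m z) with h | h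
    · exact ⟨h, i1, arc_of_le h⟩
    · rw [arc_of_lt h] at i2
      linarith [arc_nonneg m z]
  obtain ⟨x1, x2, x3⟩ := hpos x hx
  obtain ⟨y1, y2, y3⟩ := hpos y hy
  have hxyA : arc x y = arc m y - arc m x := arc_of_le hxy
  have hσ := arc_sig (a := x) (b := y) 0 (by push_cast; linarith) (by push_cast; linarith)
  push_cast at hσ
  have key : ∀ (Z : Set Angle) (c d : Angle), arc c d ≤ 1 / 2 → IsHole Z c d →
      sig 3 '' S ⊆ closedArc c d → arc c (sig 3 y) < arc c (sig 3 x) ∧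
        ∀ e ∈ Z, ¬ sbtw (sig 3 y) e (sig 3 x) := by
    intro Z c d hcd hZ hsub
    have i1 : arc c (sig 3 x) ≤ arc c d := hsub (mem_image_of_mem _ hx)
    have i2 : arc c (sig 3 y) ≤ arc c d := hsub (mem_image_of_mem _ hy)
    have hlt : arc c (sig 3 y) < arc c (sig 3 x) := by
      by_contra hle
      rw [arc_of_le (a := c) (not_lt.1 hle)] at hσ
      linarith [arc_nonneg c (sig 3 x)]
    refine ⟨hlt, fun e he hs => hZ.not_sbtw he ?_⟩
    rw [sbtw_base c] at hs
    have j1 := arc_nonneg c (sig 3 y)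
    rw [sbtw_iff]
    have := arc_nonneg c e
    rcases hs with h | h | h
    · exact ⟨by linarith, by linarith⟩
    · linarith
    · linarith
  have hnt : (sig 3 '' S).Nontrivial :=
    ⟨_, mem_image_of_mem _ hx, _, mem_image_of_mem _ hy, arc_pos.1 (by linarith)⟩
  obtain ⟨c, d, hcd, hsub⟩ := hX hnt
  obtain ⟨c₂, d₂, hcd₂, hsub₂⟩ := hY hnt
  obtain ⟨k1, k2⟩ := key X c d (h₁.hole_le_half hcd) hcd hsub
  obtain ⟨k3, k4⟩ := key Y c₂ d₂ (h₂.hole_le_half hcd₂) hcd₂ hsub₂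
  have mem1 : sig 3 m' ∈ X := h₁.iterate_mem h₁.isHole.2.1 1
  have mem2 : sig 3 p ∈ Y := h₂.iterate_mem h₂.isHole.1 1
  have hym' : y = m' := by
    by_contra hne'
    have i1 : arc m y < arc m m' := lt_of_le_of_ne y2 fun h => hne' (arc_left_cancel h)
    have i2 : arc x m' = arc m m' - arc m x := arc_of_le x2
    exact k2 _ mem1 (sbtw_sig_right (by linarith) (by linarith) (by linarith))
  have hxp : x = p := by
    by_contra hne'
    have i1 : arc m p < arc m x := lt_of_le_of_ne x1 fun h => hne' (arc_left_cancel h).symm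
    exact k4 _ mem2 (sbtw_sig_left (by linarith) (by linarith) (by linarith))
  rcases hS with hS | hS
  · have := (hpos m (hS (hym' ▸ hy))).1
    rw [arc_self] at this
    linarith
  · obtain ⟨z, hz, hzn⟩ := hS.exists_notMem_finite (Set.toFinite {x, y})
    simp only [mem_insert_iff, mem_singleton_iff, not_or] at hzn
    obtain ⟨z1, z2, z3⟩ := hpos z hz
    have z4 : arc m x < arc m z :=
      lt_of_le_of_ne (hxp ▸ z1) fun h => hzn.1 (arc_left_cancel h).symm
    have z5 : arc m z < arc m y :=
      lt_of_le_of_ne (hym' ▸ z2) fun h => hzn.2 (arc_left_cancel h)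
    have exz : arc x z = arc m z - arc m x := arc_of_le z4.le
    have ezy : arc z y = arc m y - arc m z := arc_of_le z5.le
    have f1 := arc_sig (a := x) (b := z) 0 (by push_cast; linarith) (by push_cast; linarith)
    have f2 := arc_sig (a := z) (b := y) 0 (by push_cast; linarith) (by push_cast; linarith)
    push_cast at f1 f2
    have g1 := arc_swap (a := sig 3 x) (b := sig 3 z) (arc_pos.1 (by linarith))
    have g2 := arc_swap (a := sig 3 z) (b := sig 3 y) (arc_pos.1 (by linarith))
    -- `σ y` is the left endpoint of the hole of `X`
    have hyc : arc c (sig 3 y) = 0 := by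
      by_contra h0
      refine hcd.not_sbtw (hym' ▸ mem1 : sig 3 y ∈ X) (sbtw_iff.2 ⟨?_, ?_⟩)
      · exact lt_of_le_of_ne (arc_nonneg _ _) (Ne.symm h0)
      · exact k1.trans_le (hsub (mem_image_of_mem _ hx))
    have i1 : arc c (sig 3 z) ≤ arc c d := hsub (mem_image_of_mem _ hz)
    have i2 : arc (sig 3 y) (sig 3 z) = arc c (sig 3 z) := by
      rw [arc_eq_zero.1 hyc]
    -- `σ x` is the right endpoint of the hole of `Y`
    have hxd : arc c₂ (sig 3 x) = arc c₂ d₂ := by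
      by_contra h0
      refine hcd₂.not_sbtw (hxp ▸ mem2 : sig 3 x ∈ Y) (sbtw_iff.2 ⟨?_, ?_⟩)
      · linarith [arc_nonneg c₂ (sig 3 y)]
      · exact lt_of_le_of_ne (hsub₂ (mem_image_of_mem _ hx)) h0
    have i3 : arc c₂ (sig 3 z) ≤ arc c₂ d₂ := hsub₂ (mem_image_of_mem _ hz)
    have i4 : arc (sig 3 z) (sig 3 x) = arc c₂ (sig 3 x) - arc c₂ (sig 3 z) :=
      arc_of_le (by rw [hxd]; exact i3)
    have i5 := h₁.hole_le_half hcd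
    have i6 := h₂.hole_le_half hcd₂
    have i7 := arc_nonneg c₂ (sig 3 z)
    rw [hym', hxp] at *
    linarith

theorem norm_sub_of_arc {a x y : Angle} (h : arc a x ≤ arc a y)
    (h' : arc a y - arc a x ≤ 1 / 2) : ‖y - x‖ = arc a y - arc a x := by
  have : y - x = ((arc a y - arc a x : ℝ) : Angle) := by
    rw [AddCircle.coe_sub, coe_arc, coe_arc]; abel
  rw [this, (AddCircle.norm_coe_eq_abs_iff (1 : ℝ) one_ne_zero).2, abs_of_nonneg (by linarith)]
  rw [abs_of_nonneg (by linarith), abs_one]; exact h'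

theorem norm_three_nsmul {z : Angle} (h : ‖z‖ ≤ 1 / 6) : ‖3 • z‖ = 3 * ‖z‖ := by
  obtain ⟨t, ht, hzt⟩ : ∃ t : ℝ, |t| ≤ 1 / 2 ∧ (t : Angle) = z := by
    obtain ⟨s, hs, rfl⟩ := AddCircle.eq_coe_Ico (p := (1 : ℝ)) z
    rcases le_or_gt s (1 / 2) with h1 | h1
    · exact ⟨s, by rw [abs_of_nonneg hs.1]; exact h1, rfl⟩
    · refine ⟨s - 1, ?_, ?_⟩
      · rw [abs_of_nonpos (by linarith [hs.2])]; linarith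
      · rw [AddCircle.coe_sub, AddCircle.coe_period, sub_zero]
  rw [← hzt] at h ⊢
  rw [(AddCircle.norm_coe_eq_abs_iff (1 : ℝ) one_ne_zero).2 (by rw [abs_one]; exact ht)] at h ⊢
  rw [← AddCircle.coe_nsmul, nsmul_eq_mul]
  push_cast
  rw [(AddCircle.norm_coe_eq_abs_iff (1 : ℝ) one_ne_zero).2, abs_mul]
  · norm_num
  · rw [abs_mul, abs_one]; norm_num; linarith

theorem norm_le_sixth_of_closedArc {a b x y : Angle} (hab : arc a b ≤ 1 / 6)
    (hx : x ∈ closedArc a b) (hy : y ∈ closedArc a b) : ‖x - y‖ ≤ 1 / 6 := by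
  have hx : arc a x ≤ arc a b := hx
  have hy : arc a y ≤ arc a b := hy
  have hx0 := arc_nonneg a x
  have hy0 := arc_nonneg a y
  rcases le_total (arc a x) (arc a y) with h | h
  · rw [norm_sub_rev, norm_sub_of_arc h (by linarith)]; linarith
  · rw [norm_sub_of_arc h (by linarith)]; linarith

/-- A sequence of pairs at distance at most `1/6` cannot be tripled forever. -/
theorem false_of_norm_le {x y : Angle} (hne : x ≠ y)
    (h : ∀ n : ℕ, (sig 3)^[n] x ≠ (sig 3)^[n] y →
      ‖(sig 3)^[n] x - (sig 3)^[n] y‖ ≤ 1 / 6) : False := by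
  have hpos : 0 < ‖x - y‖ := norm_pos_iff.2 (sub_ne_zero.2 hne)
  have key : ∀ n : ℕ, ‖(sig 3)^[n] x - (sig 3)^[n] y‖ = 3 ^ n * ‖x - y‖ := by
    intro n
    induction n with
    | zero => simp
    | succ n ih =>
      have hn : (sig 3)^[n] x ≠ (sig 3)^[n] y := by
        intro h0
        rw [h0, sub_self, norm_zero] at ih
        have : 0 < 3 ^ n * ‖x - y‖ := by positivity
        linarith
      rw [Function.iterate_succ_apply', Function.iterate_succ_apply', sig_apply, sig_apply,
        ← smul_sub, norm_three_nsmul (h n hn), ih, pow_succ]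
      ring
  obtain ⟨N, hN⟩ := pow_unbounded_of_one_lt (1 / ‖x - y‖) (by norm_num : (1 : ℝ) < 3)
  rw [div_lt_iff₀ hpos] at hN
  have h1 := key N
  have h2 := h N (by
    intro h0
    rw [h0, sub_self, norm_zero] at h1
    linarith)
  linarith

theorem arc_le_of_mem {m m' p x : Angle} (hx : arc m x ≤ arc m m') (h : arc p x ≤ arc m x) :
    arc m p ≤ arc m m' := by
  have : arc m p = arc m x - arc p x :=
    arc_unique (by linarith) (by linarith [arc_lt_one m x, arc_nonneg p x])
      (by rw [AddCircle.coe_sub, coe_arc, coe_arc]; abel)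
  linarith [arc_nonneg p x]

/-- If all images of `S` lie behind holes of both bases and the major holes are different and not
both of length `1/2`, then the distances between points of `S` triple at every step. -/
theorem false_of_behind_holes {X Y S : Set Angle} {m m' p p' : Angle} (h₁ : IsMajor X m m')
    (h₂ : IsMajor Y p p') {r₁ r₂ : Setoid Angle} (hr₁ : IsCubicLamination r₁)
    (hr₂ : IsCubicLamination r₂) (hm : r₁ m m') (hp : r₂ p p') (hne : ¬ (m = p ∧ m' = p'))
    (hhalf : arc m m' + arc p p' < 1) (hS : S.Nontrivial)
    (hX : ∀ n : ℕ, ((sig 3)^[n] '' S).Nontrivial →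
      ∃ c d, IsHole X c d ∧ (sig 3)^[n] '' S ⊆ closedArc c d)
    (hY : ∀ n : ℕ, ((sig 3)^[n] '' S).Nontrivial →
      ∃ c d, IsHole Y c d ∧ (sig 3)^[n] '' S ⊆ closedArc c d)
    (hcls : (∀ n : ℕ, (m' ∈ (sig 3)^[n] '' S → m ∈ (sig 3)^[n] '' S) ∧
      (p' ∈ (sig 3)^[n] '' S → p ∈ (sig 3)^[n] '' S)) ∨ S.Infinite) : False := by
  obtain ⟨x, hx, y, hy, hxy⟩ := hS
  have himg : ∀ n : ℕ, (sig 3)^[n + 1] '' S = sig 3 '' ((sig 3)^[n] '' S) := by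
    intro n
    rw [Function.iterate_succ', image_comp]
  have hinf : S.Infinite → ∀ n : ℕ, ((sig 3)^[n] '' S).Infinite := by
    intro h n
    induction n with
    | zero => simpa using h
    | succ n ih => rw [himg]; exact infinite_image_sig ih
  refine false_of_norm_le hxy fun n hn => ?_
  have hxS : (sig 3)^[n] x ∈ (sig 3)^[n] '' S := mem_image_of_mem _ hx
  have hyS : (sig 3)^[n] y ∈ (sig 3)^[n] '' S := mem_image_of_mem _ hy
  have hnt : ((sig 3)^[n] '' S).Nontrivial := ⟨_, hxS, _, hyS, hn⟩
  obtain ⟨a, b, hab, hsab⟩ := hX n hnt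
  by_cases ham : a = m
  swap
  · exact norm_le_sixth_of_closedArc (h₁.other_le a b hab ham) (hsab hxS) (hsab hyS)
  obtain ⟨a', b', hab', hsab'⟩ := hY n hnt
  by_cases hap : a' = p
  swap
  · exact norm_le_sixth_of_closedArc (h₂.other_le a' b' hab' hap) (hsab' hxS) (hsab' hyS)
  subst ham hap
  have := hab.right_unique h₁.isHole
  subst this
  have := hab'.right_unique h₂.isHole
  subst this
  by_contra hlt
  push Not at hlt
  have hX' := hX (n + 1)
  have hY' := hY (n + 1)
  rw [himg] at hX' hY'
  have hcls' : ((b ∈ (sig 3)^[n] '' S → a ∈ (sig 3)^[n] '' S) ∧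
      (b' ∈ (sig 3)^[n] '' S → a' ∈ (sig 3)^[n] '' S)) ∨ ((sig 3)^[n] '' S).Infinite :=
    hcls.imp (fun h => h n) (fun h => hinf h n)
  have main : ∀ c, ∀ u ∈ (sig 3)^[n] '' S, ∀ v ∈ (sig 3)^[n] '' S,
      (∀ u ∈ (sig 3)^[n] '' S, ∀ v ∈ (sig 3)^[n] '' S, arc c u ≤ arc c v →
        arc c v - arc c u ≤ 1 / 6) → ‖u - v‖ ≤ 1 / 6 := by
    intro c u hu v hv h
    rcases le_total (arc c u) (arc c v) with huv | huv
    · have := h u hu v hv huv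
      rw [norm_sub_rev, norm_sub_of_arc huv (by linarith)]
      exact this
    · have := h v hv u hu huv
      rw [norm_sub_of_arc huv (by linarith)]
      exact this
  rcases le_total (arc a' ((sig 3)^[n] x)) (arc a ((sig 3)^[n] x)) with h | h
  · exact absurd (main a _ hxS _ hyS fun u hu v hv huv => arc_le_sixth_of_overlap h₁ h₂ hr₁ hr₂ hm hp
      hne hhalf (arc_le_of_mem (hsab hxS) h) hsab hsab' hX' hY' (hcls'.imp And.left id) hu hv huv)
      (not_le.2 hlt)
  · exact absurd (main a' _ hxS _ hyS fun u hu v hv huv => arc_le_sixth_of_overlap h₂ h₁ hr₂ hr₁ hp hm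
      (fun h => hne ⟨h.1.symm, h.2.symm⟩) (by linarith) (arc_le_of_mem (hsab' hxS) h) hsab' hsab hY'
      hX' (hcls'.imp And.right id) hu hv huv) (not_le.2 hlt)

/-- A gap basis whose holes have length at most `1/2` lies behind a hole of length at most `1/2`
only if both lengths are `1/2`. -/
theorem exists_isHole_half {X : Set Angle} (hX : IsClosed X) (hn : X.Nontrivial)
    (hle : ∀ a b, IsHole X a b → arc a b ≤ 1 / 2) {c d : Angle} (hcd : arc c d ≤ 1 / 2)
    (hsub : X ⊆ closedArc c d) : arc c d = 1 / 2 ∧ ∃ a b, IsHole X a b ∧ arc a b = 1 / 2 := by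
  have h0 := arc_nonneg c d
  obtain ⟨y, hy⟩ : ∃ y, arc c y = (1 + arc c d) / 2 :=
    ⟨_, arc_add_coe c (by linarith) (by linarith)⟩
  have hyX : y ∉ X := fun h => by
    have : arc c y ≤ arc c d := hsub h
    linarith
  obtain ⟨a, b, hab, hs⟩ := exists_hole hX hn hyX
  have i1 : arc c a ≤ arc c d := hsub hab.1
  have i2 : arc c b ≤ arc c d := hsub hab.2.1
  have i3 := hle a b hab
  have i4 := arc_nonneg c b
  rw [sbtw_base c, hy] at hs
  have i5 : arc c b < arc c a := by
    rcases hs with h | h | h <;> linarith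
  rw [arc_of_lt i5] at i3
  refine ⟨by linarith, a, b, hab, ?_⟩
  rw [arc_of_lt i5]; linarith

theorem IsMajor.arc_eq_half {X : Set Angle} {m m' a b : Angle} (h : IsMajor X m m')
    (hab : IsHole X a b) (hl : arc a b = 1 / 2) : arc m m' = 1 / 2 := by
  have : a = m := by
    by_contra hne
    linarith [h.other_le a b hab hne]
  subst this
  rw [h.isHole.right_unique hab, hl]

theorem IsMajor.unique {X : Set Angle} {m m' p p' : Angle} (h : IsMajor X m m')
    (h' : IsMajor X p p') : m = p ∧ m' = p' := by
  have : p = m := by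
    by_contra hne
    linarith [h.other_le p p' h'.isHole hne, h'.third_le]
  subst this
  exact ⟨rfl, h.isHole.right_unique h'.isHole⟩

/-- The major holes of two laminations with a common class or a common infinite gap coincide,
or they are half circles. -/
theorem IsMajor.eq_or_half {X Y S : Set Angle} {m m' p p' : Angle} {r₁ r₂ : Setoid Angle}
    (hr₁ : IsCubicLamination r₁) (hr₂ : IsCubicLamination r₂) (hX : IsGapBasis r₁ X)
    (hY : IsGapBasis r₂ Y) (h₁ : IsMajor X m m') (h₂ : IsMajor Y p p')
    (hS : (∃ x, S = cls r₁ x ∧ S = cls r₂ x ∧ S.Nontrivial) ∨ (IsGapBasis r₁ S ∧ IsGapBasis r₂ S)) :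
    (m = p ∧ m' = p') ∨ (arc m m' = 1 / 2 ∧ arc p p' = 1 / 2) := by
  by_contra hcon
  push Not at hcon
  obtain ⟨hne, hnh⟩ := hcon
  have hhalf : arc m m' + arc p p' < 1 := by
    have i1 := h₁.le_half
    have i2 := h₂.le_half
    rcases i1.eq_or_lt with h | h
    · have := lt_of_le_of_ne i2 (hnh h)
      linarith
    · linarith
  have hm := hX.rel_of_isHole m m' h₁.isHole
  have hp := hY.rel_of_isHole p p' h₂.isHole
  have hne' : ¬ (m = p ∧ m' = p') := fun h => hne h.1 h.2
  rcases hS with ⟨x, hS1, hS2, hSn⟩ | ⟨hS1, hS2⟩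
  · have e1 : ∀ n : ℕ, (sig 3)^[n] '' S = cls r₁ ((sig 3)^[n] x) := fun n => by
      rw [hS1, hr₁.image_iterate_cls]
    have e2 : ∀ n : ℕ, (sig 3)^[n] '' S = cls r₂ ((sig 3)^[n] x) := fun n => by
      rw [hS2, hr₂.image_iterate_cls]
    refine false_of_behind_holes h₁ h₂ hr₁ hr₂ hm hp hne' hhalf hSn (fun n hn => ?_)
      (fun n hn => ?_) (Or.inl fun n => ⟨fun h => ?_, fun h => ?_⟩)
    · rw [e1] at hn ⊢
      exact hX.exists_hole_of_cls hr₁.lamination hn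
    · rw [e2] at hn ⊢
      exact hY.exists_hole_of_cls hr₂.lamination hn
    · rw [e1] at h ⊢
      exact r₁.trans h (r₁.symm hm)
    · rw [e2] at h ⊢
      exact r₂.trans h (r₂.symm hp)
  · have g1 : ∀ n : ℕ, IsGapBasis r₁ ((sig 3)^[n] '' S) := fun n => hS1.image_iterate hr₁ n
    have g2 : ∀ n : ℕ, IsGapBasis r₂ ((sig 3)^[n] '' S) := fun n => hS2.image_iterate hr₂ n
    -- no image is one of the two given bases
    have hXY : ∀ T, IsGapBasis r₁ T → IsGapBasis r₂ T → ¬ T ⊆ X := by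
      intro T hT1 hT2 hsub
      have hTX := hT1.eq_of_subset hX hsub
      subst hTX
      rcases hY.subset_or_exists_hole hT2.unseparated with h | ⟨c, d, hcd, h⟩
      · have := hT2.eq_of_subset hY h
        subst this
        exact hne' (h₁.unique h₂)
      · obtain ⟨i1, a, b, i2, i3⟩ := exists_isHole_half hX.closed hX.nontrivial
          (fun a b => h₁.hole_le_half) (h₂.hole_le_half hcd) h
        linarith [h₁.arc_eq_half i2 i3, h₂.arc_eq_half hcd i1]
    have hYX : ∀ T, IsGapBasis r₁ T → IsGapBasis r₂ T → ¬ T ⊆ Y := by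
      intro T hT1 hT2 hsub
      have hTY := hT2.eq_of_subset hY hsub
      subst hTY
      rcases hX.subset_or_exists_hole hT1.unseparated with h | ⟨c, d, hcd, h⟩
      · have := hT1.eq_of_subset hX h
        subst this
        exact hne' (h₁.unique h₂)
      · obtain ⟨i1, a, b, i2, i3⟩ := exists_isHole_half hY.closed hY.nontrivial
          (fun a b => h₂.hole_le_half) (h₁.hole_le_half hcd) h
        linarith [h₂.arc_eq_half i2 i3, h₁.arc_eq_half hcd i1]
    refine false_of_behind_holes h₁ h₂ hr₁ hr₂ hm hp hne' hhalf hS1.nontrivial (fun n _ => ?_)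
      (fun n _ => ?_) (Or.inr hS1.infinite)
    · exact (hX.subset_or_exists_hole (g1 n).unseparated).resolve_left (hXY _ (g1 n) (g2 n))
    · exact (hY.subset_or_exists_hole (g2 n).unseparated).resolve_left (hYX _ (g1 n) (g2 n))

/-! ### The lamination with both special gaps -/

/-- The point `j / (2 · 3 ^ n)` of the circle. The cells of level `n` are the open arcs between
`node n j` and `node n (j + 1)`; for `n = 0` they are the two half circles. -/
def node (n : ℕ) (j : ℤ) : Angle := (((j : ℝ) / (2 * 3 ^ n) : ℝ) : Angle)

theorem node_eq_iff {n : ℕ} {i j : ℤ} : node n i = node n j ↔ ∃ k : ℤ, j = i + k * (2 * 3 ^ n) := by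
  rw [node, node, coe_eq_coe_iff]
  have h3 : (2 * 3 ^ n : ℝ) ≠ 0 := by positivity
  refine exists_congr fun k => ?_
  rw [div_add' _ _ _ h3, div_left_inj' h3]
  exact_mod_cast Iff.rfl

theorem node_add_period (n : ℕ) (j k : ℤ) : node n (j + k * (2 * 3 ^ n)) = node n j :=
  (node_eq_iff.2 ⟨k, rfl⟩).symm

theorem node_zero_add_two (j : ℤ) : node 0 (j + 2) = node 0 j := by
  have := node_add_period 0 j 1
  simpa using this

theorem node_zero_eq_iff {i j : ℤ} : node 0 i = node 0 j ↔ i % 2 = j % 2 := by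
  rw [node_eq_iff]
  constructor
  · rintro ⟨k, rfl⟩
    simp
  · intro h
    exact ⟨(j - i) / 2, by simp; omega⟩

theorem node_refine (n m : ℕ) (j : ℤ) : node (n + m) (j * 3 ^ m) = node n j := by
  rw [node, node]
  congr 1
  push_cast
  rw [pow_add]
  field_simp

theorem sig_node_succ (n : ℕ) (j : ℤ) : sig 3 (node (n + 1) j) = node n j := by
  rw [node, node, sig_apply, ← AddCircle.coe_nsmul]
  congr 1
  rw [nsmul_eq_mul, pow_succ]
  push_cast
  field_simp

theorem sig_node_zero (j : ℤ) : sig 3 (node 0 j) = node 0 j := by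
  rw [node, sig_apply, ← AddCircle.coe_nsmul, coe_eq_coe_iff]
  refine ⟨-j, ?_⟩
  rw [nsmul_eq_mul]
  push_cast
  ring

theorem eq_node_of_sig {x : Angle} {n : ℕ} {j : ℤ} (h : sig 3 x = node n j) :
    ∃ k : ℤ, x = node (n + 1) (j + k * (2 * 3 ^ n)) := by
  obtain ⟨t, -, rfl⟩ := AddCircle.eq_coe_Ico (p := (1 : ℝ)) x
  rw [node, sig_apply, ← AddCircle.coe_nsmul, eq_comm, coe_eq_coe_iff] at h
  obtain ⟨k, hk⟩ := h
  refine ⟨k, ?_⟩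
  rw [node]
  congr 1
  rw [nsmul_eq_mul] at hk
  push_cast at hk ⊢
  rw [pow_succ]
  field_simp at hk ⊢
  linarith

theorem arc_node (n : ℕ) {i j : ℤ} (h0 : i ≤ j) (h1 : j < i + 2 * 3 ^ n) :
    arc (node n i) (node n j) = (j - i) / (2 * 3 ^ n) := by
  have h0' : (i : ℝ) ≤ j := by exact_mod_cast h0
  have h1' : (j : ℝ) < i + 2 * 3 ^ n := by exact_mod_cast h1
  apply arc_unique
  · exact div_nonneg (by linarith) (by positivity)
  · rw [div_lt_one (by positivity)]; linarith
  · rw [node, node, ← AddCircle.coe_sub]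
    congr 1
    ring

theorem arc_cell (n : ℕ) (j : ℤ) : arc (node n j) (node n (j + 1)) = 1 / (2 * 3 ^ n) := by
  have : (1 : ℤ) ≤ 3 ^ n := one_le_pow₀ (by norm_num)
  rw [arc_node n (by omega) (by omega)]
  push_cast
  ring

theorem arc_cell_pos (n : ℕ) (j : ℤ) : 0 < arc (node n j) (node n (j + 1)) := by
  rw [arc_cell]; positivity

theorem arc_cell_le_half (n : ℕ) (j : ℤ) : arc (node n j) (node n (j + 1)) ≤ 1 / 2 := by
  rw [arc_cell]
  apply one_div_le_one_div_of_le (by norm_num)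
  have : (1 : ℝ) ≤ 3 ^ n := one_le_pow₀ (by norm_num)
  linarith

theorem arc_cell_succ_le (n : ℕ) (j : ℤ) : arc (node (n + 1) j) (node (n + 1) (j + 1)) ≤ 1 / 6 := by
  rw [arc_cell]
  apply one_div_le_one_div_of_le (by norm_num)
  have : (1 : ℝ) ≤ 3 ^ n := one_le_pow₀ (by norm_num)
  rw [pow_succ]
  linarith

theorem node_ne (n : ℕ) (j : ℤ) : node n j ≠ node n (j + 1) := arc_pos.1 (arc_cell_pos n j)

/-- Coarse nodes do not lie inside finer cells. -/
theorem not_sbtw_cell {n m : ℕ} (h : n ≤ m) (i k : ℤ) :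
    ¬ sbtw (node m k) (node n i) (node m (k + 1)) := by
  obtain ⟨d, rfl⟩ := Nat.exists_eq_add_of_le h
  rw [← node_refine n d i]
  generalize i * 3 ^ d = i'
  generalize n + d = m
  have hM : (0 : ℤ) < 2 * 3 ^ m := by positivity
  -- reduce the index to the range `[k, k + 2 · 3 ^ m)`
  obtain ⟨l, hl0, hl1, hl2⟩ : ∃ l : ℤ, k ≤ l ∧ l < k + 2 * 3 ^ m ∧ node m i' = node m l := by
    refine ⟨k + (i' - k) % (2 * 3 ^ m), ?_, ?_, ?_⟩
    · have := Int.emod_nonneg (i' - k) hM.ne'; omega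
    · have := Int.emod_lt_of_pos (i' - k) hM; omega
    · rw [node_eq_iff]
      refine ⟨-((i' - k) / (2 * 3 ^ m)), ?_⟩
      have := Int.emod_add_mul_ediv (i' - k) (2 * 3 ^ m)
      linear_combination this
  rw [hl2, sbtw_iff, arc_cell, arc_node m hl0 hl1]
  have hR : (0 : ℝ) < 2 * 3 ^ m := by positivity
  rintro ⟨h1, h2⟩
  rw [div_lt_div_iff_of_pos_right hR] at h2
  have h3 : (0 : ℝ) < l - k := by
    by_contra hle
    exact absurd h1 (not_lt.2 (div_nonpos_of_nonpos_of_nonneg (not_lt.1 hle) hR.le))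
  have h4 : k < l := by
    have : (k : ℝ) < l := by linarith
    exact_mod_cast this
  have h5 : l < k + 1 := by
    have : (l : ℝ) < k + 1 := by linarith
    exact_mod_cast this
  omega

theorem sbtw_cell_sig {n : ℕ} {j : ℤ} {x : Angle}
    (h : sbtw (node (n + 1) j) x (node (n + 1) (j + 1))) :
    sbtw (node n j) (sig 3 x) (node n (j + 1)) := by
  have h6 := arc_cell_succ_le n j
  rw [sbtw_iff] at h ⊢
  rw [← sig_node_succ n j, ← sig_node_succ n (j + 1),
    arc_sig 0 (by push_cast; linarith) (by push_cast; linarith),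
    arc_sig 0 (by push_cast; linarith) (by push_cast; linarith)]
  push_cast
  exact ⟨by linarith, by linarith⟩

theorem sbtw_cell_iterate {n : ℕ} (m : ℕ) {j : ℤ} {x : Angle}
    (h : sbtw (node (n + m) j) x (node (n + m) (j + 1))) :
    sbtw (node n j) ((sig 3)^[m] x) (node n (j + 1)) := by
  induction m generalizing x with
  | zero => exact h
  | succ m ih => exact ih (sbtw_cell_sig (n := n + m) h)

theorem iterate_node (n m : ℕ) (j : ℤ) : (sig 3)^[m] (node (n + m) j) = node n j := by
  induction m with
  | zero => rfl
  | succ m ih => rw [Function.iterate_succ_apply, ← add_assoc, sig_node_succ, ih]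

theorem iterate_node_zero (m : ℕ) (j : ℤ) : (sig 3)^[m] (node 0 j) = node 0 j := by
  induction m with
  | zero => rfl
  | succ m ih => rw [Function.iterate_succ_apply, sig_node_zero, ih]

/-- A cell of level one lies in a cell of level zero. -/
theorem sbtw_cell_coarse {j l : ℤ} {x : Angle} (h1 : 3 * l ≤ j) (h2 : j < 3 * l + 3)
    (h : sbtw (node 1 j) x (node 1 (j + 1))) : sbtw (node 0 l) x (node 0 (l + 1)) := by
  have e1 : node 0 l = node 1 (3 * l) := by rw [← node_refine 0 1 l]; ring_nf
  have e2 : node 0 (l + 1) = node 1 (3 * l + 3) := by rw [← node_refine 0 1 (l + 1)]; ring_nf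
  have a1 := arc_node 1 (i := 3 * l) (j := j) (by omega) (by omega)
  have a3 := arc_node 1 (i := 3 * l) (j := 3 * l + 3) (by omega) (by omega)
  have a2 := arc_node 1 (i := 3 * l) (j := j + 1) (by omega) (by omega)
  have h1' : (3 * l : ℝ) ≤ j := by exact_mod_cast h1
  have h2' : (j + 1 : ℝ) ≤ 3 * l + 3 := by exact_mod_cast (by omega : j + 1 ≤ 3 * l + 3)
  push_cast at a1 a2 a3
  rw [sbtw_base (node 1 (3 * l))] at h
  rw [e1, e2, sbtw_iff, a3]
  rw [a1, a2] at h
  grind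

theorem sbtw_cell_zero_congr {i j : ℤ} (h : i % 2 = j % 2) {x : Angle} :
    sbtw (node 0 i) x (node 0 (i + 1)) ↔ sbtw (node 0 j) x (node 0 (j + 1)) := by
  rw [node_zero_eq_iff.2 h, node_zero_eq_iff.2 (by omega : (i + 1) % 2 = (j + 1) % 2)]

theorem sbtw_cell_zero_unique {i j : ℤ} {x : Angle} (h : sbtw (node 0 i) x (node 0 (i + 1)))
    (h' : sbtw (node 0 j) x (node 0 (j + 1))) : i % 2 = j % 2 := by
  by_contra hne
  have e : sbtw (node 0 (j + 1)) x (node 0 (j + 1 + 1)) :=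
    (sbtw_cell_zero_congr (by omega : i % 2 = (j + 1) % 2)).1 h
  rw [show j + 1 + 1 = j + 2 by ring, node_zero_add_two] at e
  exact sbtw_asymm h' e

theorem eq_node_or_sbtw_cell (n : ℕ) (x : Angle) :
    ∃ j : ℤ, x = node n j ∨ sbtw (node n j) x (node n (j + 1)) := by
  obtain ⟨t, ht, rfl⟩ := AddCircle.eq_coe_Ico (p := (1 : ℝ)) x
  have hR : (0 : ℝ) < 2 * 3 ^ n := by positivity
  refine ⟨⌊t * (2 * 3 ^ n)⌋, ?_⟩
  have h1 := Int.floor_le (t * (2 * 3 ^ n))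
  have h2 := Int.lt_floor_add_one (t * (2 * 3 ^ n))
  generalize ⌊t * (2 * 3 ^ n)⌋ = j at h1 h2 ⊢
  have h1' : (j : ℝ) / (2 * 3 ^ n) ≤ t := by rw [div_le_iff₀ hR]; exact h1
  have h2' : t < j / (2 * 3 ^ n) + 1 / (2 * 3 ^ n) := by
    rw [← add_div, lt_div_iff₀ hR]; exact h2
  rcases h1'.eq_or_lt with h | h
  · left; rw [node, h]
  · right
    have h3 := arc_cell_le_half n j
    rw [arc_cell] at h3
    have : arc (node n j) t = t - j / (2 * 3 ^ n) :=
      arc_unique (by linarith) (by linarith) (by rw [AddCircle.coe_sub]; rfl)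
    rw [sbtw_iff, arc_cell, this]
    exact ⟨by linarith, by linarith⟩

/-- The endpoints of the cell with left endpoint `node n j` form a class: either the cell is a half
circle, or it is the middle third of a cell of the previous level. -/
def IsMiddle (n : ℕ) (j : ℤ) : Prop := n = 0 ∨ j % 3 = 1

/-- Two points are equivalent if they are equal or the endpoints of a half circle or of a middle
third. -/
def abRel (x y : Angle) : Prop :=
  x = y ∨ ∃ n j, IsMiddle n j ∧
    ((x = node n j ∧ y = node n (j + 1)) ∨ (x = node n (j + 1) ∧ y = node n j))

theorem abRel_node {n : ℕ} {j : ℤ} (h : IsMiddle n j) : abRel (node n j) (node n (j + 1)) :=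
  Or.inr ⟨n, j, h, Or.inl ⟨rfl, rfl⟩⟩

theorem abRel.symm {x y : Angle} (h : abRel x y) : abRel y x := by
  rcases h with rfl | ⟨n, j, h, h' | h'⟩
  · exact Or.inl rfl
  · exact Or.inr ⟨n, j, h, Or.inr ⟨h'.2, h'.1⟩⟩
  · exact Or.inr ⟨n, j, h, Or.inl ⟨h'.2, h'.1⟩⟩

/-- The level of a node that does not occur on the previous level is determined by the point. -/
theorem level_unique {n n' : ℕ} {i i' : ℤ} (hi : n = 0 ∨ i % 3 ≠ 0) (hi' : n' = 0 ∨ i' % 3 ≠ 0)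
    (h : node n i = node n' i') : n = n' := by
  have key : ∀ n n' : ℕ, ∀ i i' : ℤ, (n' = 0 ∨ i' % 3 ≠ 0) → node n i = node n' i' → ¬ n < n' := by
    intro n n' i i' hi' h hlt
    obtain ⟨d, rfl⟩ := Nat.exists_eq_add_of_lt hlt
    rw [add_assoc, ← node_refine n (d + 1) i, node_eq_iff] at h
    obtain ⟨k, hk⟩ := h
    have hdvd : (3 : ℤ) ∣ i' := by
      rw [hk]
      exact dvd_add (Dvd.intro_left _ (by rw [pow_succ, ← mul_assoc]))
        (Dvd.intro_left (k * (2 * 3 ^ (n + d))) (by ring))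
    rcases hi' with h | h
    · omega
    · omega
  have h1 := key n n' i i' hi' h
  have h2 := key n' n i' i hi h.symm
  omega

theorem emod_three_of_node_eq {n : ℕ} {i i' : ℤ} (hn : n ≠ 0) (h : node n i = node n i') :
    i % 3 = i' % 3 := by
  obtain ⟨d, rfl⟩ := Nat.exists_eq_succ_of_ne_zero hn
  obtain ⟨k, rfl⟩ := node_eq_iff.1 h
  rw [pow_succ, show i + k * (2 * (3 ^ d * 3)) = i + 3 * (k * (2 * 3 ^ d)) by ring]
  omega

theorem IsMiddle.emod_ne {n : ℕ} {j : ℤ} (h : IsMiddle n j) :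
    (n = 0 ∨ j % 3 ≠ 0) ∧ (n = 0 ∨ (j + 1) % 3 ≠ 0) := by
  rcases h with h | h
  · exact ⟨Or.inl h, Or.inl h⟩
  · exact ⟨Or.inr (by omega), Or.inr (by omega)⟩

/-- Every point is equivalent to at most one other point. -/
theorem abRel.eq_of_ne {x y z : Angle} (hy : abRel x y) (hz : abRel x z) (hxy : x ≠ y)
    (hxz : x ≠ z) : y = z := by
  obtain ⟨n, j, hj, h⟩ := hy.resolve_left hxy
  obtain ⟨n', j', hj', h'⟩ := hz.resolve_left hxz
  have hn : n = n' := by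
    rcases h with ⟨h, -⟩ | ⟨h, -⟩ <;> rcases h' with ⟨h', -⟩ | ⟨h', -⟩
    · exact level_unique hj.emod_ne.1 hj'.emod_ne.1 (h.symm.trans h')
    · exact level_unique hj.emod_ne.1 hj'.emod_ne.2 (h.symm.trans h')
    · exact level_unique hj.emod_ne.2 hj'.emod_ne.1 (h.symm.trans h')
    · exact level_unique hj.emod_ne.2 hj'.emod_ne.2 (h.symm.trans h')
  subst hn
  have shift : ∀ a b c : ℤ, node n a = node n b → node n (a + c) = node n (b + c) := by
    intro a b c hab
    obtain ⟨k, rfl⟩ := node_eq_iff.1 hab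
    exact node_eq_iff.2 ⟨k, by ring⟩
  rcases h with ⟨h1, h2⟩ | ⟨h1, h2⟩ <;> rcases h' with ⟨h1', h2'⟩ | ⟨h1', h2'⟩
  · rw [h2, h2']; exact shift _ _ _ (h1.symm.trans h1')
  · rcases eq_or_ne n 0 with rfl | hn
    · rw [h2, h2', node_zero_eq_iff]
      have := node_zero_eq_iff.1 (h1.symm.trans h1')
      omega
    · have := emod_three_of_node_eq hn (h1.symm.trans h1')
      have := hj.resolve_left hn
      have := hj'.resolve_left hn
      omega
  · rcases eq_or_ne n 0 with rfl | hn
    · rw [h2, h2', node_zero_eq_iff]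
      have := node_zero_eq_iff.1 (h1.symm.trans h1')
      omega
    · have := emod_three_of_node_eq hn (h1.symm.trans h1')
      have := hj.resolve_left hn
      have := hj'.resolve_left hn
      omega
  · rw [h2, h2']
    have := shift _ _ (-1) (h1.symm.trans h1')
    simpa using this

theorem abRel.trans {x y z : Angle} (hxy : abRel x y) (hyz : abRel y z) : abRel x z := by
  rcases eq_or_ne y x with rfl | h
  · exact hyz
  rcases eq_or_ne y z with rfl | h'
  · exact hxy
  exact Or.inl (hxy.symm.eq_of_ne hyz h h')

/-- The lamination whose non-degenerate classes are `{0, 1/2}` and the pairs of endpoints of middle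
thirds. -/
def abSetoid : Setoid Angle where
  r := abRel
  iseqv := ⟨fun _ => Or.inl rfl, abRel.symm, abRel.trans⟩

theorem cls_ab_subset {x y : Angle} (h : abRel x y) (hne : x ≠ y) : cls abSetoid x = {x, y} := by
  ext z
  constructor
  · intro hz
    by_cases hxz : x = z
    · exact Or.inl hxz.symm
    · exact Or.inr (h.eq_of_ne hz hne hxz).symm
  · rintro (rfl | rfl)
    · exact mem_cls_self _ _
    · exact h

theorem cls_ab_eq (x : Angle) : cls abSetoid x = {x} ∨ ∃ y, x ≠ y ∧ cls abSetoid x = {x, y} := by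
  by_cases h : ∃ y, x ≠ y ∧ abRel x y
  · obtain ⟨y, hne, hy⟩ := h
    exact Or.inr ⟨y, hne, cls_ab_subset hy hne⟩
  · push Not at h
    refine Or.inl (Subset.antisymm (fun z hz => ?_) ?_)
    · by_contra hne
      exact h z (fun h => hne h.symm) hz
    · rintro _ rfl; exact mem_cls_self _ _

theorem norm_node_sub (n : ℕ) (j : ℤ) : ‖node n (j + 1) - node n j‖ = 1 / (2 * 3 ^ n) := by
  have h := arc_cell n j
  have h' := arc_cell_le_half n j
  rw [norm_sub_of_arc (a := node n j), arc_self, h, sub_zero]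
  · rw [arc_self]; exact arc_nonneg _ _
  · rw [arc_self, sub_zero]; exact h'

theorem nsmul_node (n : ℕ) (j : ℤ) : (2 * 3 ^ n) • node n j = 0 := by
  rw [node, ← AddCircle.coe_nsmul, nsmul_eq_mul]
  push_cast
  rw [mul_div_cancel₀ _ (by positivity)]
  exact coe_int j

theorem isClosed_abRel : IsClosed {p : Angle × Angle | abSetoid p.1 p.2} := by
  rw [← isOpen_compl_iff, isOpen_iff_forall_mem_open]
  rintro ⟨x, y⟩ hxy
  have hne : x ≠ y := fun h => hxy (Or.inl h)
  have hpos : 0 < ‖x - y‖ := norm_pos_iff.2 (sub_ne_zero.2 hne)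
  obtain ⟨N, hN⟩ := pow_unbounded_of_one_lt (1 / ‖x - y‖) (by norm_num : (1 : ℝ) < 3)
  rw [div_lt_iff₀ hpos] at hN
  -- only finitely many classes have a diameter of at least `‖x - y‖ / 2`
  set F : Set (Angle × Angle) := {p | abRel p.1 p.2} ∩
    ⋃ n ∈ Finset.range N, {u : Angle | (2 * 3 ^ n) • u = 0} ×ˢ {u : Angle | (2 * 3 ^ n) • u = 0}
    with hF
  have hFfin : F.Finite := by
    refine Set.Finite.subset (Set.Finite.biUnion (Finset.range N).finite_toSet fun n _ => ?_)
      inter_subset_right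
    have : {u : Angle | (2 * 3 ^ n) • u = 0}.Finite :=
      AddCircle.finite_torsion (1 : ℝ) (by positivity)
    exact this.prod this
  refine ⟨{p | ‖x - y‖ / 2 < ‖p.1 - p.2‖} ∩ Fᶜ, ?_, ?_, ?_, ?_⟩
  · rintro ⟨u, v⟩ ⟨h1, h2⟩ (h | ⟨n, j, hj, h⟩)
    · simp only at h
      simp only [mem_ofPred_eq, h, sub_self, norm_zero] at h1
      linarith
    · have hn : n < N := by
        by_contra hle
        have e : ‖u - v‖ = 1 / (2 * 3 ^ n) := by
          rcases h with ⟨h1, h2⟩ | ⟨h1, h2⟩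
          · simp only at h1 h2
            rw [h1, h2, norm_sub_rev, norm_node_sub]
          · simp only at h1 h2
            rw [h1, h2, norm_node_sub]
        simp only [mem_ofPred_eq] at h1
        rw [e, lt_div_iff₀ (by positivity)] at h1
        have : (3 : ℝ) ^ N ≤ 3 ^ n := pow_le_pow_right₀ (by norm_num) (not_lt.1 hle)
        nlinarith
      refine h2 ⟨Or.inr ⟨n, j, hj, h⟩, mem_iUnion₂.2 ⟨n, Finset.mem_range.2 hn, ?_⟩⟩
      rcases h with ⟨h1, h2⟩ | ⟨h1, h2⟩
      · simp only at h1 h2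
        rw [h1, h2]; exact ⟨nsmul_node _ _, nsmul_node _ _⟩
      · simp only at h1 h2
        rw [h1, h2]; exact ⟨nsmul_node _ _, nsmul_node _ _⟩
  · refine IsOpen.inter ?_ hFfin.isClosed.isOpen_compl
    exact isOpen_lt continuous_const (continuous_fst.sub continuous_snd).norm
  · simp only [mem_ofPred_eq]; linarith
  · exact fun h => hxy h.1

theorem unlinked_ab {a b c d : Angle} (hab : abRel a b) (hcd : abRel c d) (hbc : ¬ abRel b c) :
    Disjoint (openSegment ℝ (pt a) (pt b)) (openSegment ℝ (pt c) (pt d)) := by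
  -- a chord of a cell does not meet the chords of coarser cells
  have key : ∀ {n m : ℕ} {j k : ℤ}, n ≤ m → (∀ i ∈ ({j, j + 1} : Set ℤ), ∀ l ∈ ({k, k + 1} : Set ℤ),
      node n i ≠ node m l) → Disjoint (openSegment ℝ (pt (node n j)) (pt (node n (j + 1))))
        (openSegment ℝ (pt (node m k)) (pt (node m (k + 1)))) := by
    intro n m j k hnm hne
    exact disjoint_of_not_cross (node_ne m k) (not_sbtw_cell hnm _ _) (not_sbtw_cell hnm _ _)
      (Or.inl ⟨hne _ (Or.inl rfl) _ (Or.inl rfl), hne _ (Or.inl rfl) _ (Or.inr rfl)⟩)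
  have hpoint : ∀ u x y : Angle, u ≠ x →
      Disjoint (openSegment ℝ (pt u) (pt u)) (openSegment ℝ (pt x) (pt y)) := by
    intro u x y hux
    rw [openSegment_same, disjoint_singleton_left]
    intro hm
    rcases eq_or_ne x y with rfl | hxy
    · rw [openSegment_same] at hm
      exact hux (pt_injective hm)
    · have := norm_lt_one_of_mem_openSegment hxy hm
      rw [norm_pt] at this
      exact lt_irrefl _ this
  have hne : ∀ u v, abRel u b → abRel c v → u ≠ v := by
    rintro u v hu hv rfl
    exact hbc (hu.symm.trans hv.symm)
  rcases eq_or_ne a b with rfl | hab'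
  · exact hpoint a c d (hne _ _ (Or.inl rfl) (Or.inl rfl))
  rcases eq_or_ne c d with rfl | hcd'
  · exact (hpoint c a b (hne _ _ hab (Or.inl rfl)).symm).symm
  obtain ⟨n, j, hj, h⟩ := hab.resolve_left hab'
  obtain ⟨m, k, hk, h'⟩ := hcd.resolve_left hcd'
  have e1 : openSegment ℝ (pt a) (pt b) = openSegment ℝ (pt (node n j)) (pt (node n (j + 1))) := by
    rcases h with ⟨h1, h2⟩ | ⟨h1, h2⟩
    · rw [h1, h2]
    · rw [h1, h2, openSegment_symm]
  have e2 : openSegment ℝ (pt c) (pt d) = openSegment ℝ (pt (node m k)) (pt (node m (k + 1))) := by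
    rcases h' with ⟨h1, h2⟩ | ⟨h1, h2⟩
    · rw [h1, h2]
    · rw [h1, h2, openSegment_symm]
  have hb : ∀ i ∈ ({j, j + 1} : Set ℤ), abRel (node n i) b := by
    have := abRel_node hj
    rintro i (rfl | rfl) <;> rcases h with ⟨-, h2⟩ | ⟨-, h2⟩ <;> rw [h2]
    · exact this
    · exact Or.inl rfl
    · exact Or.inl rfl
    · exact this.symm
  have hc : ∀ l ∈ ({k, k + 1} : Set ℤ), abRel c (node m l) := by
    have := abRel_node hk
    rintro l (rfl | rfl) <;> rcases h' with ⟨h2, -⟩ | ⟨h2, -⟩ <;> rw [h2]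
    · exact Or.inl rfl
    · exact this.symm
    · exact this
    · exact Or.inl rfl
  rw [e1, e2]
  rcases le_total n m with hnm | hnm
  · exact key hnm fun i hi l hl => hne _ _ (hb i hi) (hc l hl)
  · exact (key hnm fun l hl i hi => (hne _ _ (hb i hi) (hc l hl)).symm).symm

theorem abRel.sig {x y : Angle} (h : abRel x y) : abRel (sig 3 x) (sig 3 y) := by
  have key : ∀ n j, IsMiddle n j →
      abRel (CubicLam.sig 3 (node n j)) (CubicLam.sig 3 (node n (j + 1))) := by
    intro n j hj
    cases n with
    | zero => rw [sig_node_zero, sig_node_zero]; exact abRel_node hj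
    | succ n =>
      rw [sig_node_succ, sig_node_succ]
      exact abRel_node (Or.inr (hj.resolve_left (by omega)))
  rcases h with rfl | ⟨n, j, hj, ⟨rfl, rfl⟩ | ⟨rfl, rfl⟩⟩
  · exact Or.inl rfl
  · exact key n j hj
  · exact (key n j hj).symm

/-- Classes are mapped onto classes. -/
theorem exists_abRel_of_sig {x z : Angle} (h : abRel (sig 3 x) z) : ∃ y, abRel x y ∧ sig 3 y = z := by
  rcases eq_or_ne (sig 3 x) z with hz | hz
  · exact ⟨x, Or.inl rfl, hz⟩
  obtain ⟨n, j, hj, h⟩ := h.resolve_left hz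
  cases n with
  | zero =>
    have hx : ∃ i, sig 3 x = node 0 i ∧ z = node 0 (i + 1) := by
      rcases h with ⟨h1, h2⟩ | ⟨h1, h2⟩
      · exact ⟨j, h1, h2⟩
      · exact ⟨j + 1, h1, by rw [h2, node_zero_eq_iff]; omega⟩
    obtain ⟨i, hi, rfl⟩ := hx
    obtain ⟨k, rfl⟩ := eq_node_of_sig hi
    rw [zero_add]
    have hmod : ∀ l : ℤ, l % 2 = (i + 1) % 2 → node 0 l = node 0 (i + 1) := fun l hl =>
      node_zero_eq_iff.2 hl
    rw [pow_zero, mul_one]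
    generalize hl : i + k * 2 = l
    have hl3 : l % 3 = 0 ∨ l % 3 = 1 ∨ l % 3 = 2 := by omega
    rcases hl3 with h3 | h3 | h3
    · obtain ⟨q, rfl⟩ : ∃ q, l = q * 3 := ⟨l / 3, by omega⟩
      refine ⟨node 0 (q + 1), ?_, ?_⟩
      · have := node_refine 0 1 q
        rw [zero_add, pow_one] at this
        rw [this]
        exact abRel_node (Or.inl rfl)
      · rw [sig_node_zero]; exact hmod _ (by omega)
    · refine ⟨node 1 (l + 1), abRel_node (Or.inr h3), ?_⟩
      rw [sig_node_succ]; exact hmod _ (by omega)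
    · refine ⟨node 1 (l - 1), ?_, ?_⟩
      · have := (abRel_node (n := 1) (j := l - 1) (Or.inr (by omega))).symm
        rwa [sub_add_cancel] at this
      · rw [sig_node_succ]; exact hmod _ (by omega)
  | succ n =>
    have hj3 := hj.resolve_left (by omega)
    have hmid : ∀ k : ℤ, IsMiddle (n + 2) (j + k * (2 * 3 ^ (n + 1))) := by
      intro k
      refine Or.inr ?_
      rw [pow_succ, show j + k * (2 * (3 ^ n * 3)) = j + 3 * (k * (2 * 3 ^ n)) by ring]
      omega
    rcases h with ⟨h1, h2⟩ | ⟨h1, h2⟩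
    · obtain ⟨k, rfl⟩ := eq_node_of_sig h1
      refine ⟨_, abRel_node (hmid k), ?_⟩
      rw [sig_node_succ, h2, show j + k * (2 * 3 ^ (n + 1)) + 1 = j + 1 + k * (2 * 3 ^ (n + 1)) by ring,
        node_add_period]
    · obtain ⟨k, rfl⟩ := eq_node_of_sig h1
      refine ⟨node (n + 2) (j + k * (2 * 3 ^ (n + 1))), ?_, ?_⟩
      · have := (abRel_node (hmid k)).symm
        rwa [show j + k * (2 * 3 ^ (n + 1)) + 1 = j + 1 + k * (2 * 3 ^ (n + 1)) by ring] at this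
      · rw [sig_node_succ, node_add_period, h2]

theorem isCubicLamination_ab : IsCubicLamination abSetoid where
  lamination :=
    { closed := isClosed_abRel
      unlinked := fun _ _ _ _ h1 h2 h3 => unlinked_ab h1 h2 h3
      finite := fun x => by
        rcases cls_ab_eq x with h | ⟨y, -, h⟩ <;> rw [h] <;> exact Set.toFinite _ }
  invariant :=
    { forward := fun x => by
        apply Subset.antisymm
        · rintro _ ⟨y, hy, rfl⟩
          exact abRel.sig hy
        · intro z hz
          obtain ⟨y, hy, rfl⟩ := exists_abRel_of_sig hz
          exact mem_image_of_mem _ hy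
      covering := fun x => by
        rcases cls_ab_eq x with h | ⟨y, -, h⟩
        · exact Or.inl ⟨sig 3 x, by rw [h, image_singleton]⟩
        · rw [h, image_pair]
          by_cases hσ : sig 3 x = sig 3 y
          · exact Or.inl ⟨sig 3 x, by rw [← hσ, pair_eq_singleton]⟩
          · refine Or.inr fun a b hab => ?_
            have hmem : ∀ u ∈ ({x, y} : Set Angle), sig 3 u ∈ ({sig 3 x, sig 3 y} : Set Angle) := by
              rintro u (rfl | rfl)
              · exact Or.inl rfl
              · exact Or.inr rfl
            have hcases : (a = x ∧ b = y) ∨ (a = y ∧ b = x) := by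
              rcases hab.1 with h1 | h1 <;> rcases hab.2.1 with h2 | h2
              · exact absurd (h1.trans h2.symm) hab.2.2.1
              · exact Or.inl ⟨h1, h2⟩
              · exact Or.inr ⟨h1, h2⟩
              · exact absurd (h1.trans h2.symm) hab.2.2.1
            refine isHole_of (hmem a hab.1) (hmem b hab.2.1) ?_ ?_
            · rcases hcases with ⟨rfl, rfl⟩ | ⟨rfl, rfl⟩
              · exact hσ
              · exact fun h => hσ h.symm
            · rcases hcases with ⟨rfl, rfl⟩ | ⟨rfl, rfl⟩ <;> rintro z (rfl | rfl)
              · exact sbtw_irrefl_left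
              · exact sbtw_irrefl_right
              · exact sbtw_irrefl_right
              · exact sbtw_irrefl_left }

/-! ### The bases of the two special gaps -/

/-- The points whose orbits avoid the open half circle from `e / 2` to `(e + 1) / 2`. Only the
parity of `e` matters: for odd `e` this is the basis of `FGa`, for even `e` the basis of `FGb`. -/
def gapSet (e : ℤ) : Set Angle :=
  {x | ∀ n : ℕ, ¬ sbtw (node 0 e) ((sig 3)^[n] x) (node 0 (e + 1))}

theorem sbtw_half_iff {e : ℤ} {x : Angle} :
    sbtw (node 0 e) x (node 0 (e + 1)) ↔ 1 / 2 < arc (node 0 (e + 1)) x := by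
  have h := arc_cell 0 (e + 1)
  rw [show e + 1 + 1 = e + 2 by ring, node_zero_add_two] at h
  rw [sbtw_base (node 0 (e + 1)), arc_self, h]
  have := arc_nonneg (node 0 (e + 1)) x
  norm_num
  grind

theorem gapSet_congr {e f : ℤ} (h : e % 2 = f % 2) : gapSet e = gapSet f := by
  rw [gapSet, gapSet, node_zero_eq_iff.2 h,
    node_zero_eq_iff.2 (by omega : (e + 1) % 2 = (f + 1) % 2)]

theorem pt_node_zero (j : ℤ) : pt (node 0 (2 * j)) = 1 ∧ pt (node 0 (2 * j + 1)) = -1 := by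
  have h0 : node 0 (2 * j) = ((0 : ℝ) : Angle) := by
    rw [node, eq_comm, coe_eq_coe_iff]
    exact ⟨j, by push_cast; ring⟩
  have h1 : node 0 (2 * j + 1) = ((1 / 2 : ℝ) : Angle) := by
    rw [node, eq_comm, coe_eq_coe_iff]
    exact ⟨j, by push_cast; ring⟩
  rw [h0, h1, pt_coe, pt_coe]
  constructor
  · simp
  · rw [show 2 * Real.pi * (1 / 2) = Real.pi by ring]
    simp

theorem sbtw_half_iff_im (x : Angle) :
    (sbtw (node 0 1) x (node 0 (1 + 1)) ↔ (pt x).im < 0) ∧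
      (sbtw (node 0 0) x (node 0 (0 + 1)) ↔ 0 < (pt x).im) := by
  have h0 := (pt_node_zero 0).1
  have h1 := (pt_node_zero 0).2
  have h2 := (pt_node_zero 1).1
  norm_num at h0 h1 h2
  have key : ∀ a b : Angle, sbtw a x b ↔ side a b (pt x) < 0 := fun a b =>
    ⟨side_neg, sbtw_of_side_neg⟩
  constructor
  · rw [key, side]
    norm_num [h1, h2, Complex.mul_im]
    constructor <;> intro h <;> linarith
  · rw [key, side]
    norm_num [h1, h0, Complex.mul_im]

theorem FGa_eq : FGa = convexHull ℝ (pt '' gapSet 1) := by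
  rw [FGa, gapSet]
  simp only [(sbtw_half_iff_im _).1, not_lt]

theorem FGb_eq : FGb = convexHull ℝ (pt '' gapSet 0) := by
  rw [FGb, gapSet]
  simp only [(sbtw_half_iff_im _).2, not_lt]

theorem isClosed_gapSet (e : ℤ) : IsClosed (gapSet e) := by
  have : gapSet e =
      ⋂ n : ℕ, {x | 0 ≤ side (node 0 e) (node 0 (e + 1)) (pt ((sig 3)^[n] x))} := by
    ext x
    simp only [gapSet, mem_iInter, mem_ofPred_eq]
    exact forall_congr' fun n =>
      ⟨side_nonneg, fun h h' => absurd (side_neg h') (not_lt.2 h)⟩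
  rw [this]
  exact isClosed_iInter fun n => isClosed_le continuous_const
    ((continuous_side _ _).comp (continuous_pt.comp (continuous_sig.iterate n)))

theorem sig_mem_gapSet {e : ℤ} {x : Angle} (h : x ∈ gapSet e) : sig 3 x ∈ gapSet e :=
  fun n => h (n + 1)

theorem mem_gapSet_of_sig {e : ℤ} {x : Angle} (h : sig 3 x ∈ gapSet e)
    (h0 : ¬ sbtw (node 0 e) x (node 0 (e + 1))) : x ∈ gapSet e
  | 0 => h0
  | n + 1 => h n

theorem node_zero_mem_gapSet (e j : ℤ) : node 0 j ∈ gapSet e := fun n => by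
  rw [iterate_node_zero]
  exact not_sbtw_cell le_rfl _ _

/-- The inverse branch of tripling that fixes `(e + 1) / 2` preserves `gapSet e`. -/
theorem third_mem_gapSet {e : ℤ} {t : ℝ} (h0 : 0 ≤ t) (h1 : t ≤ 1 / 2)
    (h : node 0 (e + 1) + (t : ℝ) ∈ gapSet e) :
    node 0 (e + 1) + ((t / 3 : ℝ) : Angle) ∈ gapSet e ∧
      sig 3 (node 0 (e + 1) + ((t / 3 : ℝ) : Angle)) = node 0 (e + 1) + (t : ℝ) := by
  have hs : sig 3 (node 0 (e + 1) + ((t / 3 : ℝ) : Angle)) = node 0 (e + 1) + (t : ℝ) := by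
    rw [sig_add_coe, sig_node_zero, mul_div_cancel₀ t (by norm_num : (3 : ℝ) ≠ 0)]
  refine ⟨mem_gapSet_of_sig (hs ▸ h) ?_, hs⟩
  rw [sbtw_half_iff, arc_add_coe _ (by linarith) (by linarith)]
  linarith

theorem image_gapSet (e : ℤ) : sig 3 '' gapSet e = gapSet e := by
  apply Subset.antisymm
  · rintro _ ⟨x, hx, rfl⟩
    exact sig_mem_gapSet hx
  · intro x hx
    have h1 : arc (node 0 (e + 1)) x ≤ 1 / 2 := not_lt.1 fun h => hx 0 (sbtw_half_iff.2 h)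
    have h := third_mem_gapSet (arc_nonneg _ x) h1 (by rwa [add_arc])
    exact ⟨_, h.1, by rw [h.2, add_arc]⟩

theorem infinite_gapSet (e : ℤ) : (gapSet e).Infinite := by
  have hle : ∀ n : ℕ, (1 : ℝ) / (2 * 3 ^ n) ≤ 1 / 2 := fun n => by
    apply one_div_le_one_div_of_le (by norm_num)
    have : (1 : ℝ) ≤ 3 ^ n := one_le_pow₀ (by norm_num)
    linarith
  refine Set.infinite_of_injective_forall_mem
    (f := fun n : ℕ => node 0 (e + 1) + ((1 / (2 * 3 ^ n) : ℝ) : Angle)) ?_ ?_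
  · intro n m h
    have h' := congrArg (arc (node 0 (e + 1))) h
    simp only at h'
    rw [arc_add_coe _ (by positivity) (by linarith [hle n]),
      arc_add_coe _ (by positivity) (by linarith [hle m])] at h'
    have h3 : (3 : ℝ) ^ n = 3 ^ m := by
      field_simp at h'
      linarith
    exact pow_right_injective₀ (by norm_num : (0 : ℝ) < 3) (by norm_num) h3
  · intro n
    induction n with
    | zero =>
      have := add_arc (node 0 (e + 1)) (node 0 (e + 1 + 1))
      rw [arc_cell] at this
      rw [this]
      exact node_zero_mem_gapSet _ _
    | succ n ih =>
      have h := (third_mem_gapSet (by positivity) (hle n) ih).1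
      have e : (1 : ℝ) / (2 * 3 ^ (n + 1)) = 1 / (2 * 3 ^ n) / 3 := by
        rw [pow_succ]
        field_simp
      simp only [e]
      exact h

theorem nontrivial_gapSet (e : ℤ) : (gapSet e).Nontrivial := (infinite_gapSet e).nontrivial

theorem not_mem_gapSet_of_cell {e j : ℤ} {n : ℕ} (hj : j % 2 = e % 2) {x : Angle}
    (h : sbtw (node n j) x (node n (j + 1))) : x ∉ gapSet e := by
  intro hx
  refine hx n ((sbtw_cell_zero_congr hj).1 (sbtw_cell_iterate (n := 0) n ?_))
  rwa [zero_add]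

theorem unseparated_ab_of_cell {S : Set Angle}
    (h : ∀ n j, IsMiddle n j → ∀ x ∈ S, ∀ y ∈ S, sbtw (node n j) x (node n (j + 1)) →
      ¬ sbtw (node n (j + 1)) y (node n j)) : Unseparated abSetoid S := by
  intro a b hab x hx y hy hxs hys
  rcases hab with rfl | ⟨n, j, hj, ⟨rfl, rfl⟩ | ⟨rfl, rfl⟩⟩
  · exact sbtw_irrefl_left_right hxs
  · exact h n j hj x hx y hy hxs hys
  · exact h n j hj y hy x hx hys hxs

/-- A cell with endpoints in a class and its complement cannot both meet `gapSet e`: for half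
circles this is the definition, and a middle third is mapped into both half circles by consecutive
iterates. -/
theorem unseparated_gapSet (e : ℤ) : Unseparated abSetoid (gapSet e) := by
  refine unseparated_ab_of_cell fun n j hj x hx y hy hxs hys => ?_
  have he : ∀ {k : ℕ} {i : ℤ} {z}, z ∈ gapSet e → sbtw (node k i) z (node k (i + 1)) →
      i % 2 ≠ e % 2 := fun hz h hi => not_mem_gapSet_of_cell hi h hz
  cases n with
  | zero =>
    have h1 := he hx hxs
    have h2 := he (k := 0) (i := j + 1) hy
      (by rwa [show j + 1 + 1 = j + 2 by ring, node_zero_add_two])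
    omega
  | succ n =>
    have hj3 := hj.resolve_left (by omega)
    have h1 := he hx hxs
    rw [add_comm] at hxs
    -- the middle third lies in a cell of the previous level with an index of the other parity
    have h2 := sbtw_cell_coarse (l := j / 3) (by omega) (by omega) (sbtw_cell_iterate n hxs)
    have hxn : (sig 3)^[n] x ∈ gapSet e := fun k => by
      rw [← Function.iterate_add_apply]; exact hx _
    have h3 := he hxn h2
    omega

/-- If the arc `(p, q)` meets `(a, b)` close to one of its endpoints and contains neither `a` nor
`b`, then it is contained in `(a, b)`. -/
theorem sbtw_of_not_sbtw {a b p q w : Angle} (ha : ¬ sbtw p a q) (hb : ¬ sbtw p b q)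
    (hw : sbtw p w q) (h : sbtw a p b ∨ sbtw a q b) : sbtw a w b := by
  rw [sbtw_base p] at *
  have := arc_self p
  have := arc_nonneg p a
  have := arc_nonneg p b
  have := arc_nonneg p w
  have := arc_nonneg p q
  rw [sbtw_base p] at h
  grind

/-- The holes of `gapSet e` are cells with the parity of `e` that give rise to a class. The level is
the time at which the hole enters the half circle avoided by `gapSet e`. -/
theorem eq_cell_of_isHole {e : ℤ} {u v : Angle} (h : IsHole (gapSet e) u v) :
    ∃ n j, IsMiddle n j ∧ j % 2 = e % 2 ∧ u = node n j ∧ v = node n (j + 1) := by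
  obtain ⟨w, hw⟩ : ∃ w, sbtw u w v := by
    have h0 := arc_pos.2 h.2.2.1
    have h1 := arc_lt_one u v
    refine ⟨u + ((arc u v / 2 : ℝ) : Angle), ?_⟩
    rw [sbtw_iff, arc_add_coe _ (by linarith) (by linarith)]
    exact ⟨by linarith, by linarith⟩
  have hex : ∃ n : ℕ, sbtw (node 0 e) ((sig 3)^[n] w) (node 0 (e + 1)) := by
    by_contra hno
    push Not at hno
    exact h.not_sbtw hno hw
  classical
  obtain ⟨n, hn, hmin⟩ : ∃ n : ℕ, sbtw (node 0 e) ((sig 3)^[n] w) (node 0 (e + 1)) ∧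
      ∀ m < n, ¬ sbtw (node 0 e) ((sig 3)^[m] w) (node 0 (e + 1)) :=
    ⟨Nat.find hex, Nat.find_spec hex, fun m => Nat.find_min hex⟩
  obtain ⟨j, hj⟩ := eq_node_or_sbtw_cell n w
  replace hj : sbtw (node n j) w (node n (j + 1)) := by
    refine hj.resolve_left fun hwj => ?_
    have := iterate_node 0 n j
    rw [zero_add, ← hwj] at this
    rw [this] at hn
    exact not_sbtw_cell le_rfl _ _ hn
  have hje : j % 2 = e % 2 :=
    sbtw_cell_zero_unique (sbtw_cell_iterate (n := 0) n (by rwa [zero_add])) hn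
  have hmid : IsMiddle n j := by
    cases n with
    | zero => exact Or.inl rfl
    | succ n =>
      refine Or.inr (by_contra fun hj3 => hmin n (by omega) ?_)
      rw [add_comm] at hj
      exact (sbtw_cell_zero_congr (by omega : j / 3 % 2 = e % 2)).1
        (sbtw_cell_coarse (by omega) (by omega) (sbtw_cell_iterate n hj))
  have hmem : ∀ i ∈ ({j, j + 1} : Set ℤ), node n i ∈ gapSet e := by
    intro i hi m hs
    rcases lt_or_ge m n with hm | hm
    · obtain ⟨d, rfl⟩ := Nat.exists_eq_add_of_le hm.le
      rw [add_comm m d] at hs hj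
      rw [iterate_node d m i] at hs
      refine hmin m hm (sbtw_of_not_sbtw (not_sbtw_cell (n := 0) (by omega) _ _)
        (not_sbtw_cell (n := 0) (by omega) _ _) (sbtw_cell_iterate m hj) ?_)
      rcases hi with rfl | rfl
      · exact Or.inl hs
      · exact Or.inr hs
    · obtain ⟨d, rfl⟩ := Nat.exists_eq_add_of_le hm
      have := iterate_node 0 n i
      rw [zero_add] at this
      rw [add_comm, Function.iterate_add_apply, this, iterate_node_zero] at hs
      exact not_sbtw_cell le_rfl _ _ hs
  have hhole : IsHole (gapSet e) (node n j) (node n (j + 1)) :=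
    isHole_of (hmem _ (Or.inl rfl)) (hmem _ (Or.inr rfl)) (node_ne n j)
      fun x hx hs => not_mem_gapSet_of_cell hje hs hx
  exact ⟨n, j, hmid, hje, h.eq_of_sbtw hhole hw hj⟩

theorem isHole_gapSet_zero (e : ℤ) : IsHole (gapSet e) (node 0 e) (node 0 (e + 1)) :=
  isHole_of (node_zero_mem_gapSet _ _) (node_zero_mem_gapSet _ _) (node_ne 0 e)
    fun _ hx hs => not_mem_gapSet_of_cell rfl hs hx

theorem isGapBasis_gapSet (e : ℤ) : IsGapBasis abSetoid (gapSet e) where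
  closed := isClosed_gapSet e
  infinite := infinite_gapSet e
  rel_of_isHole := fun a b h => by
    obtain ⟨n, j, hj, -, rfl, rfl⟩ := eq_cell_of_isHole h
    exact abRel_node hj
  unseparated := unseparated_gapSet e

theorem basis_hull_gapSet (e : ℤ) : basis (convexHull ℝ (pt '' gapSet e)) = gapSet e :=
  basis_hull (isClosed_gapSet e) (nontrivial_gapSet e)

theorem hasDegree_gapSet (e : ℤ) : HasDegree 3 (convexHull ℝ (pt '' gapSet e)) 2 := by
  rw [HasDegree, basis_hull_gapSet, image_gapSet]
  constructor
  · intro a b h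
    right
    obtain ⟨n, j, -, hje, rfl, rfl⟩ := eq_cell_of_isHole h
    cases n with
    | zero => rw [sig_node_zero, sig_node_zero]; exact h
    | succ n =>
      have h1 := sig_mem_gapSet h.1
      have h2 := sig_mem_gapSet h.2.1
      rw [sig_node_succ] at h1 h2 ⊢
      rw [sig_node_succ]
      exact isHole_of h1 h2 (node_ne n j) fun x hx hs => not_mem_gapSet_of_cell hje hs hx
  · -- the map has slope three on the half circle that carries the gap and slope one on the other
    set c : ℝ := ((e + 1 : ℤ) : ℝ) / (2 * 3 ^ 0) with hc
    have hcn : node 0 (e + 1) = (c : Angle) := rfl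
    have hdiff : ∀ x y : ℝ, |‖((y - c : ℝ) : Angle)‖ - ‖((x - c : ℝ) : Angle)‖| ≤ |y - x| := by
      intro x y
      refine (abs_norm_sub_norm_le _ _).trans ?_
      rw [← AddCircle.coe_sub, sub_sub_sub_cancel_right]
      exact QuotientAddGroup.norm_mk_le_norm
    refine ⟨fun x => 2 * x - c + ‖((x - c : ℝ) : Angle)‖, ?_, ?_, ?_, ?_, ?_⟩
    · have : Continuous fun x : ℝ => ((x - c : ℝ) : Angle) :=
        (AddCircle.continuous_mk' (1 : ℝ)).comp (continuous_id.sub continuous_const)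
      fun_prop
    · intro x y hxy
      have := hdiff x y
      rw [abs_of_nonneg (sub_nonneg.2 hxy), abs_le] at this
      simp only
      linarith [this.1]
    · intro x
      have : ((x + 1 - c : ℝ) : Angle) = ((x - c : ℝ) : Angle) := by
        rw [eq_comm, coe_eq_coe_iff]; exact ⟨1, by push_cast; ring⟩
      simp only [this]
      push_cast
      ring
    · intro x hx
      have h1 : arc (c : Angle) x ≤ 1 / 2 := not_lt.1 fun h => hx 0 (sbtw_half_iff.2 h)
      have h0 := arc_nonneg (c : Angle) x
      have hn : ‖((x - c : ℝ) : Angle)‖ = arc (c : Angle) x := by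
        rw [AddCircle.coe_sub, norm_sub_of_arc (a := (c : Angle)) (by rw [arc_self]; exact h0)
          (by rw [arc_self]; linarith), arc_self, sub_zero]
      have h2 := add_arc (c : Angle) x
      rw [← AddCircle.coe_add, coe_eq_coe_iff] at h2
      obtain ⟨k, hk⟩ := h2
      simp only [hn]
      rw [sig_apply, ← AddCircle.coe_nsmul, coe_eq_coe_iff]
      refine ⟨e + 1 + k, ?_⟩
      have hc2 : 2 * c = e + 1 := by rw [hc]; push_cast; ring
      rw [nsmul_eq_mul]
      push_cast
      linarith
    · intro x y hxy hyx h
      have harc : arc (x : Angle) y = y - x :=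
        arc_unique (by linarith) (by linarith) (AddCircle.coe_sub ..)
      have hd := hdiff x y
      rw [abs_of_nonneg (sub_nonneg.2 hxy.le), abs_le] at hd
      simp only
      obtain ⟨n, j, -, hje, hx, hy⟩ := eq_cell_of_isHole h
      cases n with
      | zero =>
        have hyc : (y : Angle) = c := by
          rw [hy, ← hcn, node_zero_eq_iff]; omega
        have hxc : 0 < ‖((x - c : ℝ) : Angle)‖ := by
          rw [norm_pos_iff, AddCircle.coe_sub, sub_ne_zero, ← hyc]
          exact h.2.2.1
        have hyn : ‖((y - c : ℝ) : Angle)‖ = 0 := by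
          rw [AddCircle.coe_sub, hyc, sub_self, norm_zero]
        have := arc_cell_le_half 0 j
        rw [← hx, ← hy, harc] at this
        linarith
      | succ n =>
        have := arc_cell_succ_le n j
        rw [← hx, ← hy, harc] at this
        linarith [hd.2]

theorem isInvariantQuadraticGap_gapSet (e : ℤ) :
    IsInvariantQuadraticGap abSetoid (convexHull ℝ (pt '' gapSet e)) where
  infiniteGap := (isGapBasis_gapSet e).isInfiniteGap
  invariant := by rw [basis_hull_gapSet, image_gapSet]
  degree := hasDegree_gapSet e

theorem gapSet_ne : gapSet 1 ≠ gapSet 0 := by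
  intro h
  -- points of both sets lie in both closed half circles
  have hsub : gapSet 1 ⊆ {node 0 0, node 0 1} := by
    intro x hx
    have h1 := hx 0
    have h0 := (h ▸ hx : x ∈ gapSet 0) 0
    rw [show (1 : ℤ) + 1 = 0 + 2 by norm_num, node_zero_add_two] at h1
    rcases sbtw_trichotomy (node_ne 0 0) x with h | h | h | h
    · exact Or.inl h
    · exact Or.inr h
    · exact absurd h h0
    · exact absurd h h1
  exact infinite_gapSet 1 ((Set.toFinite _).subset hsub)

theorem FGa_ne_FGb : FGa ≠ FGb := by
  intro h
  rw [FGa_eq, FGb_eq] at h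
  have := congrArg basis h
  rw [basis_hull_gapSet, basis_hull_gapSet] at this
  exact gapSet_ne this

/-! ### Common classes and gaps of laminations with the two special gaps -/

/-- A set behind a hole of each special gap is contained in a closed cell of positive level or in
the diameter `{0, 1/2}`. -/
theorem subset_cell_or_pair {S : Set Angle}
    (h : ∀ e, ∃ u v, IsHole (gapSet e) u v ∧ S ⊆ closedArc u v) :
    (∃ m k, S ⊆ closedArc (node (m + 1) k) (node (m + 1) (k + 1))) ∨
      S ⊆ {node 0 0, node 0 1} := by
  have key : ∀ e, (∃ m k, S ⊆ closedArc (node (m + 1) k) (node (m + 1) (k + 1))) ∨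
      S ⊆ closedArc (node 0 e) (node 0 (e + 1)) := by
    intro e
    obtain ⟨u, v, huv, hS⟩ := h e
    obtain ⟨n, j, -, hje, rfl, rfl⟩ := eq_cell_of_isHole huv
    cases n with
    | zero =>
      right
      rwa [← node_zero_eq_iff.2 hje,
        ← node_zero_eq_iff.2 (by omega : (j + 1) % 2 = (e + 1) % 2)]
    | succ n => exact Or.inl ⟨n, j, hS⟩
  rcases key 0 with h0 | h0
  · exact Or.inl h0
  rcases key 1 with h1 | h1
  · exact Or.inl h1
  refine Or.inr fun x hx => ?_
  have hx0 := (mem_closedArc (node_ne 0 0)).1 (h0 hx)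
  have hx1 := (mem_closedArc (node_ne 0 1)).1 (h1 hx)
  rw [show (1 : ℤ) + 1 = 0 + 2 by norm_num, node_zero_add_two] at hx1
  rcases sbtw_trichotomy (node_ne 0 0) x with h | h | h | h
  · exact Or.inl h
  · exact Or.inr h
  · exact absurd h hx1
  · exact absurd h hx0

theorem node_succ (n : ℕ) (j : ℤ) :
    node n (j + 1) = node n j + ((1 / (2 * 3 ^ n) : ℝ) : Angle) := by
  rw [node, node, ← AddCircle.coe_add]
  congr 1
  push_cast
  ring

/-- The outer thirds of a half circle do not give leaves: their endpoints separate the points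
`1/8` and `3/8`, respectively `5/8` and `7/8`, of a special gap. -/
theorem not_rel_outer {r : Setoid Angle} {l i : ℤ} (hu : Unseparated r (gapSet (l + 1)))
    (hi : i = 3 * l ∨ i = 3 * l + 2) : ¬ r (node 1 i) (node 1 (i + 1)) := by
  intro h
  have e1 : node 0 l = node 1 (3 * l) := by rw [← node_refine 0 1 l]; ring_nf
  have hhalf : ∀ t : ℝ, 0 ≤ t → t ≤ 1 / 2 →
      ¬ sbtw (node 0 (l + 1)) (node 0 l + (t : ℝ)) (node 0 (l + 1 + 1)) := by
    intro t h0 h1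
    rw [sbtw_half_iff, show l + 1 + 1 = l + 2 by ring, node_zero_add_two,
      arc_add_coe _ h0 (by linarith)]
    linarith
  set p : Angle := node 0 l + ((1 / 8 : ℝ) : Angle) with hp
  set q : Angle := node 0 l + ((3 / 8 : ℝ) : Angle) with hq
  have hsp : sig 3 p = q := by
    rw [hp, sig_add_coe, sig_node_zero, hq]; norm_num
  have hsq : sig 3 q = p := by
    rw [hp, hq, sig_add_coe, sig_node_zero]
    congr 1
    rw [eq_comm, coe_eq_coe_iff]
    exact ⟨1, by norm_num⟩
  have hmem : ∀ n : ℕ, ∀ z ∈ ({p, q} : Set Angle), (sig 3)^[n] z ∈ ({p, q} : Set Angle) := by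
    intro n
    induction n with
    | zero => exact fun z hz => hz
    | succ n ih =>
      rintro z (rfl | rfl)
      · rw [Function.iterate_succ_apply, hsp]; exact ih _ (Or.inr rfl)
      · rw [Function.iterate_succ_apply, hsq]; exact ih _ (Or.inl rfl)
  have hgap : ∀ z ∈ ({p, q} : Set Angle), z ∈ gapSet (l + 1) := by
    intro z hz n
    rcases hmem n z hz with h | h
    · rw [h]; exact hhalf _ (by norm_num) (by norm_num)
    · rw [h]; exact hhalf _ (by norm_num) (by norm_num)
  have ap : arc (node 0 l) p = 1 / 8 := arc_add_coe _ (by norm_num) (by norm_num)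
  have aq : arc (node 0 l) q = 3 / 8 := arc_add_coe _ (by norm_num) (by norm_num)
  have aa : ∀ d : ℤ, 0 ≤ d → d ≤ 3 → arc (node 0 l) (node 1 (3 * l + d)) = d / 6 := by
    intro d h0 h1
    rw [e1, arc_node 1 (by omega) (by omega)]
    push_cast
    ring
  have ha0 := aa 0 (by norm_num) (by norm_num)
  have ha1 := aa 1 (by norm_num) (by norm_num)
  have ha2 := aa 2 (by norm_num) (by norm_num)
  have ha3 := aa 3 (by norm_num) (by norm_num)
  rw [add_zero] at ha0
  rcases hi with rfl | rfl
  · refine hu _ _ h p (hgap p (Or.inl rfl)) q (hgap q (Or.inr rfl)) ?_ ?_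
    · rw [sbtw_base (node 0 l), ap, ha0, ha1]; norm_num
    · rw [sbtw_base (node 0 l), aq, ha0, ha1]; norm_num
  · rw [add_assoc, show (2 : ℤ) + 1 = 3 by norm_num] at h
    refine hu _ _ h q (hgap q (Or.inr rfl)) p (hgap p (Or.inl rfl)) ?_ ?_
    · rw [sbtw_base (node 0 l), aq, ha2, ha3]; norm_num
    · rw [sbtw_base (node 0 l), ap, ha2, ha3]; norm_num

/-- Close preimages of the endpoints of a cell are the endpoints of a cell of the next level; for a
half circle either orientation is possible. -/
theorem eq_node_of_sig_cell {x y : Angle} {n : ℕ} {j : ℤ} (hxy : ‖y - x‖ ≤ 1 / 6)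
    (hx : sig 3 x = node n j) (hy : sig 3 y = node n (j + 1)) :
    (∃ k : ℤ, x = node (n + 1) (j + k * (2 * 3 ^ n)) ∧
      y = node (n + 1) (j + k * (2 * 3 ^ n) + 1)) ∨
    (n = 0 ∧ ∃ i, x = node 1 (i + 1) ∧ y = node 1 i) := by
  obtain ⟨s, hs, hsy⟩ : ∃ s : ℝ, |s| ≤ 1 / 6 ∧ (s : Angle) = y - x := by
    obtain ⟨t, -, ht⟩ := AddCircle.eq_coe_Ico (p := (1 : ℝ)) (y - x)
    refine ⟨t - round t, ?_, ?_⟩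
    · rwa [← ht, UnitAddCircle.norm_eq] at hxy
    · rw [← ht, eq_comm, coe_eq_coe_iff]; exact ⟨-round t, by push_cast; ring⟩
  rw [abs_le] at hs
  have hyx : y = x + (s : Angle) := by rw [hsy]; abel
  rw [hyx, sig_add_coe, hx, node_succ, add_left_cancel_iff, eq_comm, coe_eq_coe_iff] at hy
  obtain ⟨k, hk⟩ := hy
  have hL := arc_cell_le_half n j
  have hL0 := arc_cell_pos n j
  rw [arc_cell] at hL hL0
  obtain ⟨k', rfl⟩ := eq_node_of_sig hx
  have hk1 : -2 < k := by
    have : (-2 : ℝ) < k := by linarith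
    exact_mod_cast this
  have hk2 : k < 1 := by
    have : (k : ℝ) < 1 := by linarith
    exact_mod_cast this
  obtain rfl | rfl : k = 0 ∨ k = -1 := by omega
  · refine Or.inl ⟨k', rfl, ?_⟩
    rw [hyx, node_succ]
    congr 2
    rw [pow_succ]
    push_cast at hk
    field_simp at hk ⊢
    linarith
  · have hs6 : s = -(1 / 6) := by push_cast at hk; linarith
    have hn : n = 0 := by
      by_contra hn
      obtain ⟨d, rfl⟩ := Nat.exists_eq_add_one_of_ne_zero hn
      have h6 := arc_cell_succ_le d j
      rw [arc_cell] at h6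
      push_cast at hk
      linarith
    subst hn
    refine Or.inr ⟨rfl, j + k' * (2 * 3 ^ 0) - 1, by rw [sub_add_cancel], ?_⟩
    have := node_succ 1 (j + k' * (2 * 3 ^ 0) - 1)
    rw [sub_add_cancel] at this
    rw [hyx, hs6, zero_add, this, add_assoc, ← AddCircle.coe_add]
    norm_num

/-- If laminations with the two special gaps identify two points, then so does the lamination with
both: along the orbits of any other pair, both holes force the distance to be at most `1/6`. -/
theorem abRel_of_rel {r : ℤ → Setoid Angle} (hr : ∀ e, IsCubicLamination (r e))
    (hg : ∀ e, IsGapBasis (r e) (gapSet e)) {x y : Angle} (h : ∀ e, r e x y) : abRel x y := by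
  have hclose : ∀ {u v : Angle}, (∀ e, r e u v) → ¬ abRel u v → ‖u - v‖ ≤ 1 / 6 := by
    intro u v huv hab
    have hne : u ≠ v := fun h => hab (Or.inl h)
    rcases subset_cell_or_pair (S := {u, v}) fun e => by
      obtain ⟨a, b, hh, hs⟩ := (hg e).exists_hole_of_cls (hr e).lamination (x := u)
        ⟨u, mem_cls_self _ _, v, huv e, hne⟩
      refine ⟨a, b, hh, ?_⟩
      rintro _ (rfl | rfl)
      · exact hs (mem_cls_self _ _)
      · exact hs (huv e) with ⟨m, k, hS⟩ | hS
    · exact norm_le_sixth_of_closedArc (arc_cell_succ_le m k) (hS (Or.inl rfl)) (hS (Or.inr rfl))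
    · have hrel : abRel (node 0 0) (node 0 1) := abRel_node (n := 0) (j := 0) (Or.inl rfl)
      rcases hS (Or.inl rfl : u ∈ ({u, v} : Set Angle)) with h1 | h1 <;>
        rcases hS (Or.inr rfl : v ∈ ({u, v} : Set Angle)) with h2 | h2
      · exact absurd (h1.trans h2.symm) hne
      · exact absurd (h1 ▸ h2 ▸ hrel) hab
      · exact absurd (h1 ▸ h2 ▸ hrel.symm) hab
      · exact absurd (h1.trans h2.symm) hne
  have hcell : ∀ i, (∀ e, r e (node 1 i) (node 1 (i + 1))) → abRel (node 1 i) (node 1 (i + 1)) := by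
    intro i hi
    by_cases h3 : i % 3 = 1
    · exact abRel_node (Or.inr h3)
    · exact absurd (hi _) (not_rel_outer (l := i / 3) (hg _).unseparated (by omega))
  have hpull : ∀ {u v : Angle} {n : ℕ} {j : ℤ}, (∀ e, r e u v) → ‖v - u‖ ≤ 1 / 6 → IsMiddle n j →
      sig 3 u = node n j → sig 3 v = node n (j + 1) → abRel u v := by
    intro u v n j huv hd hj hu hv
    rcases eq_node_of_sig_cell hd hu hv with ⟨k, rfl, rfl⟩ | ⟨rfl, i, rfl, rfl⟩
    · cases n with
      | zero => exact hcell _ huv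
      | succ n =>
        refine abRel_node (Or.inr ?_)
        have := hj.resolve_left (by omega)
        rw [pow_succ, show j + k * (2 * (3 ^ n * 3)) = j + 3 * (k * (2 * 3 ^ n)) by ring]
        omega
    · exact (hcell i fun e => (r e).symm (huv e)).symm
  have hstep : ∀ {u v : Angle}, (∀ e, r e u v) → ¬ abRel u v → ¬ abRel (sig 3 u) (sig 3 v) := by
    intro u v huv hab hs
    have hd := hclose huv hab
    rcases hs with hs | ⟨n, j, hj, ⟨h1, h2⟩ | ⟨h1, h2⟩⟩
    · have h3 := norm_three_nsmul hd
      rw [nsmul_sub, ← sig_apply, ← sig_apply, hs, sub_self, norm_zero] at h3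
      exact hab (Or.inl (sub_eq_zero.1 (norm_eq_zero.1 (by linarith))))
    · exact hab (hpull huv (by rwa [norm_sub_rev]) hj h1 h2)
    · exact hab (hpull (fun e => (r e).symm (huv e)) hd hj h2 h1).symm
  by_contra hab
  have horbit : ∀ n : ℕ, (∀ e, r e ((sig 3)^[n] x) ((sig 3)^[n] y)) ∧
      ¬ abRel ((sig 3)^[n] x) ((sig 3)^[n] y) := by
    intro n
    induction n with
    | zero => exact ⟨h, hab⟩
    | succ n ih =>
      rw [Function.iterate_succ_apply', Function.iterate_succ_apply']
      exact ⟨fun e => (hr e).rel_sig (ih.1 e), hstep ih.1 ih.2⟩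
  exact false_of_norm_le (fun h => hab (Or.inl h)) fun n _ => hclose (horbit n).1 (horbit n).2

theorem eq_abSetoid {r : Setoid Angle} (hr : IsCubicLamination r)
    (hg : ∀ e, IsGapBasis r (gapSet e)) : r = abSetoid := by
  have hsub : ∀ {x y}, r x y → abRel x y := fun h =>
    abRel_of_rel (fun _ => hr) hg fun _ => h
  have hnode : ∀ n j, IsMiddle n j → r (node n j) (node n (j + 1)) := by
    intro n
    induction n with
    | zero => exact fun j _ => (hg j).rel_of_isHole _ _ (isHole_gapSet_zero j)
    | succ n ih =>
      intro j hj
      have h1 := ih j (Or.inr (hj.resolve_left (by omega)))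
      have h2 : node n (j + 1) ∈ sig 3 '' cls r (node (n + 1) j) := by
        rw [hr.image_cls, sig_node_succ]; exact h1
      obtain ⟨d, hd, hsd⟩ := h2
      have hne : node (n + 1) j ≠ d := fun h => by
        rw [← h, sig_node_succ] at hsd
        exact node_ne n j hsd
      rwa [(abRel_node hj).eq_of_ne (hsub hd) (node_ne _ _) hne]
  ext x y
  refine ⟨hsub, ?_⟩
  rintro (rfl | ⟨n, j, hj, ⟨rfl, rfl⟩ | ⟨rfl, rfl⟩⟩)
  · exact r.refl _
  · exact hnode n j hj
  · exact r.symm (hnode n j hj)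

theorem cls_ab_eq_of_forall {r : ℤ → Setoid Angle} (hr : ∀ e, IsCubicLamination (r e))
    (hg : ∀ e, IsGapBasis (r e) (gapSet e)) {x : Angle} {S : Set Angle}
    (hS : ∀ e, S = cls (r e) x) (hn : S.Nontrivial) : cls abSetoid x = S := by
  have hsub : S ⊆ cls abSetoid x := fun y hy =>
    abRel_of_rel hr hg fun e => by
      rw [hS e] at hy
      exact hy
  refine Subset.antisymm ?_ hsub
  obtain ⟨y, hy, hyx⟩ := hn.exists_ne x
  rw [cls_ab_subset (hsub hy) hyx.symm]
  rintro _ (rfl | rfl)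
  · rw [hS 0]; exact mem_cls_self _ _
  · exact hy

/-- A set within a cell cannot be separated by a coarser cell. -/
theorem not_sbtw_of_closedArc {a b c d x y : Angle} (hx : x ∈ closedArc c d)
    (hy : y ∈ closedArc c d) (ha : ¬ sbtw c a d) (hb : ¬ sbtw c b d) (hxs : sbtw a x b) :
    ¬ sbtw b y a := by
  rw [closedArc, mem_ofPred_eq] at hx hy
  rw [sbtw_base c] at ha hb hxs ⊢
  have := arc_self c
  have := arc_nonneg c a
  have := arc_nonneg c b
  have := arc_nonneg c x
  have := arc_nonneg c y
  have := arc_nonneg c d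
  grind

/-- A finer cell that meets a closed cell is contained in it. -/
theorem arc_le_of_sbtw {a b c d x : Angle} (hx : x ∈ closedArc c d)
    (hc : ¬ sbtw a c b) (hd : ¬ sbtw a d b) (hxs : sbtw a x b) :
    arc c a ≤ arc c d ∧ arc c b ≤ arc c d := by
  rw [closedArc, mem_ofPred_eq] at hx
  rw [sbtw_base c] at hc hd hxs
  have := arc_self c
  have := arc_nonneg c a
  have := arc_nonneg c b
  have := arc_nonneg c x
  have := arc_nonneg c d
  grind

theorem sbtw_sig_of_closedArc {a b c d x : Angle} (hcd : arc c d ≤ 1 / 6) (ha : arc c a ≤ arc c d)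
    (hb : arc c b ≤ arc c d) (hx : arc c x ≤ arc c d) (hs : sbtw a x b) :
    sbtw (sig 3 a) (sig 3 x) (sig 3 b) := by
  have key : ∀ z, arc c z ≤ arc c d → arc (sig 3 c) (sig 3 z) = 3 * arc c z := by
    intro z hz
    have := arc_nonneg c z
    rw [arc_sig 0 (by push_cast; linarith) (by push_cast; linarith)]
    push_cast
    ring
  rw [sbtw_base c] at hs
  rw [sbtw_base (sig 3 c), key a ha, key b hb, key x hx]
  rcases hs with ⟨h1, h2⟩ | ⟨h1, h2⟩ | ⟨h1, h2⟩
  · exact Or.inl ⟨by linarith, by linarith⟩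
  · exact Or.inr (Or.inl ⟨by linarith, by linarith⟩)
  · exact Or.inr (Or.inr ⟨by linarith, by linarith⟩)

/-- By induction on the level: a cell that separates two points of `S` is mapped to a cell that
separates two points of `σ(S)`, because `S` lies behind a short hole of each special gap unless it
is the basis of one of them. -/
theorem unseparated_ab_of_forall {r : ℤ → Setoid Angle} (hr : ∀ e, IsCubicLamination (r e))
    (hg : ∀ e, IsGapBasis (r e) (gapSet e)) {S : Set Angle} (hS : ∀ e, IsGapBasis (r e) S) :
    Unseparated abSetoid S := by
  refine unseparated_ab_of_cell fun n => ?_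
  induction n generalizing S with
  | zero =>
    exact fun j _ x hx y hy =>
      (hS j).unseparated _ _ ((hg j).rel_of_isHole _ _ (isHole_gapSet_zero j)) x hx y hy
  | succ n ih =>
    intro j hj x hx y hy hxs hys
    by_cases hsub : ∃ e, S ⊆ gapSet e
    · obtain ⟨e, he⟩ := hsub
      rw [(hS e).eq_of_subset (hg e) he] at hx hy
      exact unseparated_gapSet e _ _ (abRel_node hj) x hx y hy hxs hys
    push Not at hsub
    rcases subset_cell_or_pair (S := S) fun e =>
      ((hg e).subset_or_exists_hole (hS e).unseparated).resolve_left (hsub e) with ⟨m, k, hmk⟩ | hp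
    · rcases le_total (n + 1) (m + 1) with hnm | hnm
      · exact not_sbtw_of_closedArc (hmk hx) (hmk hy) (not_sbtw_cell hnm _ _)
          (not_sbtw_cell hnm _ _) hxs hys
      · obtain ⟨ha, hb⟩ := arc_le_of_sbtw (hmk hx) (not_sbtw_cell hnm _ _)
          (not_sbtw_cell hnm _ _) hxs
        have h6 := arc_cell_succ_le m k
        have hxs' := sbtw_sig_of_closedArc h6 ha hb (hmk hx) hxs
        have hys' := sbtw_sig_of_closedArc h6 hb ha (hmk hy) hys
        rw [sig_node_succ, sig_node_succ] at hxs' hys'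
        exact ih (fun e => (hS e).image (hr e)) j (Or.inr (hj.resolve_left (by omega))) _
          (mem_image_of_mem _ hx) _ (mem_image_of_mem _ hy) hxs' hys'
    · exact (hS 0).infinite ((Set.toFinite _).subset hp)

theorem isGapBasis_ab_of_forall {r : ℤ → Setoid Angle} (hr : ∀ e, IsCubicLamination (r e))
    (hg : ∀ e, IsGapBasis (r e) (gapSet e)) {S : Set Angle} (hS : ∀ e, IsGapBasis (r e) S) :
    IsGapBasis abSetoid S where
  closed := (hS 0).closed
  infinite := (hS 0).infinite
  rel_of_isHole := fun _ _ h => abRel_of_rel hr hg fun e => (hS e).rel_of_isHole _ _ h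
  unseparated := unseparated_ab_of_forall hr hg hS

/-! ### Invariant quadratic gaps with a common class or gap -/

theorem basis_image_pt (Q : Set Angle) : basis (pt '' Q) = Q := by
  ext x
  exact pt_injective.mem_set_image

theorem IsClassOrInfiniteGap.common {r₁ r₂ : Setoid Angle} (hr₁ : IsLamination r₁)
    (hr₂ : IsLamination r₂) {A : Set ℂ} (h₁ : IsClassOrInfiniteGap r₁ A)
    (h₂ : IsClassOrInfiniteGap r₂ A) :
    ∃ S, ((∃ x, S = cls r₁ x ∧ S = cls r₂ x ∧ S.Nontrivial) ∧ A = pt '' S) ∨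
      ((IsGapBasis r₁ S ∧ IsGapBasis r₂ S) ∧ A = convexHull ℝ (pt '' S)) := by
  have hmix : ∀ {r r' : Setoid Angle}, IsLamination r → IsNondegenerateClass r A →
      ¬ IsInfiniteGap r' A := by
    rintro r r' hr ⟨x, -, rfl⟩ hA
    have := hA.2
    rw [basis_image_pt] at this
    exact this (hr.finite x)
  rcases h₁ with h₁ | h₁ <;> rcases h₂ with h₂ | h₂
  · obtain ⟨x, hx, rfl⟩ := h₁
    obtain ⟨y, -, hxy⟩ := h₂
    have he := pt_injective.image_injective hxy
    refine ⟨cls r₁ x, Or.inl ⟨⟨x, rfl, ?_, hx⟩, rfl⟩⟩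
    have : x ∈ cls r₂ y := he ▸ mem_cls_self r₁ x
    rw [he, cls_eq_of_rel this]
  · exact absurd h₂ (hmix hr₁ h₁)
  · exact absurd h₁ (hmix hr₂ h₂)
  · exact ⟨basis A, Or.inr ⟨⟨(h₁.isGapBasis hr₁).1, (h₂.isGapBasis hr₂).1⟩,
      (h₁.isGapBasis hr₁).2⟩⟩

theorem eq_node_zero_of_fixed {x : Angle} (h : sig 3 x = x) : ∃ e, x = node 0 e := by
  obtain ⟨t, -, rfl⟩ := AddCircle.eq_coe_Ico (p := (1 : ℝ)) x
  rw [sig_apply, ← AddCircle.coe_nsmul, eq_comm, coe_eq_coe_iff] at h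
  obtain ⟨k, hk⟩ := h
  refine ⟨k, ?_⟩
  rw [nsmul_eq_mul] at hk
  push_cast at hk
  rw [node]
  congr 1
  rw [pow_zero]
  linarith

/-- Only the two special gaps have a major hole of length `1/2`. -/
theorem IsMajor.eq_gapSet {X : Set Angle} {m m' : Angle} (h : IsMajor X m m')
    (hl : arc m m' = 1 / 2) : ∃ e, X = gapSet e := by
  obtain ⟨e, rfl⟩ := eq_node_zero_of_fixed (h.fixed_of_half hl)
  have : m' = node 0 (e + 1) := by
    rw [← add_arc (node 0 e) m', hl, node_succ]
    norm_num
  subst this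
  exact ⟨e, h.eq_avoiding⟩

theorem IsClassOrInfiniteGap.ab {r₁ r₂ : Setoid Angle} (hr₁ : IsCubicLamination r₁)
    (hr₂ : IsCubicLamination r₂) {e f : ℤ} (h₁ : IsGapBasis r₁ (gapSet e))
    (h₂ : IsGapBasis r₂ (gapSet f)) (hef : e % 2 ≠ f % 2) {A : Set ℂ}
    (hA₁ : IsClassOrInfiniteGap r₁ A) (hA₂ : IsClassOrInfiniteGap r₂ A) :
    IsClassOrInfiniteGap abSetoid A := by
  set r : ℤ → Setoid Angle := fun i => if i % 2 = e % 2 then r₁ else r₂ with hrdef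
  have hr : ∀ i, IsCubicLamination (r i) := by
    intro i
    simp only [hrdef]
    split_ifs
    · exact hr₁
    · exact hr₂
  have hg : ∀ i, IsGapBasis (r i) (gapSet i) := by
    intro i
    simp only [hrdef]
    split_ifs with hi
    · rw [gapSet_congr hi]; exact h₁
    · rw [gapSet_congr (by omega : i % 2 = f % 2)]; exact h₂
  obtain ⟨S, ⟨⟨x, hx₁, hx₂, hn⟩, rfl⟩ | ⟨⟨hS₁, hS₂⟩, rfl⟩⟩ :=
    hA₁.common hr₁.lamination hr₂.lamination hA₂
  · have := cls_ab_eq_of_forall hr hg (x := x) (S := S) (fun i => by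
      simp only [hrdef]
      split_ifs
      · exact hx₁
      · exact hx₂) hn
    exact Or.inl ⟨x, this ▸ hn, by rw [this]⟩
  · refine Or.inr (isGapBasis_ab_of_forall hr hg fun i => ?_).isInfiniteGap
    simp only [hrdef]
    split_ifs
    · exact hS₁
    · exact hS₂

theorem convexHull_gapSet_cases (e : ℤ) :
    (e % 2 = 1 ∧ convexHull ℝ (pt '' gapSet e) = FGa) ∨
      (e % 2 = 0 ∧ convexHull ℝ (pt '' gapSet e) = FGb) := by
  rcases Int.emod_two_eq_zero_or_one e with h | h
  · exact Or.inr ⟨h, by rw [FGb_eq, gapSet_congr (by omega : e % 2 = 0 % 2)]⟩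
  · exact Or.inl ⟨h, by rw [FGa_eq, gapSet_congr (by omega : e % 2 = 1 % 2)]⟩

theorem eq_or_exception {r₁ r₂ : Setoid Angle} {A U₁ U₂ : Set ℂ} (hr₁ : IsCubicLamination r₁)
    (hr₂ : IsCubicLamination r₂) (hA₁ : IsClassOrInfiniteGap r₁ A)
    (hA₂ : IsClassOrInfiniteGap r₂ A) (hU₁ : IsInvariantQuadraticGap r₁ U₁)
    (hU₂ : IsInvariantQuadraticGap r₂ U₂) :
    U₁ = U₂ ∨ (IsClassOrInfiniteGap abSetoid A ∧
      ((U₁ = FGa ∧ U₂ = FGb) ∨ (U₁ = FGb ∧ U₂ = FGa))) := by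
  obtain ⟨hX, hXU⟩ := hU₁.infiniteGap.isGapBasis hr₁.lamination
  obtain ⟨hY, hYU⟩ := hU₂.infiniteGap.isGapBasis hr₂.lamination
  obtain ⟨m, m', hm⟩ := hU₁.exists_isMajor hr₁.lamination
  obtain ⟨p, p', hp⟩ := hU₂.exists_isMajor hr₂.lamination
  obtain ⟨S, hS⟩ := hA₁.common hr₁.lamination hr₂.lamination hA₂
  rcases hm.eq_or_half hr₁ hr₂ hX hY hp (hS.imp And.left And.left) with ⟨rfl, rfl⟩ | ⟨h₁, h₂⟩
  · left
    rw [hXU, hYU, hm.eq_avoiding, hp.eq_avoiding]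
  · obtain ⟨e, he⟩ := hm.eq_gapSet h₁
    obtain ⟨f, hf⟩ := hp.eq_gapSet h₂
    rw [he] at hX hXU
    rw [hf] at hY hYU
    by_cases hef : e % 2 = f % 2
    · left
      rw [hXU, hYU, gapSet_congr hef]
    · refine Or.inr ⟨IsClassOrInfiniteGap.ab hr₁ hr₂ hX hY hef hA₁ hA₂, ?_⟩
      rcases convexHull_gapSet_cases e with ⟨h1, h2⟩ | ⟨h1, h2⟩ <;>
        rcases convexHull_gapSet_cases f with ⟨h3, h4⟩ | ⟨h3, h4⟩
      · omega
      · exact Or.inl ⟨hXU.trans h2, hYU.trans h4⟩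
      · exact Or.inr ⟨hXU.trans h2, hYU.trans h4⟩
      · omega

theorem eq_abSetoid_of_isGap {r : Setoid Angle} (hr : IsCubicLamination r) (ha : IsGap r FGa)
    (hb : IsGap r FGb) : r = abSetoid := by
  have key : ∀ e, IsGap r (convexHull ℝ (pt '' gapSet e)) → IsGapBasis r (gapSet e) := by
    intro e he
    have hinf : IsInfiniteGap r (convexHull ℝ (pt '' gapSet e)) :=
      ⟨he, by rw [basis_hull_gapSet]; exact infinite_gapSet e⟩
    have := (hinf.isGapBasis hr.lamination).1
    rwa [basis_hull_gapSet] at this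
  refine eq_abSetoid hr fun e => key e ?_
  rcases convexHull_gapSet_cases e with ⟨-, h⟩ | ⟨-, h⟩
  · rwa [h]
  · rwa [h]

end CubicLam

end

theorem lemmal :
    ∃ ab : Setoid CubicLam.Angle,
      -- `ab` is the unique lamination that has both special gaps as gaps
      (CubicLam.IsCubicLamination ab ∧
        CubicLam.IsGap ab CubicLam.FGa ∧ CubicLam.IsGap ab CubicLam.FGb) ∧
      (∀ r : Setoid CubicLam.Angle, CubicLam.IsCubicLamination r →
        CubicLam.IsGap r CubicLam.FGa → CubicLam.IsGap r CubicLam.FGb → r = ab) ∧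
      -- the invariant quadratic gaps coincide, with one possible exception
      (∀ (r₁ r₂ : Setoid CubicLam.Angle) (A U₁ U₂ : Set ℂ),
        CubicLam.IsCubicLamination r₁ → CubicLam.IsCubicLamination r₂ →
        CubicLam.IsClassOrInfiniteGap r₁ A → CubicLam.IsClassOrInfiniteGap r₂ A →
        CubicLam.IsInvariantQuadraticGap r₁ U₁ → CubicLam.IsInvariantQuadraticGap r₂ U₂ →
        U₁ = U₂ ∨
          (CubicLam.IsClassOrInfiniteGap ab A ∧
            ((U₁ = CubicLam.FGa ∧ U₂ = CubicLam.FGb) ∨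
              (U₁ = CubicLam.FGb ∧ U₂ = CubicLam.FGa)))) ∧
      -- the exception occurs for every class or infinite gap `A` of `ab`, in either order:
      -- `r₁ = r₂ = ab` has two different invariant quadratic gaps
      (CubicLam.FGa ≠ CubicLam.FGb ∧
        CubicLam.IsInvariantQuadraticGap ab CubicLam.FGa ∧
        CubicLam.IsInvariantQuadraticGap ab CubicLam.FGb) := by
  have ha : CubicLam.IsInvariantQuadraticGap CubicLam.abSetoid CubicLam.FGa :=
    CubicLam.FGa_eq ▸ CubicLam.isInvariantQuadraticGap_gapSet 1
  have hb : CubicLam.IsInvariantQuadraticGap CubicLam.abSetoid CubicLam.FGb :=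
    CubicLam.FGb_eq ▸ CubicLam.isInvariantQuadraticGap_gapSet 0
  exact ⟨CubicLam.abSetoid,
    ⟨CubicLam.isCubicLamination_ab, ha.infiniteGap.1, hb.infiniteGap.1⟩,
    fun _ hr hra hrb => CubicLam.eq_abSetoid_of_isGap hr hra hrb,
    fun _ _ _ _ _ hr₁ hr₂ hA₁ hA₂ hU₁ hU₂ =>
      CubicLam.eq_or_exception hr₁ hr₂ hA₁ hA₂ hU₁ hU₂,
    CubicLam.FGa_ne_FGb, ha, hb⟩
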